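/- Let $n\ge 0$, $p\in\mathbb Z$, $q\in\mathbb Z_{\ge0}$, let $\mathbb S^1=\{|\lambda|=1\}\subset\mathbb C$, $\mathbb T^n=(\mathbb R/2\pi\mathbb Z)^n$, $\mathrm x=(\mathrm x_0,\dots,\mathrm x_n)=(\lambda,x_1,\dots,x_n)$. **Setting.** Let $\bar{\mathcal G}$ be the Lie algebra of vector fields $\bar a=a_0(x;\lambda)\frac{\partial}{\partial\lambda}+\sum_{j=1}^n a_j(x;\lambda)\frac{\partial}{\partial x_j}$ with coefficients in $C^\infty(\mathbb S^1\times\mathbb T^n;\mathbb C)$ (along $\mathbb S^1$, $\lambda=e^{i\theta}$, $\partial/\partial\lambda=(i\lambda)^{-1}\partial/\partial\theta$), with the commutator $[\bar a,\bar b]_j=\sum_{i}(a_i\,\partial b_j/\partial \mathrm x_i-b_i\,\partial a_j/\partial \mathrm x_i)$. Writing $a=\sum_{k\in\mathbb Z}a_k(x)\lambda^k$, put $P_+a=a_+=\sum_{k\ge0}a_k\lambda^k$ (which extends holomorphically to $|\lambda|<1$) and $P_-a=a-a_+$ (which extends holomorphically to $|\lambda|>1$ and vanishes at $\infty$); let $\mathcal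 R=(P_+-P_-)/2$ and $[\bar a,\bar b]_{\mathcal R}=[\mathcal R\bar a,\bar b]+[\bar a,\mathcal R\bar b]$. The space $\bar{\mathcal G}^*$ consists of the forms $\bar l=l_0\,d\lambda+\sum_{j=1}^n l_j\,dx_j$ with $l_j\in C^\infty(\mathbb S^1\times\mathbb T^n;\mathbb C)$ and is paired with $\bar{\mathcal G}$ by $$(\bar l,\bar a)=\frac1{2\pi i}\oint_{\mathbb S^1}\lambda^{-p}\,d\lambda\ \sum_{j=0}^n\sum_{\alpha\in\mathbb Z_{\ge0}^n,\ |\alpha|\le q}\int_{\mathbb T^n}\partial_x^\alpha l_j\ \partial_x^\alpha a_j\,dx .$$ The coadjoint action is defined by $(ad^*_{\bar a}\bar l,\bar b)=-(\bar l,[\bar a,\bar b])$ for all $\bar b\in\bar{\mathcal G}$. A smooth family of elements of $\bar{\mathcal G}$ or $\bar{\mathcal G}^*$ over an open subset of $\mathbb R^k$ is one whose coefficients are jointly smooth in the parameters and in $(\lambda,x)$. A set $U\subseteq\bar{\mathcal G}^*$ is open if its preimage under every smooth family is open; maps on $U$ are smooth if they are smooth along all smooth families in $U$. The gradient $\nabla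 f:U\to\bar{\mathcal G}$ of a smooth function $f:U\to\mathbb C$ is a smooth map with $\frac{d}{ds}f(\bar l(s))=(\frac{d\bar l}{ds},\nabla f(\bar l(s)))$ along every smooth curve in $U$; $\mathrm D(U)$ denotes the smooth functions that have a gradient, and $\{f,g\}_{\mathcal R}(\bar l)=(\bar l,[\nabla f(\bar l),\nabla g(\bar l)]_{\mathcal R})$. A Casimir function on $U$ is an $h\in\mathrm D(U)$ with $ad^*_{\nabla h(\bar l)}\bar l=0$ for all $\bar l\in U$. Write $\nabla h_+(\bar l)=(\nabla h(\bar l))_+$ and let $\bar A_{\nabla h_+}=\sum_{j=0}^n(\nabla h_+)_j\,\partial/\partial\mathrm x_j$ be the corresponding vector field. **Proposition.** Let $U\subseteq\bar{\mathcal G}^*$ be open (for instance $U=\bar{\mathcal G}^*$) and let $h^{(y)},h^{(t)}$ be Casimir functions on $U$. Consider on $U$ the dynamical systems $$\partial\bar l/\partial y=X_y(\bar l):=-ad^*_{\nabla h^{(y)}_+(\bar l)}\bar l,\qquad \partial\bar l/\partial t=X_t(\bar l):=-ad^*_{\nabla h^{(t)}_+(\bar l)}\bar l .$$ 1. $X_y$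 and $X_t$ are well-defined smooth vector fields on $U$. They are Hamiltonian with respect to $\{\cdot,\cdot\}_{\mathcal R}$: for every $f\in\mathrm D(U)$ the derivative of $f$ along $X_y$ is $\{h^{(y)},f\}_{\mathcal R}$ and along $X_t$ is $\{h^{(t)},f\}_{\mathcal R}$. They commute: $\{h^{(y)},h^{(t)}\}_{\mathcal R}=0$ on $U$, and the commutator of the vector fields $X_y$ and $X_t$ vanishes on $U$. 2. Let $\bar l(t,y)\in U$ be a smooth family over an open set $W\subseteq\mathbb R^2$. Let $\Omega=\{|\lambda|<1\}$, or let $\Omega=\mathbb C$ if $\nabla h^{(t)}_+(\bar l)$ and $\nabla h^{(y)}_+(\bar l)$ are polynomials in $\lambda$ of degree bounded uniformly on $W$. Call the linear system $$(\partial/\partial t+\bar A_{\nabla h^{(t)}_+})\psi=0,\qquad(\partial/\partial y+\bar A_{\nabla h^{(y)}_+})\psi=0\qquad(*)$$ compatible if $[\partial/\partial t+\bar A_{\nabla h^{(t)}_+},\ \partial/\partial y+\bar A_{\nabla h^{(y)}_+}]\psi=0$ on $W\times\Omega\times\mathbb T^n$ for all $\psi\in C^\infty(\mathbb R^2\times\mathbb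 C\times\mathbb T^n;\mathbb C)$, where $\partial/\partial\lambda$ acts on $\psi$ as the Wirtinger derivative. Then: * $(*)$ is compatible if and only if the Lax relation $\frac{\partial}{\partial y}\bar A_{\nabla h^{(t)}_+}-\frac{\partial}{\partial t}\bar A_{\nabla h^{(y)}_+}=[\bar A_{\nabla h^{(t)}_+},\bar A_{\nabla h^{(y)}_+}]$ holds on $W$; * if near every point of $W\times\Omega\times\mathbb T^n$ the system $(*)$ has $n+1$ smooth solutions whose Jacobian with respect to $(\lambda,x)$ does not vanish at that point, then $(*)$ is compatible; * if $\bar l(t,y)$ solves both dynamical systems on $W$, then the flows are compatible along it, i.e. $\partial_y\big(X_t(\bar l)\big)=\partial_t\big(X_y(\bar l)\big)$ on $W$, the Lax relation holds on $W$, and this compatibility of the flows is equivalent to the compatibility of $(*)$. -/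

import Mathlib

open scoped ContDiff

noncomputable section

namespace HolLoop

/-- Universal cover of `S¹ × Tⁿ`: the coordinate `0` is the angle `θ` of `λ = exp (iθ)`, the
coordinates `1, …, n` are the coordinates of the torus `Tⁿ = ℝⁿ / (2πℤ)ⁿ`. -/
abbrev Pt (n : ℕ) := Fin (n + 1) → ℝ

/-- Coefficients `(a₀, a₁, …, aₙ)` of a vector field `a₀ ∂/∂λ + ∑ aⱼ ∂/∂xⱼ`, or
`(l₀, l₁, …, lₙ)` of a one-form `l₀ dλ + ∑ lⱼ dxⱼ`, along `S¹ × Tⁿ`. -/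
abbrev Coeffs (n : ℕ) := Pt n → Fin (n + 1) → ℂ

variable {n : ℕ}

/-- The coefficients are smooth and `2π`-periodic in every coordinate, i.e. they are smooth
functions on `S¹ × Tⁿ`. The elements of the loop algebra, and of its regular dual, are these. -/
def IsLoop (a : Coeffs n) : Prop :=
  ContDiff ℝ ∞ a ∧ ∀ (i : Fin (n + 1)) (z : Pt n), a (z + Pi.single i (2 * Real.pi)) = a z

/-- The value of the spectral parameter `λ`. -/
def lam (z : Pt n) : ℂ := Complex.exp (Complex.I * (z 0 : ℂ))

/-- Real partial derivative in the coordinate `i`. -/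
def pd (i : Fin (n + 1)) (f : Pt n → ℂ) : Pt n → ℂ := fun z => fderiv ℝ f z (Pi.single i 1)

/-- The derivations `∂/∂λ = (iλ)⁻¹ ∂/∂θ` (index `0`) and `∂/∂xⱼ` (index `j ≥ 1`). -/
def dd (i : Fin (n + 1)) (f : Pt n → ℂ) : Pt n → ℂ := fun z =>
  if i = 0 then (Complex.I * lam z)⁻¹ * pd 0 f z else pd i f z

/-- The commutator of vector fields. -/
def bracket (a b : Coeffs n) : Coeffs n := fun z j =>
  ∑ i, (a z i * dd i (fun w => b w j) z - b z i * dd i (fun w => a w j) z)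

/-- `∂^{|α|} / ∂x^α` for a multi-index `α` in the torus variables. -/
def dMulti (α : Fin n → ℕ) (f : Pt n → ℂ) : Pt n → ℂ :=
  (List.finRange n).foldr (fun i g => (pd i.succ)^[α i] g) f

/-- The multi-indices with `|α| ≤ q`. -/
def multiIndices (n q : ℕ) : Finset (Fin n → ℕ) :=
  (Fintype.piFinset fun _ : Fin n => Finset.range (q + 1)).filter fun α => ∑ i, α i ≤ q

/-- The pairing `(2πi)⁻¹ ∮ λ^{-p} dλ (l, a)_{H^q}`, with `dλ = iλ dθ` and
`(l, a)_{H^q} = ∑ⱼ ∑_{|α| ≤ q} ∫ ∂^α lⱼ ∂^α aⱼ dx`. -/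
def pairing (p : ℤ) (q : ℕ) (l a : Coeffs n) : ℂ :=
  (2 * Real.pi * Complex.I)⁻¹ *
    ∫ z in Set.Icc (0 : Pt n) (fun _ => 2 * Real.pi),
      lam z ^ (-p) * (Complex.I * lam z) *
        ∑ j, ∑ α ∈ multiIndices n q,
          dMulti α (fun w => l w j) z * dMulti α (fun w => a w j) z

/-- `m = ad*_a l`, where `(ad*_a l, b) = -(l, [a, b])` for all `b`. -/
def IsCoadjoint (p : ℤ) (q : ℕ) (a l m : Coeffs n) : Prop :=
  IsLoop m ∧ ∀ b, IsLoop b → pairing p q m b = -pairing p q l (bracket a b)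

open Classical in
/-- The coadjoint action `ad*_a l` of the vector field `a` on the form `l`. -/
def coad (p : ℤ) (q : ℕ) (a l : Coeffs n) : Coeffs n :=
  if h : ∃ m, IsCoadjoint p q a l m then h.choose else 0

/-- The coefficient of `λ^k` of the Laurent expansion in `λ`. -/
def lamCoeff (a : Coeffs n) (k : ℕ) (x : Fin n → ℝ) (j : Fin (n + 1)) : ℂ :=
  (2 * Real.pi : ℂ)⁻¹ * ∫ θ in (0 : ℝ)..(2 * Real.pi),
    Complex.exp (-(Complex.I * k * θ)) * a (Fin.cons θ x : Pt n) j

/-- `∑_{k ≥ 0} a_k(x) μ^k`: the extension to the interior of the circle of the part of `a` of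
nonnegative degree in the spectral parameter. -/
def plusExt (a : Coeffs n) (μ : ℂ) (x : Fin n → ℝ) (j : Fin (n + 1)) : ℂ :=
  ∑' k : ℕ, lamCoeff a k x j * μ ^ k

/-- The projection `P₊` onto the fields that extend holomorphically inside the circle. -/
def plusPart (a : Coeffs n) : Coeffs n := fun z j => plusExt a (lam z) (fun i => z i.succ) j

/-- The projection `P₋` onto the fields that extend holomorphically outside the circle and vanish
at `λ = ∞`. -/
def minusPart (a : Coeffs n) : Coeffs n := a - plusPart a

/-- The classical `R`-structure `R = (P₊ - P₋) / 2`. -/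
def rMap (a : Coeffs n) : Coeffs n := (2⁻¹ : ℂ) • (plusPart a - minusPart a)

/-- `[a, b]_R = [R a, b] + [a, R b]`. -/
def bracketR (a b : Coeffs n) : Coeffs n := bracket (rMap a) b + bracket a (rMap b)

/-- A smooth finite-dimensional family of loops, parametrized by an open set `W ⊆ ℝᵏ`. -/
def IsPlot {k : ℕ} (W : Set (Fin k → ℝ)) (c : (Fin k → ℝ) → Coeffs n) : Prop :=
  IsOpen W ∧ (∀ s ∈ W, IsLoop (c s)) ∧
    ContDiffOn ℝ ∞ (fun r : (Fin k → ℝ) × Pt n => c r.1 r.2) (W ×ˢ Set.univ)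

/-- Partial derivative of a family of loops with respect to the `i`-th parameter. -/
def dpar {k : ℕ} (i : Fin k) (c : (Fin k → ℝ) → Coeffs n) (s : Fin k → ℝ) : Coeffs n :=
  fun z j => fderiv ℝ (fun s' => c s' z j) s (Pi.single i 1)

/-- `U` is an open set of loops (for the topology that is final for the smooth families). -/
def IsOpenDomain (U : Set (Coeffs n)) : Prop :=
  (∀ l ∈ U, IsLoop l) ∧
    ∀ (k : ℕ) (W : Set (Fin k → ℝ)) (c : (Fin k → ℝ) → Coeffs n),
      IsPlot W c → IsOpen {s | s ∈ W ∧ c s ∈ U}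

/-- A map from `U` to loops is smooth if it maps smooth families to smooth families. -/
def IsSmoothMap (U : Set (Coeffs n)) (X : Coeffs n → Coeffs n) : Prop :=
  ∀ (k : ℕ) (W : Set (Fin k → ℝ)) (c : (Fin k → ℝ) → Coeffs n),
    IsPlot W c → Set.MapsTo c W U → IsPlot W (fun s => X (c s))

/-- `h` is a smooth function on `U` (it is smooth along smooth families), and `g = ∇h` is its
smooth gradient with respect to the pairing. -/
structure IsSmoothFunctional (p : ℤ) (q : ℕ) (U : Set (Coeffs n))
    (h : Coeffs n → ℂ) (g : Coeffs n → Coeffs n) : Prop where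
  smooth : ∀ (k : ℕ) (W : Set (Fin k → ℝ)) (c : (Fin k → ℝ) → Coeffs n),
    IsPlot W c → Set.MapsTo c W U → ContDiffOn ℝ ∞ (fun s => h (c s)) W
  smooth_grad : IsSmoothMap U g
  grad : ∀ (k : ℕ) (W : Set (Fin k → ℝ)) (c : (Fin k → ℝ) → Coeffs n),
    IsPlot W c → Set.MapsTo c W U → ∀ s ∈ W, ∀ i : Fin k,
      fderiv ℝ (fun s' => h (c s')) s (Pi.single i 1) = pairing p q (dpar i c s) (g (c s))

/-- `h` is a Casimir function on `U` with gradient `g`: `ad*_{∇h(l)} l = 0` for `l ∈ U`. -/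
structure IsCasimir (p : ℤ) (q : ℕ) (U : Set (Coeffs n))
    (h : Coeffs n → ℂ) (g : Coeffs n → Coeffs n) : Prop
    extends IsSmoothFunctional p q U h g where
  casimir : ∀ l ∈ U, IsCoadjoint p q (g l) l 0

/-- The bracket `{f, h}_R = (l, [∇f(l), ∇h(l)]_R)`, in terms of the gradients. -/
def poissonR (p : ℤ) (q : ℕ) (gf gh : Coeffs n → Coeffs n) (l : Coeffs n) : ℂ :=
  pairing p q l (bracketR (gf l) (gh l))

/-- The right-hand side `-ad*_{∇h₊(l)} l` of the dynamical system generated by `h`, `g = ∇h`. -/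
def flowField (p : ℤ) (q : ℕ) (g : Coeffs n → Coeffs n) (l : Coeffs n) : Coeffs n :=
  -coad p q (plusPart (g l)) l

/-- `X` is the Hamiltonian vector field of the function with gradient `g`, with respect to the
bracket `{·, ·}_R`: the derivative along `X` of any smooth function `f` is `{h, f}_R`. -/
def IsHamiltonianField (p : ℤ) (q : ℕ) (U : Set (Coeffs n)) (g X : Coeffs n → Coeffs n) : Prop :=
  ∀ (f : Coeffs n → ℂ) (gf : Coeffs n → Coeffs n), IsSmoothFunctional p q U f gf →
    ∀ l ∈ U, HasDerivAt (fun ε : ℝ => f (l + ε • X l)) (poissonR p q g gf l) 0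

/-- The vector fields `X` and `Y` on `U` commute: `DY(l)[X(l)] = DX(l)[Y(l)]`. -/
def CommuteOn (U : Set (Coeffs n)) (X Y : Coeffs n → Coeffs n) : Prop :=
  ∀ l ∈ U, ∀ (z : Pt n) (j : Fin (n + 1)),
    deriv (fun ε : ℝ => Y (l + ε • X l) z j) 0 = deriv (fun ε : ℝ => X (l + ε • Y l) z j) 0

/-! Two-parameter families `l(t, y)`: parameter `0` is `t`, parameter `1` is `y`. -/

/-- `l(t, y)` solves both dynamical systems on `W`. -/
def IsJointSolution (p : ℤ) (q : ℕ) (gt gy : Coeffs n → Coeffs n)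
    (W : Set (Fin 2 → ℝ)) (l : (Fin 2 → ℝ) → Coeffs n) : Prop :=
  ∀ s ∈ W, dpar 0 l s = flowField p q gt (l s) ∧ dpar 1 l s = flowField p q gy (l s)

/-- Compatibility of the two systems along `l(t, y)`: the two expressions for the mixed
derivative agree. -/
def FlowsCompatible (p : ℤ) (q : ℕ) (gt gy : Coeffs n → Coeffs n)
    (W : Set (Fin 2 → ℝ)) (l : (Fin 2 → ℝ) → Coeffs n) : Prop :=
  ∀ s ∈ W, dpar 1 (fun s' => flowField p q gt (l s')) s =
    dpar 0 (fun s' => flowField p q gy (l s')) s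

/-- The Lax relation `∂A_t/∂y - ∂A_y/∂t = [A_t, A_y]` for the vector fields
`A_t = ∇h^{(t)}₊(l)`, `A_y = ∇h^{(y)}₊(l)`. -/
def LaxRelation (gt gy : Coeffs n → Coeffs n)
    (W : Set (Fin 2 → ℝ)) (l : (Fin 2 → ℝ) → Coeffs n) : Prop :=
  ∀ s ∈ W, dpar 1 (fun s' => plusPart (gt (l s'))) s - dpar 0 (fun s' => plusPart (gy (l s'))) s =
    bracket (plusPart (gt (l s))) (plusPart (gy (l s)))

/-- The variables `((t, y), λ, x)` of the functions `ψ`. -/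
abbrev LaxPt (n : ℕ) := (Fin 2 → ℝ) × ℂ × (Fin n → ℝ)

/-- `∂ψ/∂λ` (index `0`, the Wirtinger derivative) and `∂ψ/∂xⱼ` (index `j ≥ 1`). -/
def vertDeriv (ψ : LaxPt n → ℂ) (r : LaxPt n) : Fin (n + 1) → ℂ :=
  Fin.cons
    (2⁻¹ * (fderiv ℝ ψ r (0, 1, 0) - Complex.I * fderiv ℝ ψ r (0, Complex.I, 0)))
    (fun j => fderiv ℝ ψ r (0, 0, Pi.single j 1))

/-- The operator `∂/∂sᵢ + A_{∇h₊(l)}` on functions `ψ(t, y, λ, x)`, where `g = ∇h`. -/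
def laxOp (i : Fin 2) (g : Coeffs n → Coeffs n) (l : (Fin 2 → ℝ) → Coeffs n)
    (ψ : LaxPt n → ℂ) : LaxPt n → ℂ := fun r =>
  fderiv ℝ ψ r (Pi.single i 1, 0, 0) +
    ∑ j, plusExt (g (l r.1)) r.2.1 r.2.2 j * vertDeriv ψ r j

/-- The domain of `λ` in the linear system: the interior of the circle, and all of `ℂ` if both
projected gradients are polynomials in `λ`. -/
def IsSpectralRegion (gt gy : Coeffs n → Coeffs n)
    (W : Set (Fin 2 → ℝ)) (l : (Fin 2 → ℝ) → Coeffs n) (Ω : Set ℂ) : Prop :=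
  Ω = Metric.ball 0 1 ∨
    (Ω = Set.univ ∧ ∃ N : ℕ, ∀ s ∈ W, ∀ k > N, ∀ (x : Fin n → ℝ) (j : Fin (n + 1)),
      lamCoeff (gt (l s)) k x j = 0 ∧ lamCoeff (gy (l s)) k x j = 0)

/-- Compatibility of `(∂/∂t + A_t) ψ = 0 = (∂/∂y + A_y) ψ`: the two operators commute on all
smooth functions on `ℝ² × ℂ × Tⁿ`, over `λ ∈ Ω`. -/
def LinearCompatible (gt gy : Coeffs n → Coeffs n)
    (W : Set (Fin 2 → ℝ)) (l : (Fin 2 → ℝ) → Coeffs n) (Ω : Set ℂ) : Prop :=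
  ∀ ψ : LaxPt n → ℂ, ContDiff ℝ ∞ ψ →
    (∀ (i : Fin n) (r : LaxPt n), ψ (r + (0, 0, Pi.single i (2 * Real.pi))) = ψ r) →
    ∀ r : LaxPt n, r.1 ∈ W → r.2.1 ∈ Ω →
      laxOp 0 gt l (laxOp 1 gy l ψ) r = laxOp 1 gy l (laxOp 0 gt l ψ) r

/-- Near every point the linear system has `n + 1` smooth solutions that are functionally
independent with respect to `(λ, x)`. -/
def HasLocalInvariants (gt gy : Coeffs n → Coeffs n)
    (W : Set (Fin 2 → ℝ)) (l : (Fin 2 → ℝ) → Coeffs n) (Ω : Set ℂ) : Prop :=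
  ∀ r : LaxPt n, r.1 ∈ W → r.2.1 ∈ Ω →
    ∃ (N : Set (LaxPt n)) (ψ : Fin (n + 1) → LaxPt n → ℂ), IsOpen N ∧ r ∈ N ∧
      (∀ i, ContDiffOn ℝ ∞ (ψ i) N) ∧
      (∀ i, ∀ r' ∈ N, laxOp 0 gt l (ψ i) r' = 0 ∧ laxOp 1 gy l (ψ i) r' = 0) ∧
      Matrix.det (Matrix.of fun i j => vertDeriv (ψ i) r j) ≠ 0

end HolLoop

end

open scoped ContDiff

noncomputable section

namespace HolLoop

open MeasureTheory Set Filter Topology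

set_option linter.unusedSectionVars false

variable {n : ℕ}

/-! ### Differentiation under integrals over compact sets. -/

section ParametricIntegral

variable {E H : Type} [NormedAddCommGroup E] [NormedSpace ℝ E] [LocallyCompactSpace E]
  [NormedAddCommGroup H] [NormedSpace ℝ H] [MeasurableSpace H] [BorelSpace H]
  [SecondCountableTopology H]
  {μ : Measure H} [IsFiniteMeasureOnCompacts μ]

/-! The algebra rests on one property of a Casimir function h: its gradient is infinitesimally
equivariant. The Casimir condition says (l, [∇h(l), b]) = 0 for every b. Differentiating this in an
arbitrary direction m, and using the symmetry of the second derivative of h, gives D∇h(l)[-ad*_b l]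
= [∇h(l), b] (`IsCasimir.dpar_grad`). Two choices of b matter. If b is the gradient of another
Casimir function, the left side is D∇h(l)[0] = 0, so gradients of Casimir functions commute
(`IsCasimir.bracket_grad`). If b is the projected gradient driving a flow, the formula says how ∇h
evolves along that flow.

Write a and b for the two gradients. Since [a, b] = 0, the bracket of their minus parts satisfies
[a, b₊] - [b, a₊] = [a₊, b₊] - [a₋, b₋]. Fields of nonnegative degree in λ and fields of negative
degree both form subalgebras, so P₊ of the right side is [a₊, b₊]. This is
`plusPart_bracket_of_commute`. Along a joint solution its left side is the difference of the
derivatives of a₊ and b₊, so it is the Lax relation; together with the Jacobi identity it also gives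
the commutation of the vector fields (`IsCasimir.commuteOn`). The Hamiltonian property and the
vanishing of the bracket follow from R a = a₊ - a/2, because the term with a is killed by the
Casimir condition.

The analysis has to show that ad* exists, is unique and depends smoothly on parameters, and that P₊
does too. Moving all derivatives to one side writes the pairing as ∫ ρ ∑ Λ(lⱼ) aⱼ, where ρ depends
only on λ and Λ has the symbol ∑ k^{2α} over |α| ≤ q, which is at least 1. A right inverse of Λ
(`IsConstOp.exists_rightInverse`) gives ad* (`exists_coadjoint`), and a test field proportional to
the conjugate gives nondegeneracy (`eq_zero_of_pairing_left`). Both Λ⁻¹ and P₊ are realised as a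
differential operator followed by averaging over translates with a continuous, absolutely convergent
Fourier kernel. Smoothness in parameters and commutation with their derivatives then reduce to
differentiation under the integral sign; `IsTorusOp` records these properties.

For the linear system, the commutator of the two operators has no second order part. Its
coefficients (`laxCurv`) are detected by the test functions λ and exp(i xⱼ), and they vanish if they
annihilate n + 1 functions with nonzero Jacobian. For fixed x and parameters they are holomorphic in
λ on Ω, continuous up to the unit circle, and on the circle they are the defect of the Lax relation.
The maximum principle and the identity theorem make vanishing on Ω equivalent to vanishing on the
circle (`eqOn_zero_specRegion_iff`, `laxRelation_iff_laxCurv`). -/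

theorem integrableOn_slice {F : Type} [NormedAddCommGroup F] [NormedSpace ℂ F]
    {V : Set E} {K : Set H} (hK : IsCompact K)
    {κ : H → ℂ} (hκ : Continuous κ) {G : E × H → F} (hG : ContinuousOn G (V ×ˢ univ))
    {x : E} (hx : x ∈ V) : IntegrableOn (fun w => κ w • G (x, w)) K μ := by
  have hc : Continuous fun w => G (x, w) :=
    hG.comp_continuous (by fun_prop) fun w => ⟨hx, mem_univ _⟩
  exact ((hκ.smul hc).continuousOn).integrableOn_compact hK

/-- A compact neighbourhood of x times K is compact. The constant C serves as the dominating
function in the two lemmas that follow. -/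
theorem exists_nhds_bound {F : Type} [NormedAddCommGroup F] {V : Set E} (hV : IsOpen V)
    {K : Set H} (hK : IsCompact K) {G : E × H → F} (hG : ContinuousOn G (V ×ˢ univ))
    {x : E} (hx : x ∈ V) :
    ∃ s ∈ 𝓝 x, s ⊆ V ∧ ∃ C, ∀ y ∈ s, ∀ w ∈ K, ‖G (y, w)‖ ≤ C := by
  obtain ⟨s, hs, hsV, hsc⟩ := LocallyCompactSpace.local_compact_nhds x V (hV.mem_nhds hx)
  obtain ⟨C, hC⟩ := (hsc.prod hK).exists_bound_of_continuousOn
    (hG.mono (prod_mono hsV (subset_univ K)))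
  exact ⟨s, hs, hsV, C, fun y hy w hw => hC (y, w) ⟨hy, hw⟩⟩

theorem continuousOn_integral_kernel {F : Type} [NormedAddCommGroup F] [NormedSpace ℝ F]
    [NormedSpace ℂ F] {V : Set E} (hV : IsOpen V) {K : Set H} (hK : IsCompact K)
    {κ : H → ℂ} (hκ : Continuous κ) {G : E × H → F} (hG : ContinuousOn G (V ×ˢ univ)) :
    ContinuousOn (fun x => ∫ w in K, κ w • G (x, w) ∂μ) V := by
  intro x hx
  refine ContinuousAt.continuousWithinAt ?_
  obtain ⟨s, hs, hsV, C, hC⟩ := exists_nhds_bound hV hK hG hx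
  obtain ⟨D, hD⟩ := hK.exists_bound_of_continuousOn hκ.continuousOn
  refine continuousAt_of_dominated (bound := fun _ => D * C) ?_ ?_ ?_ ?_
  · filter_upwards [hV.mem_nhds hx] with y hy
    exact (integrableOn_slice hK hκ hG hy).aestronglyMeasurable
  · filter_upwards [hs] with y hy
    refine (ae_restrict_iff' hK.measurableSet).2 (ae_of_all _ fun w hw => ?_)
    rw [norm_smul]
    exact mul_le_mul (hD w hw) (hC y hy w hw) (norm_nonneg _) ((norm_nonneg _).trans (hD w hw))
  · exact integrableOn_const hK.measure_lt_top.ne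
  · refine ae_of_all _ fun w => ContinuousAt.smul continuousAt_const ?_
    have : ContinuousAt G (x, w) :=
      hG.continuousAt ((hV.prod isOpen_univ).mem_nhds ⟨hx, mem_univ _⟩)
    exact ContinuousAt.comp (f := fun y => (y, w)) this (by fun_prop)

theorem hasFDerivAt_integral_kernel {F : Type} [NormedAddCommGroup F] [NormedSpace ℝ F]
    [NormedSpace ℂ F] [SMulCommClass ℝ ℂ F]
    {V : Set E} (hV : IsOpen V) {K : Set H} (hK : IsCompact K)
    {κ : H → ℂ} (hκ : Continuous κ) {G : E × H → F} (hG : ContDiffOn ℝ 1 G (V ×ˢ univ))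
    {x : E} (hx : x ∈ V) :
    HasFDerivAt (fun x => ∫ w in K, κ w • G (x, w) ∂μ)
      (∫ w in K, κ w • (fderiv ℝ G (x, w)).comp (ContinuousLinearMap.inl ℝ E H) ∂μ) x := by
  have hO : IsOpen (V ×ˢ (univ : Set H)) := hV.prod isOpen_univ
  set G' : E × H → E →L[ℝ] F := fun r => (fderiv ℝ G r).comp (ContinuousLinearMap.inl ℝ E H)
    with hG'def
  have hG' : ContinuousOn G' (V ×ˢ univ) := by
    have h1 := hG.continuousOn_fderiv_of_isOpen hO le_rfl
    exact h1.clm_comp continuousOn_const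
  obtain ⟨s, hs, hsV, C, hC⟩ := exists_nhds_bound hV hK hG' hx
  obtain ⟨D, hD⟩ := hK.exists_bound_of_continuousOn hκ.continuousOn
  refine hasFDerivAt_integral_of_dominated_of_fderiv_le (bound := fun _ => D * C) hs
    (F' := fun y w => κ w • G' (y, w)) ?_ ?_ ?_ ?_ ?_ ?_
  · filter_upwards [hV.mem_nhds hx] with y hy
    exact (integrableOn_slice hK hκ hG.continuousOn hy).aestronglyMeasurable
  · exact integrableOn_slice hK hκ hG.continuousOn hx
  · exact (integrableOn_slice hK hκ hG' hx).aestronglyMeasurable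
  · refine (ae_restrict_iff' hK.measurableSet).2 (ae_of_all _ fun w hw y hy => ?_)
    rw [norm_smul]
    exact mul_le_mul (hD w hw) (hC y hy w hw) (norm_nonneg _) ((norm_nonneg _).trans (hD w hw))
  · exact integrableOn_const hK.measure_lt_top.ne
  · refine ae_of_all _ fun w y hy => HasFDerivAt.const_smul ?_ _
    have h1 : HasFDerivAt G (fderiv ℝ G (y, w)) (y, w) :=
      ((hG.contDiffAt (hO.mem_nhds ⟨hsV hy, mem_univ _⟩)).differentiableAt one_ne_zero).hasFDerivAt
    exact h1.comp y (hasFDerivAt_prodMk_left y w)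

/-- Induction on the order of smoothness. The target F is quantified inside the induction because
the derivative is an integral of the same kind with values in E →L[ℝ] F. -/
theorem contDiffOn_integral_kernel_nat {V : Set E} (hV : IsOpen V) {K : Set H} (hK : IsCompact K)
    {κ : H → ℂ} (hκ : Continuous κ) (m : ℕ) : ∀ {F : Type} [NormedAddCommGroup F] [NormedSpace ℝ F]
    [NormedSpace ℂ F] [SMulCommClass ℝ ℂ F] {G : E × H → F}, ContDiffOn ℝ m G (V ×ˢ univ) →
    ContDiffOn ℝ m (fun x => ∫ w in K, κ w • G (x, w) ∂μ) V := by
  have hO : IsOpen (V ×ˢ (univ : Set H)) := hV.prod isOpen_univ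
  induction m with
  | zero =>
    intro F _ _ _ _ G hG
    rw [Nat.cast_zero, contDiffOn_zero] at hG ⊢
    exact continuousOn_integral_kernel hV hK hκ hG
  | succ m ih =>
    intro F _ _ _ _ G hG
    rw [Nat.cast_add, Nat.cast_one] at hG ⊢
    have hd : ∀ x ∈ V, _ := fun x hx =>
      hasFDerivAt_integral_kernel (μ := μ) hV hK hκ (hG.of_le (by simp)) hx
    rw [contDiffOn_succ_iff_fderiv_of_isOpen hO] at hG
    rw [contDiffOn_succ_iff_fderiv_of_isOpen hV]
    refine ⟨fun x hx => (hd x hx).differentiableAt.differentiableWithinAt, by simp, ?_⟩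
    refine ContDiffOn.congr ?_ fun x hx => (hd x hx).fderiv
    exact ih (G := fun r => (fderiv ℝ G r).comp (ContinuousLinearMap.inl ℝ E H))
      (hG.2.2.clm_comp contDiffOn_const)

theorem contDiffOn_integral_kernel {V : Set E} (hV : IsOpen V) {K : Set H} (hK : IsCompact K)
    {κ : H → ℂ} (hκ : Continuous κ) {G : E × H → ℂ} (hG : ContDiffOn ℝ ∞ G (V ×ˢ univ)) :
    ContDiffOn ℝ ∞ (fun x => ∫ w in K, κ w * G (x, w) ∂μ) V :=
  contDiffOn_infty.2 fun m =>
    contDiffOn_integral_kernel_nat hV hK hκ m (hG.of_le (mod_cast le_top))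

theorem fderiv_integral_kernel {V : Set E} (hV : IsOpen V) {K : Set H} (hK : IsCompact K)
    {κ : H → ℂ} (hκ : Continuous κ) {G : E × H → ℂ} (hG : ContDiffOn ℝ ∞ G (V ×ˢ univ))
    {x : E} (hx : x ∈ V) (v : E) :
    fderiv ℝ (fun x => ∫ w in K, κ w * G (x, w) ∂μ) x v =
      ∫ w in K, κ w * fderiv ℝ G (x, w) (v, 0) ∂μ := by
  have hO : IsOpen (V ×ˢ (univ : Set H)) := hV.prod isOpen_univ
  have hG1 : ContDiffOn ℝ 1 G (V ×ˢ univ) := hG.of_le (mod_cast le_top)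
  have h := (hasFDerivAt_integral_kernel (μ := μ) hV hK hκ hG1 hx).fderiv
  simp only [smul_eq_mul] at h
  rw [h, ContinuousLinearMap.integral_apply]
  · simp
  · exact integrableOn_slice (G := fun r => (fderiv ℝ G r).comp (ContinuousLinearMap.inl ℝ E H))
      hK hκ ((hG1.continuousOn_fderiv_of_isOpen hO le_rfl).clm_comp continuousOn_const) hx

end ParametricIntegral

/-! ### Directional derivatives of smooth functions. -/

section DirectionalDerivative

variable {E : Type*} [NormedAddCommGroup E] [NormedSpace ℝ E] {V : Set E} {f : E → ℂ}

theorem contDiffOn_fderiv_apply (hV : IsOpen V) (hf : ContDiffOn ℝ ∞ f V) (u : E) :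
    ContDiffOn ℝ ∞ (fun x => fderiv ℝ f x u) V :=
  ((contDiffOn_infty_iff_fderiv_of_isOpen hV).1 hf).2.clm_apply contDiffOn_const

theorem differentiableAt_of_contDiffOn (hV : IsOpen V) (hf : ContDiffOn ℝ ∞ f V) {x : E}
    (hx : x ∈ V) : DifferentiableAt ℝ f x :=
  (hf.contDiffAt (hV.mem_nhds hx)).differentiableAt (by simp)

theorem fderiv_fderiv_apply_comm (hV : IsOpen V) (hf : ContDiffOn ℝ ∞ f V) {x : E} (hx : x ∈ V)
    (u v : E) : fderiv ℝ (fun y => fderiv ℝ f y u) x v = fderiv ℝ (fun y => fderiv ℝ f y v) x u := by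
  have hd : DifferentiableAt ℝ (fderiv ℝ f) x :=
    ((((contDiffOn_infty_iff_fderiv_of_isOpen hV).1 hf).2).contDiffAt
      (hV.mem_nhds hx)).differentiableAt (by simp)
  have hs : IsSymmSndFDerivAt ℝ f x :=
    ((contDiffOn_infty.1 hf 2).contDiffAt (hV.mem_nhds hx)).isSymmSndFDerivAt (by simp)
  have h : ∀ w, fderiv ℝ (fun y => fderiv ℝ f y w) x = (fderiv ℝ (fderiv ℝ f) x).flip w := by
    intro w
    rw [fderiv_clm_apply hd (differentiableAt_const w)]
    simp
  rw [h, h]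
  exact hs v u

end DirectionalDerivative

/-- Smooth functions on `S¹ × Tⁿ`. -/
structure IsTorusFun (f : Pt n → ℂ) : Prop where
  contDiff : ContDiff ℝ ∞ f
  periodic : ∀ (i : Fin (n + 1)) (z : Pt n), f (z + Pi.single i (2 * Real.pi)) = f z

/-! ### Smooth families of functions on S¹ × Tⁿ. -/

section Families

variable {E : Type} [NormedAddCommGroup E] [NormedSpace ℝ E]
variable {E' : Type} [NormedAddCommGroup E'] [NormedSpace ℝ E']

/-- Smooth families of functions on `S¹ × Tⁿ` over an open set of parameters. -/
structure IsTorusFamily (W : Set E) (f : E → Pt n → ℂ) : Prop where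
  isOpen : IsOpen W
  contDiffOn : ContDiffOn ℝ ∞ (fun r : E × Pt n => f r.1 r.2) (W ×ˢ univ)
  periodic : ∀ s ∈ W, ∀ (i : Fin (n + 1)) (z : Pt n),
    f s (z + Pi.single i (2 * Real.pi)) = f s z

/-- Derivative of a family of functions with respect to the parameter. -/
def parD (v : E) (f : E → Pt n → ℂ) (s : E) : Pt n → ℂ :=
  fun z => fderiv ℝ (fun s' => f s' z) s v

variable {W : Set E} {f g : E → Pt n → ℂ} {s : E}

theorem IsTorusFamily.isOpen_prod (hf : IsTorusFamily W f) :
    IsOpen (W ×ˢ (univ : Set (Pt n))) := hf.isOpen.prod isOpen_univ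

theorem IsTorusFamily.torusFun (hf : IsTorusFamily W f) (hs : s ∈ W) : IsTorusFun (f s) where
  contDiff := by
    rw [← contDiffOn_univ]
    exact hf.contDiffOn.comp (f := fun z => (s, z)) (by fun_prop) fun z _ => ⟨hs, mem_univ _⟩
  periodic := hf.periodic s hs

theorem IsTorusFun.family {f : Pt n → ℂ} (hf : IsTorusFun f) (hW : IsOpen W) :
    IsTorusFamily W (fun _ => f) where
  isOpen := hW
  contDiffOn := (hf.contDiff.comp contDiff_snd).contDiffOn
  periodic _ _ := hf.periodic

/-- A single function is a constant family, so closure properties of functions can be read off from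
those of families. -/
theorem IsTorusFun.familyUniv {f : Pt n → ℂ} (hf : IsTorusFun f) :
    IsTorusFamily (univ : Set ℝ) (fun _ => f) := hf.family isOpen_univ

theorem IsTorusFamily.congr (hf : IsTorusFamily W f) (h : ∀ s ∈ W, g s = f s) :
    IsTorusFamily W g where
  isOpen := hf.isOpen
  contDiffOn := hf.contDiffOn.congr fun r hr => congrFun (h r.1 hr.1) r.2
  periodic s hs i z := by rw [h s hs]; exact hf.periodic s hs i z

theorem IsTorusFamily.mono (hf : IsTorusFamily W f) {W' : Set E} (hW' : IsOpen W') (h : W' ⊆ W) :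
    IsTorusFamily W' f where
  isOpen := hW'
  contDiffOn := hf.contDiffOn.mono (prod_mono h Subset.rfl)
  periodic s hs := hf.periodic s (h hs)

theorem IsTorusFamily.reparam (hf : IsTorusFamily W f) {W' : Set E'} (hW' : IsOpen W')
    {φ : E' → E} (hφ : ContDiffOn ℝ ∞ φ W') (hm : MapsTo φ W' W) :
    IsTorusFamily W' (fun s => f (φ s)) where
  isOpen := hW'
  contDiffOn := by
    refine hf.contDiffOn.comp (f := fun r : E' × Pt n => (φ r.1, r.2)) ?_ ?_
    · exact ContDiffOn.prodMk (hφ.comp contDiffOn_fst fun r hr => hr.1) contDiffOn_snd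
    · exact fun r hr => ⟨hm hr.1, mem_univ _⟩
  periodic s hs := hf.periodic _ (hm hs)

theorem IsTorusFamily.add (hf : IsTorusFamily W f) (hg : IsTorusFamily W g) :
    IsTorusFamily W (fun s => f s + g s) where
  isOpen := hf.isOpen
  contDiffOn := hf.contDiffOn.add hg.contDiffOn
  periodic s hs i z := by simp [hf.periodic s hs i z, hg.periodic s hs i z]

theorem IsTorusFamily.mul (hf : IsTorusFamily W f) (hg : IsTorusFamily W g) :
    IsTorusFamily W (fun s => f s * g s) where
  isOpen := hf.isOpen
  contDiffOn := hf.contDiffOn.mul hg.contDiffOn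
  periodic s hs i z := by simp [hf.periodic s hs i z, hg.periodic s hs i z]

theorem IsTorusFamily.smul_param {φ : E → ℂ} (hφ : ContDiffOn ℝ ∞ φ W) (hf : IsTorusFamily W f) :
    IsTorusFamily W (fun s => φ s • f s) where
  isOpen := hf.isOpen
  contDiffOn := (hφ.comp contDiffOn_fst fun r hr => hr.1).mul hf.contDiffOn
  periodic s hs i z := by simp [hf.periodic s hs i z]

theorem IsTorusFamily.smul (c : ℂ) (hf : IsTorusFamily W f) :
    IsTorusFamily W (fun s => c • f s) := hf.smul_param contDiffOn_const

theorem IsTorusFamily.neg (hf : IsTorusFamily W f) : IsTorusFamily W (fun s => -f s) := by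
  simpa using hf.smul (-1)

theorem IsTorusFamily.sub (hf : IsTorusFamily W f) (hg : IsTorusFamily W g) :
    IsTorusFamily W (fun s => f s - g s) := by
  simpa [sub_eq_add_neg] using hf.add hg.neg

theorem isTorusFun_const (c : ℂ) : IsTorusFun (fun _ : Pt n => c) :=
  ⟨contDiff_const, fun _ _ => rfl⟩

theorem IsTorusFamily.sum {ι : Type*} (S : Finset ι) {f : ι → E → Pt n → ℂ} (hW : IsOpen W)
    (hf : ∀ i ∈ S, IsTorusFamily W (f i)) : IsTorusFamily W (fun s => ∑ i ∈ S, f i s) := by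
  classical
  induction S using Finset.induction_on with
  | empty => exact ((isTorusFun_const (n := n) 0).family hW).congr fun s _ => by ext; simp
  | insert a S ha ih =>
    simp only [Finset.sum_insert ha]
    exact (hf a (by simp)).add (ih fun i hi => hf i (by simp [hi]))

theorem IsTorusFamily.differentiableAt (hf : IsTorusFamily W f) (hs : s ∈ W) (z : Pt n) :
    DifferentiableAt ℝ (fun r : E × Pt n => f r.1 r.2) (s, z) :=
  differentiableAt_of_contDiffOn hf.isOpen_prod hf.contDiffOn ⟨hs, mem_univ _⟩

theorem IsTorusFamily.differentiableAt_param (hf : IsTorusFamily W f) (hs : s ∈ W) (z : Pt n) :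
    DifferentiableAt ℝ (fun s' => f s' z) s :=
  DifferentiableAt.comp (f := fun s' => (s', z)) s (hf.differentiableAt hs z) (by fun_prop)

theorem IsTorusFamily.parD_eq (hf : IsTorusFamily W f) (hs : s ∈ W) (v : E) (z : Pt n) :
    parD v f s z = fderiv ℝ (fun r : E × Pt n => f r.1 r.2) (s, z) (v, 0) := by
  have h := HasFDerivAt.comp (f := fun e => (e, z)) s (hf.differentiableAt hs z).hasFDerivAt
    (hasFDerivAt_prodMk_left s z)
  exact DFunLike.congr_fun h.fderiv v

theorem IsTorusFamily.pd_eq (hf : IsTorusFamily W f) (hs : s ∈ W) (i : Fin (n + 1)) (z : Pt n) :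
    pd i (f s) z = fderiv ℝ (fun r : E × Pt n => f r.1 r.2) (s, z) (0, Pi.single i 1) := by
  have h := (hf.differentiableAt hs z).hasFDerivAt.comp z (hasFDerivAt_prodMk_right s z)
  exact DFunLike.congr_fun h.fderiv (Pi.single i 1)

theorem pd_periodic {f : Pt n → ℂ} {v : Pt n} (h : ∀ z, f (z + v) = f z) (i : Fin (n + 1))
    (z : Pt n) : pd i f (z + v) = pd i f z := by
  have : (fun w => f (w + v)) = f := funext h
  simp only [pd]
  rw [← fderiv_comp_add_right, this]

theorem IsTorusFamily.pd (hf : IsTorusFamily W f) (i : Fin (n + 1)) :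
    IsTorusFamily W (fun s => pd i (f s)) where
  isOpen := hf.isOpen
  contDiffOn := (contDiffOn_fderiv_apply hf.isOpen_prod hf.contDiffOn (0, Pi.single i 1)).congr
    fun r hr => hf.pd_eq hr.1 i r.2
  periodic s hs j z := pd_periodic (hf.periodic s hs j) i z

theorem IsTorusFamily.parD (hf : IsTorusFamily W f) (v : E) : IsTorusFamily W (parD v f) where
  isOpen := hf.isOpen
  contDiffOn := (contDiffOn_fderiv_apply hf.isOpen_prod hf.contDiffOn (v, 0)).congr
    fun r hr => hf.parD_eq hr.1 v r.2
  periodic s hs j z := by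
    have : (fun s' => f s' (z + Pi.single j (2 * Real.pi))) =ᶠ[𝓝 s] fun s' => f s' z := by
      filter_upwards [hf.isOpen.mem_nhds hs] with s' hs' using hf.periodic s' hs' j z
    simp only [HolLoop.parD, this.fderiv_eq]

theorem IsTorusFamily.parD_congr (h : ∀ s ∈ W, f s = g s) (hW : IsOpen W) (hs : s ∈ W) (v : E) :
    HolLoop.parD v f s = HolLoop.parD v g s := by
  ext z
  have : (fun s' => f s' z) =ᶠ[𝓝 s] fun s' => g s' z := by
    filter_upwards [hW.mem_nhds hs] with s' hs' using by rw [h s' hs']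
  simp only [HolLoop.parD, this.fderiv_eq]

/-- Both are directional derivatives of the one jointly smooth function (s, z) ↦ f s z, so this is
the symmetry of its second derivative. -/
theorem IsTorusFamily.pd_parD (hf : IsTorusFamily W f) (hs : s ∈ W) (i : Fin (n + 1)) (v : E) :
    HolLoop.parD v (fun s => HolLoop.pd i (f s)) s = HolLoop.pd i (HolLoop.parD v f s) := by
  ext z
  rw [(hf.pd i).parD_eq hs, (hf.parD v).pd_eq hs]
  have h1 : (fun r : E × Pt n => HolLoop.pd i (f r.1) r.2) =ᶠ[𝓝 (s, z)]
      fun r => fderiv ℝ (fun r : E × Pt n => f r.1 r.2) r (0, Pi.single i 1) := by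
    filter_upwards [hf.isOpen_prod.mem_nhds ⟨hs, mem_univ z⟩] with r hr using hf.pd_eq hr.1 i r.2
  have h2 : (fun r : E × Pt n => HolLoop.parD v f r.1 r.2) =ᶠ[𝓝 (s, z)]
      fun r => fderiv ℝ (fun r : E × Pt n => f r.1 r.2) r (v, 0) := by
    filter_upwards [hf.isOpen_prod.mem_nhds ⟨hs, mem_univ z⟩] with r hr using hf.parD_eq hr.1 v r.2
  rw [h1.fderiv_eq, h2.fderiv_eq]
  exact fderiv_fderiv_apply_comm hf.isOpen_prod hf.contDiffOn ⟨hs, mem_univ z⟩ _ _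

theorem IsTorusFamily.parD_comm (hf : IsTorusFamily W f) (hs : s ∈ W) (u v : E) :
    HolLoop.parD v (HolLoop.parD u f) s = HolLoop.parD u (HolLoop.parD v f) s := by
  ext z
  have h : ∀ w, (fun r : E × Pt n => HolLoop.parD w f r.1 r.2) =ᶠ[𝓝 (s, z)]
      fun r => fderiv ℝ (fun r : E × Pt n => f r.1 r.2) r (w, 0) := fun w => by
    filter_upwards [hf.isOpen_prod.mem_nhds ⟨hs, mem_univ z⟩] with r hr using hf.parD_eq hr.1 w r.2
  rw [(hf.parD u).parD_eq hs, (hf.parD v).parD_eq hs, (h u).fderiv_eq, (h v).fderiv_eq]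
  exact fderiv_fderiv_apply_comm hf.isOpen_prod hf.contDiffOn ⟨hs, mem_univ z⟩ _ _

theorem IsTorusFamily.parD_add (hf : IsTorusFamily W f) (hg : IsTorusFamily W g) (hs : s ∈ W)
    (v : E) : HolLoop.parD v (fun s => f s + g s) s = HolLoop.parD v f s + HolLoop.parD v g s := by
  ext z
  exact DFunLike.congr_fun
    (fderiv_add (hf.differentiableAt_param hs z) (hg.differentiableAt_param hs z)) v

theorem IsTorusFamily.parD_mul (hf : IsTorusFamily W f) (hg : IsTorusFamily W g) (hs : s ∈ W)
    (v : E) : HolLoop.parD v (fun s => f s * g s) s =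
      HolLoop.parD v f s * g s + f s * HolLoop.parD v g s := by
  ext z
  have := DFunLike.congr_fun
    (fderiv_mul (hf.differentiableAt_param hs z) (hg.differentiableAt_param hs z)) v
  refine this.trans ?_
  simp only [add_apply, smul_apply, smul_eq_mul,
    Pi.add_apply, Pi.mul_apply, HolLoop.parD]
  ring

theorem parD_const (v : E) (f : Pt n → ℂ) (s : E) : parD v (fun _ => f) s = 0 := by
  ext z
  simp [parD]

theorem IsTorusFamily.parD_sub (hf : IsTorusFamily W f) (hg : IsTorusFamily W g) (hs : s ∈ W)
    (v : E) : HolLoop.parD v (fun s => f s - g s) s = HolLoop.parD v f s - HolLoop.parD v g s := by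
  ext z
  exact DFunLike.congr_fun
    (fderiv_sub (hf.differentiableAt_param hs z) (hg.differentiableAt_param hs z)) v

theorem IsTorusFamily.parD_sum {ι : Type*} (S : Finset ι) {f : ι → E → Pt n → ℂ}
    (hf : ∀ i ∈ S, IsTorusFamily W (f i)) (hs : s ∈ W) (v : E) :
    HolLoop.parD v (fun s => ∑ i ∈ S, f i s) s = ∑ i ∈ S, HolLoop.parD v (f i) s := by
  ext z
  simp only [HolLoop.parD, Finset.sum_apply]
  rw [← sum_apply, ← fderiv_fun_sum]
  exact fun i hi => (hf i hi).differentiableAt_param hs z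

end Families

/-! ### Calculus of functions on S¹ × Tⁿ and the powers of λ. -/

section Functions

variable {f g : Pt n → ℂ}

theorem IsTorusFun.add (hf : IsTorusFun f) (hg : IsTorusFun g) : IsTorusFun (f + g) :=
  (hf.familyUniv.add hg.familyUniv).torusFun (mem_univ 0)

theorem IsTorusFun.mul (hf : IsTorusFun f) (hg : IsTorusFun g) : IsTorusFun (f * g) :=
  (hf.familyUniv.mul hg.familyUniv).torusFun (mem_univ 0)

theorem IsTorusFun.sub (hf : IsTorusFun f) (hg : IsTorusFun g) : IsTorusFun (f - g) :=
  (hf.familyUniv.sub hg.familyUniv).torusFun (mem_univ 0)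

theorem IsTorusFun.neg (hf : IsTorusFun f) : IsTorusFun (-f) :=
  hf.familyUniv.neg.torusFun (mem_univ 0)

theorem IsTorusFun.smul (c : ℂ) (hf : IsTorusFun f) : IsTorusFun (c • f) :=
  (hf.familyUniv.smul c).torusFun (mem_univ 0)

theorem isTorusFun_zero : IsTorusFun (0 : Pt n → ℂ) := isTorusFun_const 0

theorem IsTorusFun.sum {ι : Type*} (S : Finset ι) {f : ι → Pt n → ℂ}
    (hf : ∀ i ∈ S, IsTorusFun (f i)) : IsTorusFun (∑ i ∈ S, f i) :=
  (IsTorusFamily.sum S isOpen_univ fun i hi => (hf i hi).familyUniv).torusFun (mem_univ 0)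

theorem IsTorusFun.pd (hf : IsTorusFun f) (i : Fin (n + 1)) : IsTorusFun (pd i f) :=
  (hf.familyUniv.pd i).torusFun (mem_univ 0)

theorem IsTorusFun.differentiable (hf : IsTorusFun f) : Differentiable ℝ f :=
  hf.contDiff.differentiable (by simp)

theorem IsTorusFun.continuous (hf : IsTorusFun f) : Continuous f := hf.contDiff.continuous

theorem IsTorusFun.conj (hf : IsTorusFun f) : IsTorusFun (fun z => (starRingEnd ℂ) (f z)) where
  contDiff := Complex.conjCLE.contDiff.comp hf.contDiff
  periodic i z := by simp only [hf.periodic i z]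

theorem pd_add (hf : IsTorusFun f) (hg : IsTorusFun g) (i : Fin (n + 1)) :
    pd i (f + g) = pd i f + pd i g := by
  ext z
  exact DFunLike.congr_fun (fderiv_add (hf.differentiable z) (hg.differentiable z)) _

theorem pd_mul (hf : IsTorusFun f) (hg : IsTorusFun g) (i : Fin (n + 1)) :
    pd i (f * g) = pd i f * g + f * pd i g := by
  ext z
  refine (DFunLike.congr_fun (fderiv_mul (hf.differentiable z) (hg.differentiable z)) _).trans ?_
  simp only [add_apply, smul_apply, smul_eq_mul,
    Pi.add_apply, Pi.mul_apply, pd]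
  ring

theorem pd_smul (hf : IsTorusFun f) (c : ℂ) (i : Fin (n + 1)) : pd i (c • f) = c • pd i f := by
  ext z
  exact DFunLike.congr_fun (fderiv_const_smul (hf.differentiable z) c) _

theorem pd_comm (hf : IsTorusFun f) (i j : Fin (n + 1)) : pd i (pd j f) = pd j (pd i f) := by
  ext z
  exact fderiv_fderiv_apply_comm isOpen_univ hf.contDiff.contDiffOn (mem_univ z) _ _

theorem pd_conj (hf : IsTorusFun f) (i : Fin (n + 1)) :
    pd i (fun z => (starRingEnd ℂ) (f z)) = fun z => (starRingEnd ℂ) (pd i f z) := by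
  ext z
  have h := (Complex.conjCLE.toContinuousLinearMap.hasFDerivAt (x := f z)).comp z
    (hf.differentiable z).hasFDerivAt
  exact DFunLike.congr_fun h.fderiv (Pi.single i 1)

theorem lam_ne_zero (z : Pt n) : lam z ≠ 0 := Complex.exp_ne_zero _

theorem norm_lam (z : Pt n) : ‖lam z‖ = 1 := by
  rw [lam, mul_comm]; exact Complex.norm_exp_ofReal_mul_I _

theorem lam_zpow (m : ℤ) (z : Pt n) : lam z ^ m = Complex.exp (Complex.I * m * z 0) := by
  rw [lam, ← Complex.exp_int_mul]
  ring_nf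

theorem isTorusFun_lam_zpow (m : ℤ) : IsTorusFun (fun z : Pt n => lam z ^ m) where
  contDiff := by
    simp only [lam_zpow]
    have : ContDiff ℝ ∞ fun z : Pt n => ((z 0 : ℝ) : ℂ) :=
      Complex.ofRealCLM.contDiff.comp (contDiff_apply ℝ ℝ 0)
    exact (contDiff_const.mul this).cexp
  periodic i z := by
    simp only [lam_zpow]
    by_cases hi : i = 0
    · subst hi
      simp only [Pi.add_apply, Pi.single_eq_same]
      rw [Complex.exp_eq_exp_iff_exists_int]
      exact ⟨m, by push_cast; ring⟩
    · simp [Pi.single_eq_of_ne (Ne.symm hi)]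

/-- No differentiability is assumed: where f is not differentiable, `fderiv` takes its default value
0. -/
theorem pd_eq_zero_of_forall_add {f : Pt n → ℂ} {i : Fin (n + 1)}
    (h : ∀ (z : Pt n) (t : ℝ), f (z + t • Pi.single i 1) = f z) : pd i f = 0 := by
  ext z
  by_cases hd : DifferentiableAt ℝ f z
  · rw [pd, ← hd.lineDeriv_eq_fderiv, lineDeriv]
    simp [h]
  · simp [pd, fderiv_zero_of_not_differentiableAt hd]

theorem pd_succ_lam_zpow (m : ℤ) (i : Fin n) :
    pd i.succ (fun z : Pt n => lam z ^ m) = 0 := by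
  refine pd_eq_zero_of_forall_add fun z t => ?_
  simp [lam]

end Functions

/-- Linear operators on smooth functions on `S¹ × Tⁿ` that map smooth families to smooth families
and commute with differentiation in the parameters. -/
structure IsTorusOp (D : (Pt n → ℂ) → Pt n → ℂ) : Prop where
  family : ∀ {E : Type} [NormedAddCommGroup E] [NormedSpace ℝ E] [LocallyCompactSpace E]
    {W : Set E} {f : E → Pt n → ℂ}, IsTorusFamily W f → IsTorusFamily W (fun s => D (f s))
  parD : ∀ {E : Type} [NormedAddCommGroup E] [NormedSpace ℝ E] [LocallyCompactSpace E]
    {W : Set E} {f : E → Pt n → ℂ}, IsTorusFamily W f → ∀ s ∈ W, ∀ v : E,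
      parD v (fun s => D (f s)) s = D (parD v f s)
  add : ∀ {f g : Pt n → ℂ}, IsTorusFun f → IsTorusFun g → D (f + g) = D f + D g
  smul : ∀ (c : ℂ) {f : Pt n → ℂ}, IsTorusFun f → D (c • f) = c • D f

/-! ### Algebra of operators compatible with smooth families. -/

namespace IsTorusOp

variable {D D' : (Pt n → ℂ) → Pt n → ℂ} {f g : Pt n → ℂ}

theorem torusFun (hD : IsTorusOp D) (hf : IsTorusFun f) : IsTorusFun (D f) :=
  (hD.family hf.familyUniv).torusFun (mem_univ 0)

theorem zero (hD : IsTorusOp D) : D 0 = 0 := by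
  simpa using hD.smul 0 isTorusFun_zero

theorem neg (hD : IsTorusOp D) (hf : IsTorusFun f) : D (-f) = -D f := by
  simpa using hD.smul (-1) hf

theorem sub (hD : IsTorusOp D) (hf : IsTorusFun f) (hg : IsTorusFun g) :
    D (f - g) = D f - D g := by
  rw [sub_eq_add_neg, hD.add hf hg.neg, hD.neg hg, sub_eq_add_neg]

theorem sum (hD : IsTorusOp D) {ι : Type*} (S : Finset ι) {f : ι → Pt n → ℂ}
    (hf : ∀ i ∈ S, IsTorusFun (f i)) : D (∑ i ∈ S, f i) = ∑ i ∈ S, D (f i) := by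
  classical
  induction S using Finset.induction_on with
  | empty => simpa using hD.zero
  | insert a S ha ih =>
    rw [Finset.sum_insert ha, Finset.sum_insert ha,
      hD.add (hf a (by simp)) (IsTorusFun.sum S fun i hi => hf i (by simp [hi])),
      ih fun i hi => hf i (by simp [hi])]

theorem id : IsTorusOp (n := n) (fun f => f) :=
  ⟨fun h => h, fun _ _ _ _ => rfl, fun _ _ => rfl, fun _ _ _ => rfl⟩

theorem comp (hD : IsTorusOp D) (hD' : IsTorusOp D') : IsTorusOp (fun f => D (D' f)) where
  family hf := hD.family (hD'.family hf)
  parD hf s hs v := by rw [hD.parD (hD'.family hf) s hs v, hD'.parD hf s hs v]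
  add hf hg := by rw [hD'.add hf hg, hD.add (hD'.torusFun hf) (hD'.torusFun hg)]
  smul c _ hf := by rw [hD'.smul c hf, hD.smul c (hD'.torusFun hf)]

theorem iterate (hD : IsTorusOp D) (m : ℕ) : IsTorusOp (D^[m]) := by
  induction m with
  | zero => exact id
  | succ m ih => exact ih.comp hD

theorem opAdd (hD : IsTorusOp D) (hD' : IsTorusOp D') : IsTorusOp (fun f => D f + D' f) where
  family hf := (hD.family hf).add (hD'.family hf)
  parD hf s hs v := by
    rw [(hD.family hf).parD_add (hD'.family hf) hs, hD.parD hf s hs, hD'.parD hf s hs]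
  add hf hg := by rw [hD.add hf hg, hD'.add hf hg]; abel
  smul c _ hf := by rw [hD.smul c hf, hD'.smul c hf, smul_add]

theorem mulLeft (hD : IsTorusOp D) (hg : IsTorusFun g) : IsTorusOp (fun f => g * D f) where
  family hf := (hg.family hf.isOpen).mul (hD.family hf)
  parD hf s hs v := by
    rw [(hg.family hf.isOpen).parD_mul (hD.family hf) hs, parD_const, hD.parD hf s hs]
    simp
  add hf hg := by rw [hD.add hf hg, mul_add]
  smul c _ hf := by rw [hD.smul c hf, mul_smul_comm]

theorem opSMul (hD : IsTorusOp D) (c : ℂ) : IsTorusOp (fun f => c • D f) := by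
  have h := hD.mulLeft (isTorusFun_const c)
  exact h

theorem opZero : IsTorusOp (n := n) (fun _ => 0) := by
  simpa using id.opSMul (n := n) 0

theorem opSum {ι : Type*} (S : Finset ι) {D : ι → (Pt n → ℂ) → Pt n → ℂ}
    (hD : ∀ i ∈ S, IsTorusOp (D i)) : IsTorusOp (fun f => ∑ i ∈ S, D i f) := by
  classical
  induction S using Finset.induction_on with
  | empty => simpa using opZero
  | insert a S ha ih =>
    simp only [Finset.sum_insert ha]
    exact (hD a (by simp)).opAdd (ih fun i hi => hD i (by simp [hi]))

theorem opPd (i : Fin (n + 1)) : IsTorusOp (pd (n := n) i) where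
  family hf := hf.pd i
  parD hf _ hs v := hf.pd_parD hs i v
  add hf hg := pd_add hf hg i
  smul c _ hf := pd_smul hf c i

end IsTorusOp

/-! ### The derivations `dd i` -/

/-- The coefficient of the derivation `dd i` with respect to the real partial derivative. -/
def ddCoeff (i : Fin (n + 1)) : Pt n → ℂ := fun z => if i = 0 then (Complex.I * lam z)⁻¹ else 1

theorem ddCoeff_zero : ddCoeff (0 : Fin (n + 1)) = (-Complex.I) • fun z => lam z ^ (-1 : ℤ) := by
  ext z
  simp [ddCoeff, mul_comm]

theorem isTorusFun_ddCoeff (i : Fin (n + 1)) : IsTorusFun (ddCoeff i) := by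
  by_cases hi : i = 0
  · subst hi
    rw [ddCoeff_zero]
    exact (isTorusFun_lam_zpow _).smul _
  · have : ddCoeff i = fun _ => 1 := by ext z; simp [ddCoeff, hi]
    rw [this]
    exact isTorusFun_const 1

theorem dd_eq (i : Fin (n + 1)) : dd i = fun f => ddCoeff i * pd i f := by
  ext f z
  by_cases hi : i = 0
  · subst hi
    simp [dd, ddCoeff]
  · simp [dd, ddCoeff, hi]

theorem IsTorusOp.opDd (i : Fin (n + 1)) : IsTorusOp (dd (n := n) i) := by
  rw [dd_eq]
  exact (IsTorusOp.opPd i).mulLeft (isTorusFun_ddCoeff i)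

theorem pd_ddCoeff {i j : Fin (n + 1)} (h : i ≠ j) : pd i (ddCoeff j) = 0 := by
  refine pd_eq_zero_of_forall_add fun z t => ?_
  by_cases hj : j = 0
  · subst hj
    simp [ddCoeff, lam, Pi.single_eq_of_ne h.symm]
  · simp [ddCoeff, hj]

section

variable {f g : Pt n → ℂ}

theorem IsTorusFun.dd (hf : IsTorusFun f) (i : Fin (n + 1)) : IsTorusFun (dd i f) :=
  (IsTorusOp.opDd i).torusFun hf

theorem dd_mul (hf : IsTorusFun f) (hg : IsTorusFun g) (i : Fin (n + 1)) :
    dd i (f * g) = dd i f * g + f * dd i g := by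
  simp only [dd_eq, pd_mul hf hg i]
  ring

/-- For i ≠ j the coefficient of the j-th derivation is constant in the i-th coordinate, so only the
commutation of real partial derivatives is needed, even though ∂/∂λ carries the factor (iλ)⁻¹. -/
theorem dd_comm (hf : IsTorusFun f) (i j : Fin (n + 1)) : dd i (dd j f) = dd j (dd i f) := by
  by_cases h : i = j
  · rw [h]
  · simp only [dd_eq]
    rw [pd_mul (isTorusFun_ddCoeff j) (hf.pd j), pd_mul (isTorusFun_ddCoeff i) (hf.pd i),
      pd_ddCoeff h, pd_ddCoeff (Ne.symm h), pd_comm hf i j]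
    ring

end

/-! ### Vector fields -/

/-- The `j`-th coefficient. -/
def coef (a : Coeffs n) (j : Fin (n + 1)) : Pt n → ℂ := fun z => a z j

theorem coeffs_ext {a b : Coeffs n} (h : ∀ j, coef a j = coef b j) : a = b := by
  ext z j
  exact congrFun (h j) z

theorem isLoop_iff {a : Coeffs n} : IsLoop a ↔ ∀ j, IsTorusFun (coef a j) := by
  constructor
  · rintro ⟨h1, h2⟩ j
    exact ⟨contDiff_pi.1 h1 j, fun i z => congrFun (h2 i z) j⟩
  · intro h
    exact ⟨contDiff_pi.2 fun j => (h j).contDiff, fun i z => funext fun j => (h j).periodic i z⟩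

theorem IsLoop.coef {a : Coeffs n} (h : IsLoop a) (j : Fin (n + 1)) : IsTorusFun (coef a j) :=
  isLoop_iff.1 h j

theorem isPlot_iff {k : ℕ} {W : Set (Fin k → ℝ)} {c : (Fin k → ℝ) → Coeffs n} :
    IsPlot W c ↔ ∀ j, IsTorusFamily W (fun s => coef (c s) j) := by
  constructor
  · rintro ⟨h0, h1, h2⟩ j
    exact ⟨h0, contDiffOn_pi.1 h2 j, fun s hs => ((h1 s hs).coef j).periodic⟩
  · intro h
    exact ⟨(h 0).isOpen, fun s hs => isLoop_iff.2 fun j => (h j).torusFun hs,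
      contDiffOn_pi.2 fun j => (h j).contDiffOn⟩

theorem IsPlot.coef {k : ℕ} {W : Set (Fin k → ℝ)} {c : (Fin k → ℝ) → Coeffs n} (h : IsPlot W c)
    (j : Fin (n + 1)) : IsTorusFamily W (fun s => coef (c s) j) := isPlot_iff.1 h j

theorem coef_dpar {k : ℕ} (i : Fin k) (c : (Fin k → ℝ) → Coeffs n) (s : Fin k → ℝ)
    (j : Fin (n + 1)) :
    coef (dpar i c s) j = parD (Pi.single i 1) (fun s => coef (c s) j) s := rfl

theorem IsPlot.dpar {k : ℕ} {W : Set (Fin k → ℝ)} {c : (Fin k → ℝ) → Coeffs n} (h : IsPlot W c)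
    (i : Fin k) : IsPlot W (dpar i c) :=
  isPlot_iff.2 fun j => (h.coef j).parD _

theorem isPlot_const {k : ℕ} {W : Set (Fin k → ℝ)} (hW : IsOpen W) {a : Coeffs n} (h : IsLoop a) :
    IsPlot W (fun _ => a) := isPlot_iff.2 fun j => (h.coef j).family hW

/-- The action of a vector field on functions. -/
def lieD (a : Coeffs n) (f : Pt n → ℂ) : Pt n → ℂ := ∑ i, coef a i * dd i f

theorem coef_bracket (a b : Coeffs n) (j : Fin (n + 1)) :
    coef (bracket a b) j = lieD a (coef b j) - lieD b (coef a j) := by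
  ext z
  simp only [coef, bracket, lieD, Pi.sub_apply, Finset.sum_apply, Pi.mul_apply,
    Finset.sum_sub_distrib]
  rfl

theorem IsTorusOp.opLieD {a : Coeffs n} (ha : IsLoop a) : IsTorusOp (lieD a) :=
  IsTorusOp.opSum _ fun i _ => (IsTorusOp.opDd i).mulLeft (ha.coef i)

theorem lieD_family {E : Type} [NormedAddCommGroup E] [NormedSpace ℝ E] [LocallyCompactSpace E]
    {W : Set E} {a : E → Coeffs n} {f : E → Pt n → ℂ}
    (ha : ∀ j, IsTorusFamily W (fun s => coef (a s) j)) (hf : IsTorusFamily W f) :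
    IsTorusFamily W (fun s => lieD (a s) (f s)) :=
  IsTorusFamily.sum _ hf.isOpen fun i _ => (ha i).mul ((IsTorusOp.opDd i).family hf)

theorem IsPlot.bracket {k : ℕ} {W : Set (Fin k → ℝ)} {a b : (Fin k → ℝ) → Coeffs n}
    (ha : IsPlot W a) (hb : IsPlot W b) : IsPlot W (fun s => bracket (a s) (b s)) :=
  isPlot_iff.2 fun j => by
    simp only [coef_bracket]
    exact (lieD_family ha.coef (hb.coef j)).sub (lieD_family hb.coef (ha.coef j))

theorem IsLoop.bracket {a b : Coeffs n} (ha : IsLoop a) (hb : IsLoop b) :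
    IsLoop (bracket a b) :=
  ((isPlot_const (k := 0) isOpen_univ ha).bracket (isPlot_const isOpen_univ hb)).2.1 0 (mem_univ _)

theorem IsLoop.add {a b : Coeffs n} (ha : IsLoop a) (hb : IsLoop b) : IsLoop (a + b) :=
  isLoop_iff.2 fun j => (ha.coef j).add (hb.coef j)

theorem IsLoop.sub {a b : Coeffs n} (ha : IsLoop a) (hb : IsLoop b) : IsLoop (a - b) :=
  isLoop_iff.2 fun j => (ha.coef j).sub (hb.coef j)

theorem IsLoop.neg {a : Coeffs n} (ha : IsLoop a) : IsLoop (-a) :=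
  isLoop_iff.2 fun j => (ha.coef j).neg

theorem IsLoop.smul {a : Coeffs n} (c : ℂ) (ha : IsLoop a) : IsLoop (c • a) :=
  isLoop_iff.2 fun j => (ha.coef j).smul c

theorem coef_add (a b : Coeffs n) (j : Fin (n + 1)) : coef (a + b) j = coef a j + coef b j := rfl
theorem coef_sub (a b : Coeffs n) (j : Fin (n + 1)) : coef (a - b) j = coef a j - coef b j := rfl
theorem coef_neg (a : Coeffs n) (j : Fin (n + 1)) : coef (-a) j = -coef a j := rfl
theorem coef_smul (c : ℂ) (a : Coeffs n) (j : Fin (n + 1)) : coef (c • a) j = c • coef a j := rfl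

theorem bracket_antisymm (a b : Coeffs n) : bracket a b = -bracket b a :=
  coeffs_ext fun j => by rw [coef_neg, coef_bracket, coef_bracket, neg_sub]

theorem lieD_add_left (a b : Coeffs n) (f : Pt n → ℂ) : lieD (a + b) f = lieD a f + lieD b f := by
  simp only [lieD, coef_add, add_mul, Finset.sum_add_distrib]

theorem lieD_smul_left (c : ℂ) (a : Coeffs n) (f : Pt n → ℂ) : lieD (c • a) f = c • lieD a f := by
  simp only [lieD, coef_smul, smul_mul_assoc, Finset.smul_sum]

theorem bracket_add_right {a b c : Coeffs n} (ha : IsLoop a) (hb : IsLoop b) (hc : IsLoop c) :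
    bracket a (b + c) = bracket a b + bracket a c :=
  coeffs_ext fun j => by
    rw [coef_add, coef_bracket, coef_bracket, coef_bracket, coef_add,
      (IsTorusOp.opLieD ha).add (hb.coef j) (hc.coef j), lieD_add_left]
    abel

theorem bracket_smul_right {a b : Coeffs n} (r : ℂ) (ha : IsLoop a) (hb : IsLoop b) :
    bracket a (r • b) = r • bracket a b :=
  coeffs_ext fun j => by
    rw [coef_smul, coef_bracket, coef_bracket, coef_smul,
      (IsTorusOp.opLieD ha).smul r (hb.coef j), lieD_smul_left, smul_sub]

theorem bracket_neg_right {a b : Coeffs n} (ha : IsLoop a) (hb : IsLoop b) :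
    bracket a (-b) = -bracket a b := by
  simpa using bracket_smul_right (-1) ha hb

theorem bracket_sub_right {a b c : Coeffs n} (ha : IsLoop a) (hb : IsLoop b) (hc : IsLoop c) :
    bracket a (b - c) = bracket a b - bracket a c := by
  rw [sub_eq_add_neg, bracket_add_right ha hb hc.neg, bracket_neg_right ha hc, sub_eq_add_neg]

theorem bracket_sub_left {a b c : Coeffs n} (ha : IsLoop a) (hb : IsLoop b) (hc : IsLoop c) :
    bracket (a - b) c = bracket a c - bracket b c := by
  rw [bracket_antisymm, bracket_sub_right hc ha hb, bracket_antisymm a c, bracket_antisymm b c]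
  abel

/-- The second order terms aₖ bᵢ ∂ₖ∂ᵢ f are symmetric under exchange of a and b because the
derivations commute. They cancel and leave the bracket. -/
theorem lieD_bracket {a b : Coeffs n} (ha : IsLoop a) (hb : IsLoop b) {f : Pt n → ℂ}
    (hf : IsTorusFun f) :
    lieD (bracket a b) f = lieD a (lieD b f) - lieD b (lieD a f) := by
  have key : ∀ {a b : Coeffs n}, IsLoop a → IsLoop b → lieD a (lieD b f) =
      ∑ i, lieD a (coef b i) * dd i f + ∑ i, ∑ k, coef a k * coef b i * dd k (dd i f) := by
    intro a b ha hb
    have h : lieD a (lieD b f) = ∑ i, lieD a (coef b i * dd i f) :=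
      (IsTorusOp.opLieD ha).sum _ fun i _ => (hb.coef i).mul (hf.dd i)
    rw [h, ← Finset.sum_add_distrib]
    refine Finset.sum_congr rfl fun i _ => ?_
    simp only [lieD, Finset.sum_mul, ← Finset.sum_add_distrib]
    refine Finset.sum_congr rfl fun k _ => ?_
    rw [dd_mul (hb.coef i) (hf.dd i)]
    ring
  have hsym : ∑ i, ∑ k, coef a k * coef b i * dd k (dd i f) =
      ∑ i, ∑ k, coef b k * coef a i * dd k (dd i f) := by
    rw [Finset.sum_comm]
    refine Finset.sum_congr rfl fun i _ => Finset.sum_congr rfl fun k _ => ?_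
    rw [dd_comm hf i k]
    ring
  rw [key ha hb, key hb ha, hsym]
  simp only [lieD, coef_bracket, sub_mul, Finset.sum_sub_distrib]
  abel

/-- The Jacobi identity. -/
theorem bracket_jacobi {a b c : Coeffs n} (ha : IsLoop a) (hb : IsLoop b) (hc : IsLoop c) :
    bracket (bracket a b) c = bracket a (bracket b c) - bracket b (bracket a c) :=
  coeffs_ext fun j => by
    have hL : ∀ {a b : Coeffs n}, IsLoop a → IsLoop b → ∀ j, IsTorusFun (lieD a (coef b j)) :=
      fun ha hb j => (IsTorusOp.opLieD ha).torusFun (hb.coef j)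
    -- Componentwise, Jacobi is the statement that a field acts on functions as a Lie algebra
    -- representation, applied to the coefficients of the third field.
    rw [coef_sub, coef_bracket, coef_bracket a (bracket b c), coef_bracket b (bracket a c),
      coef_bracket, coef_bracket, coef_bracket, lieD_bracket ha hb (hc.coef j),
      lieD_bracket hb hc (ha.coef j), lieD_bracket ha hc (hb.coef j),
      (IsTorusOp.opLieD hc).sub (hL ha hb j) (hL hb ha j),
      (IsTorusOp.opLieD ha).sub (hL hb hc j) (hL hc hb j),
      (IsTorusOp.opLieD hb).sub (hL ha hc j) (hL hc ha j)]
    abel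

theorem dpar_bracket {k : ℕ} {W : Set (Fin k → ℝ)} {a b : (Fin k → ℝ) → Coeffs n}
    (ha : IsPlot W a) (hb : IsPlot W b) {s : Fin k → ℝ} (hs : s ∈ W) (i : Fin k) :
    dpar i (fun s => bracket (a s) (b s)) s =
      bracket (dpar i a s) (b s) + bracket (a s) (dpar i b s) := by
  have key : ∀ {a : (Fin k → ℝ) → Coeffs n} {f : (Fin k → ℝ) → Pt n → ℂ}, IsPlot W a →
      IsTorusFamily W f → parD (Pi.single i 1) (fun s => lieD (a s) (f s)) s =
        lieD (dpar i a s) (f s) + lieD (a s) (parD (Pi.single i 1) f s) := by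
    intro a f ha hf
    simp only [lieD]
    rw [IsTorusFamily.parD_sum _ (fun i _ => (ha.coef i).mul ((IsTorusOp.opDd i).family hf)) hs,
      ← Finset.sum_add_distrib]
    refine Finset.sum_congr rfl fun l _ => ?_
    rw [(ha.coef l).parD_mul ((IsTorusOp.opDd l).family hf) hs, (IsTorusOp.opDd l).parD hf s hs,
      coef_dpar]
  refine coeffs_ext fun j => ?_
  rw [coef_dpar, coef_add, coef_bracket, coef_bracket]
  simp only [coef_bracket]
  rw [(lieD_family ha.coef (hb.coef j)).parD_sub (lieD_family hb.coef (ha.coef j)) hs,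
    key ha (hb.coef j), key hb (ha.coef j), coef_dpar, coef_dpar]
  abel

/-! ### Convolution operators -/

section Conv

variable {H : Type} [NormedAddCommGroup H] [NormedSpace ℝ H] [MeasurableSpace H] [BorelSpace H]
  [SecondCountableTopology H] (μ : Measure H) [IsFiniteMeasureOnCompacts μ]

/-- The operator of averaging the translates `f (z + A w)`, `w ∈ K`, with weight `κ`. -/
def convOp (A : H →L[ℝ] Pt n) (K : Set H) (κ : H → ℂ) (f : Pt n → ℂ) : Pt n → ℂ :=
  fun z => ∫ w in K, κ w * f (z + A w) ∂μ

variable {μ} {A : H →L[ℝ] Pt n} {K : Set H} {κ : H → ℂ}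

section

variable {E : Type} [NormedAddCommGroup E] [NormedSpace ℝ E] [LocallyCompactSpace E]
  {W : Set E} {f : E → Pt n → ℂ}

theorem contDiffOn_translate (hf : IsTorusFamily W f) (A : H →L[ℝ] Pt n) :
    ContDiffOn ℝ ∞ (fun r : (E × Pt n) × H => f r.1.1 (r.1.2 + A r.2))
      ((W ×ˢ univ) ×ˢ univ) := by
  refine hf.contDiffOn.comp (f := fun r : (E × Pt n) × H => (r.1.1, r.1.2 + A r.2)) ?_ ?_
  · exact ContDiff.contDiffOn (by fun_prop)
  · exact fun r hr => ⟨hr.1.1, mem_univ _⟩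

theorem fderiv_translate (hf : IsTorusFamily W f) (A : H →L[ℝ] Pt n) {s : E} (hs : s ∈ W)
    (z : Pt n) (w : H) (u : E × Pt n) :
    fderiv ℝ (fun r : (E × Pt n) × H => f r.1.1 (r.1.2 + A r.2)) ((s, z), w) (u, 0) =
      fderiv ℝ (fun r : E × Pt n => f r.1 r.2) (s, z + A w) u := by
  have h1 : HasFDerivAt (fun r : (E × Pt n) × H => (r.1.1, r.1.2 + A r.2))
      (((ContinuousLinearMap.fst ℝ E (Pt n)).comp (ContinuousLinearMap.fst ℝ (E × Pt n) H)).prod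
        (((ContinuousLinearMap.snd ℝ E (Pt n)).comp (ContinuousLinearMap.fst ℝ (E × Pt n) H)) +
          A.comp (ContinuousLinearMap.snd ℝ (E × Pt n) H))) ((s, z), w) :=
    ContinuousLinearMap.hasFDerivAt
      (((ContinuousLinearMap.fst ℝ E (Pt n)).comp (ContinuousLinearMap.fst ℝ (E × Pt n) H)).prod
        (((ContinuousLinearMap.snd ℝ E (Pt n)).comp (ContinuousLinearMap.fst ℝ (E × Pt n) H)) +
          A.comp (ContinuousLinearMap.snd ℝ (E × Pt n) H)))
  have h2 := (HasFDerivAt.comp ((s, z), w) (hf.differentiableAt hs (z + A w)).hasFDerivAt h1).fderiv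
  refine (DFunLike.congr_fun h2 (u, 0)).trans ?_
  simp

/-- Parameter and position are treated as one variable (s, z), so a single formula yields the
commutation both with parameter derivatives and with partial derivatives on the torus. -/
theorem fderiv_convOp (hf : IsTorusFamily W f) (hK : IsCompact K) (hκ : Continuous κ) {s : E}
    (hs : s ∈ W) (z : Pt n) (u : E × Pt n) :
    fderiv ℝ (fun r : E × Pt n => convOp μ A K κ (f r.1) r.2) (s, z) u =
      ∫ w in K, κ w * fderiv ℝ (fun r : E × Pt n => f r.1 r.2) (s, z + A w) u ∂μ := by
  refine (fderiv_integral_kernel hf.isOpen_prod hK hκ (contDiffOn_translate hf A)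
    ⟨hs, mem_univ z⟩ u).trans ?_
  simp only [fderiv_translate hf A hs]

theorem IsTorusFamily.convOp (hf : IsTorusFamily W f) (A : H →L[ℝ] Pt n) (hK : IsCompact K)
    (hκ : Continuous κ) : IsTorusFamily W (fun s => convOp μ A K κ (f s)) where
  isOpen := hf.isOpen
  contDiffOn := contDiffOn_integral_kernel hf.isOpen_prod hK hκ (contDiffOn_translate hf A)
  periodic s hs i z := by
    simp only [HolLoop.convOp]
    congr 1
    ext w
    rw [add_right_comm, hf.periodic s hs]

end

theorem IsTorusOp.opConv (A : H →L[ℝ] Pt n) (hK : IsCompact K) (hκ : Continuous κ) :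
    IsTorusOp (convOp μ A K κ) where
  family hf := hf.convOp A hK hκ
  parD hf s hs v := by
    ext z
    rw [(hf.convOp A hK hκ).parD_eq hs, fderiv_convOp hf hK hκ hs]
    simp only [convOp, hf.parD_eq hs]
  add hf hg := by
    ext z
    have h : ∀ {f : Pt n → ℂ}, IsTorusFun f → IntegrableOn (fun w => κ w * f (z + A w)) K μ :=
      fun hf => (hκ.mul (hf.continuous.comp (by fun_prop))).continuousOn.integrableOn_compact hK
    simp only [convOp, Pi.add_apply, mul_add]
    exact integral_add (h hf) (h hg)
  smul c f hf := by
    ext z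
    simp only [convOp, Pi.smul_apply, smul_eq_mul, mul_left_comm _ c]
    exact integral_const_mul c _

theorem pd_convOp {f : Pt n → ℂ} (hf : IsTorusFun f) (hK : IsCompact K) (hκ : Continuous κ)
    (i : Fin (n + 1)) : pd i (convOp μ A K κ f) = convOp μ A K κ (pd i f) := by
  ext z
  have h0 := hf.familyUniv
  have hs : (0 : ℝ) ∈ univ := mem_univ 0
  have := (h0.convOp (μ := μ) A hK hκ).pd_eq hs i z
  rw [this, fderiv_convOp h0 hK hκ hs]
  simp only [convOp, ← h0.pd_eq hs]

theorem continuous_translate {f : Pt n → ℂ} (hf : IsTorusFun f) (A : H →L[ℝ] Pt n) (z : Pt n) :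
    Continuous fun w => f (z + A w) := hf.continuous.comp (by fun_prop)

/-- Termwise integration of an absolutely convergent kernel. -/
theorem hasSum_convOp {ι : Type*} [Countable ι] {e : ι → H → ℂ} (he : ∀ k, Continuous (e k))
    (he1 : ∀ k w, ‖e k w‖ ≤ 1) {c : ι → ℂ} (hc : Summable c) (hK : IsCompact K)
    {f : Pt n → ℂ} (hf : IsTorusFun f) (z : Pt n) :
    HasSum (fun k => c k * convOp μ A K (e k) f z)
      (convOp μ A K (fun w => ∑' k, c k * e k w) f z) := by
  have hcf := continuous_translate hf A z
  obtain ⟨C, hC⟩ := hK.exists_bound_of_continuousOn hcf.continuousOn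
  have hint : ∀ k, IntegrableOn (fun w => c k * (e k w * f (z + A w))) K μ := fun k =>
    (continuous_const.mul ((he k).mul hcf)).continuousOn.integrableOn_compact hK
  have hb : ∀ k, ∀ᵐ w ∂(μ.restrict K), ‖c k * (e k w * f (z + A w))‖ ≤ ‖c k‖ * C := fun k =>
    (ae_restrict_iff' hK.measurableSet).2 (ae_of_all _ fun w hw => by
      rw [norm_mul, norm_mul]
      refine mul_le_mul_of_nonneg_left ?_ (norm_nonneg _)
      calc ‖e k w‖ * ‖f (z + A w)‖ ≤ 1 * C :=
            mul_le_mul (he1 k w) (hC w hw) (norm_nonneg _) zero_le_one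
        _ = C := one_mul C)
  have hsum : ∀ w, Summable fun k => c k * e k w := fun w =>
    Summable.of_norm_bounded hc.norm fun k => by
      rw [norm_mul]
      exact mul_le_of_le_one_right (norm_nonneg _) (he1 k w)
  have key := hasSum_integral_of_dominated_convergence
    (μ := μ.restrict K) (F := fun k w => c k * (e k w * f (z + A w)))
    (f := fun w => (∑' k, c k * e k w) * f (z + A w)) (bound := fun k _ => ‖c k‖ * C)
    (fun k => (hint k).aestronglyMeasurable) hb
    (ae_of_all _ fun w => hc.norm.mul_right C)
    (integrableOn_const hK.measure_lt_top.ne)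
    (ae_of_all _ fun w => by
      simpa only [mul_assoc] using (hsum w).hasSum.mul_right (f (z + A w)))
  refine (key.congr_fun ?_)
  intro k
  simp only [convOp]
  exact (integral_const_mul (c k) _).symm

theorem continuous_tsum_kernel {ι : Type*} {e : ι → H → ℂ} (he : ∀ k, Continuous (e k))
    (he1 : ∀ k w, ‖e k w‖ ≤ 1) {c : ι → ℂ} (hc : Summable c) :
    Continuous fun w => ∑' k, c k * e k w :=
  continuous_tsum (fun k => continuous_const.mul (he k)) hc.norm fun k w => by
    rw [norm_mul]
    exact mul_le_of_le_one_right (norm_nonneg _) (he1 k w)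

end Conv

/-! ### Integration over the torus -/

/-- A fundamental domain of the torus. -/
abbrev box (n : ℕ) : Set (Pt n) := Icc (0 : Pt n) (fun _ => 2 * Real.pi)

theorem isCompact_box : IsCompact (box n) := isCompact_Icc

theorem IsTorusFun.integrableOn_box {f : Pt n → ℂ} (hf : IsTorusFun f) :
    IntegrableOn f (box n) := hf.continuous.continuousOn.integrableOn_compact isCompact_box

/-- Divergence theorem for the field with only component f in the direction i. The integrals over
the two opposite faces agree by periodicity. -/
theorem integral_pd {f : Pt n → ℂ} (hf : IsTorusFun f) (i : Fin (n + 1)) :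
    ∫ z in box n, pd i f z = 0 := by
  classical
  have hle : (0 : Pt n) ≤ fun _ => 2 * Real.pi := fun _ => by simp [Real.pi_pos.le]
  let F : Fin (n + 1) → Pt n → ℂ := fun j => if j = i then f else 0
  have hF : ∀ j, ContDiff ℝ ∞ (F j) := fun j => by
    by_cases h : j = i
    · simp only [F, h, if_true]; exact hf.contDiff
    · simp only [F, h, if_false]; exact contDiff_const
  have hsum : ∀ x : Pt n, ∑ j, fderiv ℝ (F j) x (Pi.single j 1) = pd i f x := fun x => by
    rw [Finset.sum_eq_single i]
    · simp [F, pd]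
    · intro j _ hj
      simp [F, hj]
    · simp
  have key := integral_divergence_of_hasFDerivAt_off_countable' (0 : Pt n)
    (fun _ => 2 * Real.pi) hle F (fun j x => fderiv ℝ (F j) x) ∅ countable_empty
    (fun j => (hF j).continuous.continuousOn)
    (fun x _ j => ((hF j).differentiable (by simp) x).hasFDerivAt)
    (by simp only [hsum]; exact (hf.pd i).integrableOn_box)
  simp only [hsum] at key
  rw [key]
  refine Finset.sum_eq_zero fun j _ => ?_
  by_cases h : j = i
  · subst h
    rw [sub_eq_zero]
    congr 1
    ext x
    simp only [F, if_true]
    have hx : j.insertNth (2 * Real.pi) x =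
        (j.insertNth ((0 : Pt n) j) x : Pt n) + Pi.single j (2 * Real.pi) := by
      ext l
      refine Fin.succAboveCases j ?_ (fun l => ?_) l
      · simp
      · simp [Fin.succAbove_ne]
    rw [hx, hf.periodic]
  · simp [F, h]

/-! ### Fourier modes -/

/-- The phase `∑ kᵢ zᵢ`. -/
def phase (k : Fin (n + 1) → ℤ) (z : Pt n) : ℝ := ∑ i, (k i : ℝ) * z i

/-- The conjugate character `exp (-i k z)`. -/
def mode (k : Fin (n + 1) → ℤ) (z : Pt n) : ℂ := Complex.exp (-(Complex.I * phase k z))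

theorem norm_mode (k : Fin (n + 1) → ℤ) (z : Pt n) : ‖mode k z‖ = 1 := by
  have : -(Complex.I * phase k z) = ((-phase k z : ℝ) : ℂ) * Complex.I := by push_cast; ring
  rw [mode, this, Complex.norm_exp_ofReal_mul_I]

theorem hasFDerivAt_phase (k : Fin (n + 1) → ℤ) (z : Pt n) :
    HasFDerivAt (fun z => ((phase k z : ℝ) : ℂ)) (Complex.ofRealCLM.comp
      (∑ i, (k i : ℝ) • (ContinuousLinearMap.proj i : Pt n →L[ℝ] ℝ))) z := by
  have h := (Complex.ofRealCLM.comp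
      (∑ i, (k i : ℝ) • (ContinuousLinearMap.proj i : Pt n →L[ℝ] ℝ))).hasFDerivAt (x := z)
  refine h.congr_of_eventuallyEq (Eventually.of_forall fun w => ?_)
  simp [phase]

theorem isTorusFun_mode (k : Fin (n + 1) → ℤ) : IsTorusFun (mode k) where
  contDiff := by
    have : ContDiff ℝ ∞ (fun z : Pt n => ((phase k z : ℝ) : ℂ)) := by
      have h : ContDiff ℝ ∞ (fun z : Pt n => phase k z) :=
        ContDiff.sum fun i _ => contDiff_const.mul (contDiff_apply ℝ ℝ i)
      exact Complex.ofRealCLM.contDiff.comp h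
    exact (contDiff_const.mul this).neg.cexp
  periodic i z := by
    rw [mode, mode, Complex.exp_eq_exp_iff_exists_int]
    refine ⟨-(k i), ?_⟩
    have : phase k (z + Pi.single i (2 * Real.pi)) = phase k z + k i * (2 * Real.pi) := by
      simp only [phase, Pi.add_apply, mul_add, Finset.sum_add_distrib]
      congr 1
      rw [Finset.sum_eq_single i] <;> simp +contextual
    rw [this]
    push_cast
    ring

theorem pd_mode (k : Fin (n + 1) → ℤ) (i : Fin (n + 1)) :
    pd i (mode k) = (-(Complex.I * k i)) • mode k := by
  ext z
  have h := ((hasFDerivAt_phase k z).const_mul Complex.I).neg.cexp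
  refine (DFunLike.congr_fun h.fderiv _).trans ?_
  simp only [smul_apply, neg_apply, ContinuousLinearMap.comp_apply, sum_apply,
    ContinuousLinearMap.proj_apply, Complex.ofRealCLM_apply, Pi.smul_apply, smul_eq_mul, mode]
  rw [Finset.sum_eq_single i]
  · simp; ring
  · intro j _ hj
    simp [hj]
  · simp

/-- The component of frequency `k`. -/
def modeOp (k : Fin (n + 1) → ℤ) (f : Pt n → ℂ) : Pt n → ℂ :=
  convOp volume (ContinuousLinearMap.id ℝ (Pt n)) (box n) (mode k) f

theorem IsTorusFun.translate {f : Pt n → ℂ} (hf : IsTorusFun f) (z : Pt n) :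
    IsTorusFun (fun w => f (z + w)) where
  contDiff := hf.contDiff.comp (by fun_prop)
  periodic i w := by rw [← add_assoc, hf.periodic]

theorem pd_translate (f : Pt n → ℂ) (z : Pt n) (i : Fin (n + 1)) :
    pd i (fun w => f (z + w)) = fun w => pd i f (z + w) := by
  ext w
  simp only [pd, fderiv_comp_add_left]

theorem integral_mul_pd {f g : Pt n → ℂ} (hf : IsTorusFun f) (hg : IsTorusFun g)
    (i : Fin (n + 1)) :
    ∫ z in box n, f z * pd i g z = -∫ z in box n, pd i f z * g z := by
  have h := integral_pd (hf.mul hg) i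
  rw [pd_mul hf hg] at h
  have := integral_add ((hf.pd i).mul hg).integrableOn_box (hf.mul (hg.pd i)).integrableOn_box
  simp only [Pi.add_apply] at h
  rw [this] at h
  exact eq_neg_of_add_eq_zero_right h

theorem modeOp_pd {f : Pt n → ℂ} (hf : IsTorusFun f) (k : Fin (n + 1) → ℤ) (i : Fin (n + 1)) :
    modeOp k (pd i f) = (Complex.I * k i) • modeOp k f := by
  ext z
  simp only [modeOp, convOp, ContinuousLinearMap.id_apply, Pi.smul_apply, smul_eq_mul]
  have h := integral_mul_pd (isTorusFun_mode k) (hf.translate z) i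
  rw [pd_translate, pd_mode] at h
  rw [h, ← integral_neg, ← integral_const_mul]
  congr 1
  ext w
  simp only [Pi.smul_apply, smul_eq_mul]
  ring

section

open scoped Pointwise

/-! ### Fourier series on the torus -/

theorem summable_one_add_sq_inv : Summable fun k : ℤ => (1 + (k : ℝ) ^ 2)⁻¹ := by
  have h : Summable fun k : ℤ => 1 / (k : ℝ) ^ 2 :=
    Real.summable_one_div_int_pow.2 one_lt_two
  refine Summable.of_norm_bounded_eventually h ?_
  rw [Filter.eventually_cofinite]
  refine (finite_singleton (0 : ℤ)).subset fun k hk => ?_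
  by_contra h0
  have h0' : (k : ℝ) ≠ 0 := by exact_mod_cast h0
  refine hk ?_
  rw [Real.norm_of_nonneg (by positivity), ← one_div]
  exact one_div_le_one_div_of_le (by positivity) (by linarith)

theorem summable_prod_one_add_sq_inv (d : ℕ) :
    Summable fun k : Fin d → ℤ => (∏ i, (1 + (k i : ℝ) ^ 2))⁻¹ := by
  induction d with
  | zero => exact Summable.of_finite
  | succ d ih =>
    rw [← (Fin.consEquiv fun _ : Fin (d + 1) => ℤ).summable_iff]
    have h := summable_one_add_sq_inv.mul_of_nonneg ih (fun k => by positivity)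
      (fun k => inv_nonneg.2 (Finset.prod_nonneg fun i _ => by positivity))
    refine h.congr fun x => ?_
    simp [Fin.consEquiv, Fin.prod_univ_succ, mul_comm]

theorem IsTorusFun.periodic_lattice {f : Pt n → ℂ} (hf : IsTorusFun f) (m : Fin (n + 1) → ℤ)
    (z : Pt n) : f (z + fun i => m i * (2 * Real.pi)) = f z := by
  have h : ∀ S : Finset (Fin (n + 1)),
      Function.Periodic f (∑ i ∈ S, m i • (Pi.single i (2 * Real.pi) : Pt n)) := by
    classical
    intro S
    induction S using Finset.induction_on with
    | empty => intro z; simp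
    | insert a S ha ih =>
      rw [Finset.sum_insert ha]
      exact Function.Periodic.add_period (Function.Periodic.zsmul (hf.periodic a) (m a)) ih
  have hv : (fun i => m i * (2 * Real.pi) : Pt n) =
      ∑ i, m i • (Pi.single i (2 * Real.pi) : Pt n) := by
    ext j
    rw [Finset.sum_apply, Finset.sum_eq_single j]
    · simp
    · intro i _ hi
      simp [Pi.single_eq_of_ne (Ne.symm hi)]
    · simp
  rw [hv]
  exact h Finset.univ z

theorem norm_modeOp_le (f : Pt n → ℂ) (z : Pt n) :
    ∃ C, ∀ k, ‖modeOp k f z‖ ≤ C := by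
  refine ⟨∫ w in box n, ‖f (z + w)‖, fun k => ?_⟩
  refine (norm_integral_le_integral_norm _).trans (le_of_eq ?_)
  simp [norm_mode]

/-- The function is recentred at z, so that Fourier inversion for f at z becomes the evaluation of a
series at the origin of the unit torus. -/
theorem exists_torus_lift {f : Pt n → ℂ} (hf : IsTorusFun f) (z : Pt n) :
    ∃ g : C(UnitAddTorus (Fin (n + 1)), ℂ),
      ∀ t : Pt n, g (fun i => (t i : UnitAddCircle)) = f (z + (2 * Real.pi) • t) := by
  have hq : IsOpenQuotientMap
      (Pi.map fun (_ : Fin (n + 1)) (x : ℝ) => (x : UnitAddCircle)) :=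
    IsOpenQuotientMap.piMap fun _ => QuotientAddGroup.isOpenQuotientMap_mk
  let F : C(Pt n, ℂ) := ⟨fun t => f (z + (2 * Real.pi) • t), hf.continuous.comp (by fun_prop)⟩
  let Q : C(Pt n, UnitAddTorus (Fin (n + 1))) := ⟨_, hq.continuous⟩
  have hQ : IsQuotientMap Q := hq.isQuotientMap
  have hfac : Function.FactorsThrough F Q := by
    intro a b hab
    have h : ∀ i, ∃ m : ℤ, a i = b i + m := fun i => by
      have hi : ((a i : ℝ) : UnitAddCircle) = (b i : ℝ) := congrFun hab i
      rw [QuotientAddGroup.eq, AddSubgroup.mem_zmultiples_iff] at hi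
      obtain ⟨m, hm⟩ := hi
      refine ⟨-m, ?_⟩
      simp at hm
      push_cast
      linarith
    choose m hm using h
    have : z + (2 * Real.pi) • a = (z + (2 * Real.pi) • b) + fun i => m i * (2 * Real.pi) := by
      ext i
      simp [hm i]
      ring
    change f (z + (2 * Real.pi) • a) = f (z + (2 * Real.pi) • b)
    rw [this, hf.periodic_lattice]
  exact ⟨hQ.lift F hfac, fun t => DFunLike.congr_fun (hQ.lift_comp F hfac) t⟩

/-- The substitution w = 2πt turns the coefficient over the unit cube into the integral of exp(-ikw)
f(z + w) over the box of side 2π. The constant is the Jacobian, and half-open and closed boxes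
differ by a null set. -/
theorem mFourierCoeff_lift {f : Pt n → ℂ} (z : Pt n)
    {g : UnitAddTorus (Fin (n + 1)) → ℂ}
    (hg : ∀ t : Pt n, g (fun i => (t i : UnitAddCircle)) = f (z + (2 * Real.pi) • t))
    (k : Fin (n + 1) → ℤ) :
    UnitAddTorus.mFourierCoeff g k = ((2 * Real.pi : ℂ) ^ (n + 1))⁻¹ * modeOp k f z := by
  have hpi : 0 < 2 * Real.pi := by positivity
  rw [UnitAddTorus.mFourierCoeff_eq_integral g k 0]
  have h1 : ∀ t : Pt n, UnitAddTorus.mFourier (-k) (fun i => (t i : UnitAddCircle)) =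
      mode k ((2 * Real.pi) • t) := fun t => by
    simp only [UnitAddTorus.mFourier, ContinuousMap.coe_mk, fourier_coe_apply]
    rw [← Complex.exp_sum, mode, phase]
    congr 1
    push_cast
    rw [Finset.mul_sum, ← Finset.sum_neg_distrib]
    refine Finset.sum_congr rfl fun i _ => ?_
    simp
    ring
  simp only [h1, hg, smul_eq_mul]
  rw [Measure.setIntegral_comp_smul_of_pos volume (fun w => mode k w * f (z + w)) _ hpi]
  have hset : (2 * Real.pi) • {x : Fin (n + 1) → ℝ | ∀ i, x i ∈ Ioc ((0 : Pt n) i) ((0 : Pt n) i + 1)}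
      = pi univ fun i => Ioc ((0 : Pt n) i) ((fun _ => 2 * Real.pi : Pt n) i) := by
    ext x
    rw [mem_smul_set_iff_inv_smul_mem₀ hpi.ne']
    simp only [Pi.zero_apply, mem_ofPred_eq, Pi.smul_apply, smul_eq_mul, mem_Ioc, zero_add,
      Set.mem_pi, mem_univ, true_imp_iff]
    refine forall_congr' fun i => and_congr ?_ ?_
    · rw [mul_pos_iff_of_pos_left (by positivity)]
    · rw [inv_mul_le_iff₀ hpi, mul_one]
  rw [hset, volume_pi, setIntegral_congr_set Measure.univ_pi_Ioc_ae_eq_Icc]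
  simp [modeOp, convOp, volume_pi]

/-- Linear operators with constant coefficients, with their symbols. -/
structure IsConstOp (D : (Pt n → ℂ) → Pt n → ℂ) (σ : (Fin (n + 1) → ℤ) → ℂ) : Prop where
  op : IsTorusOp D
  conv : ∀ {κ : Pt n → ℂ}, Continuous κ → ∀ {f : Pt n → ℂ}, IsTorusFun f →
    D (convOp volume (ContinuousLinearMap.id ℝ (Pt n)) (box n) κ f) =
      convOp volume (ContinuousLinearMap.id ℝ (Pt n)) (box n) κ (D f)
  symbol : ∀ (k : Fin (n + 1) → ℤ) {f : Pt n → ℂ}, IsTorusFun f →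
    modeOp k (D f) = σ k • modeOp k f

/-! ### Constant coefficient operators and their symbols. -/

namespace IsConstOp

variable {D D' : (Pt n → ℂ) → Pt n → ℂ} {σ σ' : (Fin (n + 1) → ℤ) → ℂ}

theorem opBoxConv {κ : Pt n → ℂ} (hκ : Continuous κ) :
    IsTorusOp (convOp volume (ContinuousLinearMap.id ℝ (Pt n)) (box n) κ) :=
  IsTorusOp.opConv _ isCompact_box hκ

theorem opMode (k : Fin (n + 1) → ℤ) : IsTorusOp (modeOp k) :=
  opBoxConv (isTorusFun_mode k).continuous

theorem id : IsConstOp (n := n) (fun f => f) (fun _ => 1) :=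
  ⟨IsTorusOp.id, fun _ _ _ => rfl, fun _ _ _ => by simp⟩

theorem pd (i : Fin (n + 1)) : IsConstOp (n := n) (pd i) (fun k => Complex.I * k i) where
  op := IsTorusOp.opPd i
  conv hκ _ hf := pd_convOp hf isCompact_box hκ i
  symbol k _ hf := modeOp_pd hf k i

theorem comp (hD : IsConstOp D σ) (hD' : IsConstOp D' σ') :
    IsConstOp (fun f => D (D' f)) (fun k => σ k * σ' k) where
  op := hD.op.comp hD'.op
  conv hκ _ hf := by rw [hD'.conv hκ hf, hD.conv hκ (hD'.op.torusFun hf)]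
  symbol k _ hf := by
    rw [hD.symbol k (hD'.op.torusFun hf), hD'.symbol k hf, smul_smul]

theorem add (hD : IsConstOp D σ) (hD' : IsConstOp D' σ') :
    IsConstOp (fun f => D f + D' f) (fun k => σ k + σ' k) where
  op := hD.op.opAdd hD'.op
  conv hκ _ hf := by
    rw [hD'.conv hκ hf, hD.conv hκ hf,
      (opBoxConv hκ).add (hD.op.torusFun hf) (hD'.op.torusFun hf)]
  symbol k _ hf := by
    rw [(opMode k).add (hD.op.torusFun hf) (hD'.op.torusFun hf), hD.symbol k hf,
      hD'.symbol k hf, add_smul]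

theorem smul (hD : IsConstOp D σ) (c : ℂ) : IsConstOp (fun f => c • D f) (fun k => c * σ k) where
  op := hD.op.opSMul c
  conv hκ _ hf := by rw [hD.conv hκ hf, (opBoxConv hκ).smul c (hD.op.torusFun hf)]
  symbol k _ hf := by
    rw [(opMode k).smul c (hD.op.torusFun hf), hD.symbol k hf, smul_smul]

theorem sum {ι : Type*} (S : Finset ι) {D : ι → (Pt n → ℂ) → Pt n → ℂ}
    {σ : ι → (Fin (n + 1) → ℤ) → ℂ} (hD : ∀ i ∈ S, IsConstOp (D i) (σ i)) :
    IsConstOp (fun f => ∑ i ∈ S, D i f) (fun k => ∑ i ∈ S, σ i k) := by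
  classical
  induction S using Finset.induction_on with
  | empty => simpa using id.smul (n := n) 0
  | insert a S ha ih =>
    simp only [Finset.sum_insert ha]
    exact (hD a (by simp)).add (ih fun i hi => hD i (by simp [hi]))

theorem iterate (hD : IsConstOp D σ) (m : ℕ) : IsConstOp (D^[m]) (fun k => σ k ^ m) := by
  induction m with
  | zero =>
    simp only [pow_zero]
    exact id
  | succ m ih =>
    simp only [pow_succ]
    exact ih.comp hD

theorem exists_prod {ι : Type*} (L : List ι) {D : ι → (Pt n → ℂ) → Pt n → ℂ}
    {σ : ι → (Fin (n + 1) → ℤ) → ℂ} (hD : ∀ i, IsConstOp (D i) (σ i)) :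
    ∃ T, IsConstOp T (fun k => (L.map fun i => σ i k).prod) := by
  induction L with
  | nil => exact ⟨_, by simpa using id (n := n)⟩
  | cons a L ih =>
    obtain ⟨T, hT⟩ := ih
    exact ⟨_, by simpa using (hD a).comp hT⟩

theorem exists_elliptic : ∃ T, IsConstOp (n := n) T (fun k => ∏ i, (1 + (k i : ℂ) ^ 2)) := by
  have h : ∀ i, IsConstOp (n := n) (fun f => f + (-1 : ℂ) • HolLoop.pd i (HolLoop.pd i f))
      (fun k => 1 + (k i : ℂ) ^ 2) := fun i => by
    have h := id.add (((pd (n := n) i).comp (pd i)).smul (-1))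
    have hs : ∀ k : Fin (n + 1) → ℤ, 1 + -1 * (Complex.I * k i * (Complex.I * k i)) =
        1 + (k i : ℂ) ^ 2 := fun k => by linear_combination (-(k i : ℂ) ^ 2) * Complex.I_sq
    simpa only [hs] using h
  obtain ⟨T, hT⟩ := exists_prod (List.finRange (n + 1)) h
  exact ⟨T, by simpa only [Fin.prod_univ_def] using hT⟩

end IsConstOp

theorem prod_one_add_sq_ne_zero (k : Fin (n + 1) → ℤ) : (∏ i, (1 + (k i : ℂ) ^ 2)) ≠ 0 := by
  refine Finset.prod_ne_zero_iff.2 fun i _ => ?_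
  have : (1 + (k i : ℝ) ^ 2) ≠ 0 := by positivity
  exact_mod_cast this

theorem norm_prod_one_add_sq (k : Fin (n + 1) → ℤ) :
    ‖∏ i, (1 + (k i : ℂ) ^ 2)‖ = ∏ i, (1 + (k i : ℝ) ^ 2) := by
  rw [norm_prod]
  refine Finset.prod_congr rfl fun i _ => ?_
  have : (1 + (k i : ℂ) ^ 2) = ((1 + (k i : ℝ) ^ 2 : ℝ) : ℂ) := by push_cast; ring
  rw [this, Complex.norm_real, Real.norm_of_nonneg (by positivity)]

/-- The modes of T f are bounded in k and equal those of f times ∏ (1 + kᵢ²), so the modes of f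
decay summably. -/
theorem summable_modeOp {f : Pt n → ℂ} (hf : IsTorusFun f) (z : Pt n) :
    Summable fun k => modeOp k f z := by
  obtain ⟨T, hT⟩ := IsConstOp.exists_elliptic (n := n)
  obtain ⟨C, hC⟩ := norm_modeOp_le (T f) z
  refine Summable.of_norm_bounded ((summable_prod_one_add_sq_inv (n + 1)).mul_right C) fun k => ?_
  have h := congrFun (hT.symbol k hf) z
  rw [Pi.smul_apply, smul_eq_mul] at h
  have h2 := hC k
  rw [h, norm_mul, norm_prod_one_add_sq] at h2
  have hpos : 0 < ∏ i, (1 + (k i : ℝ) ^ 2) := Finset.prod_pos fun i _ => by positivity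
  rw [inv_mul_eq_div, le_div_iff₀ hpos]
  linarith

/-- Fourier inversion. -/
theorem hasSum_modeOp {f : Pt n → ℂ} (hf : IsTorusFun f) (z : Pt n) :
    HasSum (fun k => ((2 * Real.pi : ℂ) ^ (n + 1))⁻¹ * modeOp k f z) (f z) := by
  obtain ⟨g, hg⟩ := exists_torus_lift hf z
  have hc := mFourierCoeff_lift z hg
  have hs : Summable (UnitAddTorus.mFourierCoeff g) := by
    rw [funext hc]
    exact (summable_modeOp hf z).mul_left _
  -- At the origin all characters equal 1, so the series is just the sum of the coefficients and its
  -- value is f z.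
  have h := UnitAddTorus.hasSum_mFourier_series_apply_of_summable hs
    (fun i => (((0 : Pt n) i : ℝ) : UnitAddCircle))
  rw [hg] at h
  simpa [hc, UnitAddTorus.mFourier] using h

/-- Invertibility of elliptic operators with constant coefficients. -/
theorem IsConstOp.exists_rightInverse {D : (Pt n → ℂ) → Pt n → ℂ} {σ : (Fin (n + 1) → ℤ) → ℂ}
    (hD : IsConstOp D σ) (hσ : ∀ k, 1 ≤ ‖σ k‖) :
    ∃ M, IsTorusOp M ∧ ∀ f, IsTorusFun f → D (M f) = f := by
  obtain ⟨T, hT⟩ := IsConstOp.exists_elliptic (n := n)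
  have hσ0 : ∀ k, σ k ≠ 0 := fun k h => by
    have := hσ k
    rw [h, norm_zero] at this
    linarith
  -- The inverse is f ↦ κ * T f with T = ∏ (1 - ∂ᵢ²) and κ = ∑ cₖ exp(-ikw). The factor ∏ (1 +
  -- kᵢ²)⁻¹ undoes T and makes κ absolutely convergent, σ(k)⁻¹ undoes D, and the power of 2π is the
  -- normalisation in Fourier inversion.
  set c : (Fin (n + 1) → ℤ) → ℂ := fun k =>
    ((2 * Real.pi : ℂ) ^ (n + 1))⁻¹ * ((σ k)⁻¹ * (∏ i, (1 + (k i : ℂ) ^ 2))⁻¹) with hcdef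
  have hc : Summable c := by
    refine Summable.mul_left _ (Summable.of_norm_bounded (summable_prod_one_add_sq_inv (n + 1))
      fun k => ?_)
    rw [norm_mul, norm_inv, norm_inv, norm_prod_one_add_sq]
    refine mul_le_of_le_one_left ?_ (inv_le_one_of_one_le₀ (hσ k))
    exact inv_nonneg.2 (Finset.prod_nonneg fun i _ => by positivity)
  have hm : ∀ k : Fin (n + 1) → ℤ, Continuous (mode k) := fun k => (isTorusFun_mode k).continuous
  have hm1 : ∀ (k : Fin (n + 1) → ℤ) w, ‖mode k w‖ ≤ 1 := fun k w => (norm_mode k w).le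
  have hκ := continuous_tsum_kernel hm hm1 hc
  refine ⟨_, (IsConstOp.opBoxConv hκ).comp hT.op, fun f hf => ?_⟩
  rw [hD.conv hκ (hT.op.torusFun hf)]
  ext z
  have hg : IsTorusFun (D (T f)) := hD.op.torusFun (hT.op.torusFun hf)
  have h1 := hasSum_convOp (μ := volume) (A := ContinuousLinearMap.id ℝ (Pt n)) hm hm1 hc
    isCompact_box hg z
  refine h1.unique ((hasSum_modeOp hf z).congr_fun fun k => ?_)
  have h2 : modeOp k (D (T f)) z = σ k * ((∏ i, (1 + (k i : ℂ) ^ 2)) * modeOp k f z) := by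
    rw [hD.symbol k (hT.op.torusFun hf), hT.symbol k hf]
    rfl
  change c k * modeOp k (D (T f)) z = _
  rw [h2, hcdef]
  field_simp [hσ0 k, prod_one_add_sq_ne_zero k]

end

/-! ### The pairing -/

/-- The weight of the pairing. -/
def weight (p : ℤ) (z : Pt n) : ℂ := lam z ^ (-p) * (Complex.I * lam z)

theorem weight_eq (p : ℤ) : weight (n := n) p = Complex.I • fun z => lam z ^ (1 - p) := by
  ext z
  simp only [weight, Pi.smul_apply, smul_eq_mul]
  rw [show 1 - p = -p + 1 by ring, zpow_add_one₀ (lam_ne_zero z)]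
  ring

theorem isTorusFun_weight (p : ℤ) : IsTorusFun (weight (n := n) p) := by
  rw [weight_eq]
  exact (isTorusFun_lam_zpow _).smul _

theorem pd_succ_weight (p : ℤ) (i : Fin n) : pd i.succ (weight (n := n) p) = 0 := by
  rw [weight_eq, pd_smul (isTorusFun_lam_zpow _), pd_succ_lam_zpow, smul_zero]

/-- The inverse of the weight. -/
def weightInv (p : ℤ) : Pt n → ℂ := (-Complex.I) • fun z => lam z ^ (p - 1)

theorem isTorusFun_weightInv (p : ℤ) : IsTorusFun (weightInv (n := n) p) :=
  (isTorusFun_lam_zpow _).smul _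

theorem pd_succ_weightInv (p : ℤ) (i : Fin n) : pd i.succ (weightInv (n := n) p) = 0 := by
  rw [weightInv, pd_smul (isTorusFun_lam_zpow _), pd_succ_lam_zpow, smul_zero]

theorem weight_mul_weightInv (p : ℤ) : weight (n := n) p * weightInv p = 1 := by
  ext z
  have h : lam z ^ (1 - p) * lam z ^ (p - 1) = 1 := by
    rw [← zpow_add₀ (lam_ne_zero z)]
    simp
  simp only [weight_eq, weightInv, Pi.mul_apply, Pi.smul_apply, smul_eq_mul, Pi.one_apply]
  linear_combination (-Complex.I ^ 2) * h - Complex.I_sq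

/-- `D'` is the transpose of `D` with respect to integration with the weight `ρ`. -/
def IsTranspose (ρ : Pt n → ℂ) (D D' : (Pt n → ℂ) → Pt n → ℂ) : Prop :=
  ∀ u v, IsTorusFun u → IsTorusFun v →
    ∫ z in box n, (ρ * u * D v) z = ∫ z in box n, (ρ * D' u * v) z

theorem IsTranspose.comp {ρ : Pt n → ℂ} {D₁ D₁' D₂ D₂' : (Pt n → ℂ) → Pt n → ℂ}
    (h₁ : IsTranspose ρ D₁ D₁') (h₂ : IsTranspose ρ D₂ D₂') (hD₂ : IsTorusOp D₂)
    (hD₁' : IsTorusOp D₁') : IsTranspose ρ (fun f => D₁ (D₂ f)) (fun f => D₂' (D₁' f)) :=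
  fun u v hu hv => by rw [h₁ u _ hu (hD₂.torusFun hv), h₂ _ v (hD₁'.torusFun hu) hv]

theorem IsTranspose.iterate {ρ : Pt n → ℂ} {D D' : (Pt n → ℂ) → Pt n → ℂ}
    (h : IsTranspose ρ D D') (hD : IsTorusOp D) (hD' : IsTorusOp D') (m : ℕ) :
    IsTranspose ρ (D^[m]) (D'^[m]) := by
  induction m with
  | zero => exact fun u v _ _ => rfl
  | succ m ih =>
    have h2 := ih.comp h hD (hD'.iterate m)
    rw [Function.iterate_succ' D']
    exact h2

/-- Integration by parts; the weight is constant along the i-th coordinate and contributes no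
derivative. -/
theorem isTranspose_pd_of_pd_eq_zero {ρ : Pt n → ℂ} (hρ : IsTorusFun ρ) {i : Fin (n + 1)}
    (h : pd i ρ = 0) : IsTranspose ρ (pd i) (fun f => (-1 : ℂ) • pd i f) := fun u v hu hv => by
  have h1 := integral_mul_pd (hρ.mul hu) hv i
  rw [pd_mul hρ hu, h, zero_mul, zero_add] at h1
  simp only [Pi.mul_apply, Pi.smul_apply, smul_eq_mul] at h1 ⊢
  rw [h1, ← integral_neg]
  congr 1
  ext z
  ring

/-- Differentiation along a list of coordinates. -/
def dList (L : List (Fin n)) (α : Fin n → ℕ) (f : Pt n → ℂ) : Pt n → ℂ :=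
  L.foldr (fun i g => (pd i.succ)^[α i] g) f

theorem dMulti_eq (α : Fin n → ℕ) : dMulti α = dList (List.finRange n) α := rfl

theorem isConstOp_dList (L : List (Fin n)) (α : Fin n → ℕ) :
    IsConstOp (dList L α) (fun k => (L.map fun i => (Complex.I * k i.succ) ^ α i).prod) := by
  induction L with
  | nil => simpa [dList] using! IsConstOp.id (n := n)
  | cons i L ih =>
    simp only [List.map_cons, List.prod_cons]
    exact ((IsConstOp.pd i.succ).iterate (α i)).comp ih

theorem opMulti (α : Fin n → ℕ) : IsTorusOp (dMulti α) := (isConstOp_dList _ α).op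

theorem exists_transpose_dList {ρ : Pt n → ℂ} (hρ : IsTorusFun ρ)
    (hρ' : ∀ i : Fin n, pd i.succ ρ = 0) (L : List (Fin n)) (α : Fin n → ℕ) :
    ∃ D', IsConstOp D' (fun k => (L.map fun i => (-(Complex.I * k i.succ)) ^ α i).prod) ∧
      IsTranspose ρ (dList L α) D' := by
  induction L with
  | nil => exact ⟨_, by simpa using IsConstOp.id (n := n), fun u v _ _ => rfl⟩
  | cons i L ih =>
    obtain ⟨D', hD', ht⟩ := ih
    have h1 := isTranspose_pd_of_pd_eq_zero hρ (hρ' i)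
    have h2 : IsConstOp (fun f => (-1 : ℂ) • pd i.succ f) (fun k => -(Complex.I * k i.succ)) := by
      simpa using (IsConstOp.pd (n := n) i.succ).smul (-1)
    refine ⟨_, ?_, (h1.iterate (IsTorusOp.opPd _) h2.op (α i)).comp ht (isConstOp_dList L α).op
      (h2.iterate (α i)).op⟩
    simpa only [List.map_cons, List.prod_cons, mul_comm] using hD'.comp (h2.iterate (α i))

/-- Each product (-ik)^α (ik)^α equals k^{2α} ≥ 0, and α = 0 alone contributes 1. This includes q =
0 and frequencies with vanishing torus part. -/
theorem one_le_norm_laplacian_symbol (q : ℕ) (k : Fin (n + 1) → ℤ) :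
    1 ≤ ‖∑ α ∈ multiIndices n q,
      ((List.finRange n).map fun i => (-(Complex.I * k i.succ)) ^ α i).prod *
        ((List.finRange n).map fun i => (Complex.I * k i.succ) ^ α i).prod‖ := by
  have h : ∀ α : Fin n → ℕ,
      ((List.finRange n).map fun i => (-(Complex.I * k i.succ)) ^ α i).prod *
        ((List.finRange n).map fun i => (Complex.I * k i.succ) ^ α i).prod =
      ((∏ i : Fin n, ((k i.succ : ℝ) ^ 2) ^ α i : ℝ) : ℂ) := fun α => by
    rw [← Fin.prod_univ_def, ← Fin.prod_univ_def, ← Finset.prod_mul_distrib]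
    push_cast
    refine Finset.prod_congr rfl fun i _ => ?_
    rw [← mul_pow]
    congr 1
    linear_combination (-(k i.succ : ℂ) ^ 2) * Complex.I_sq
  simp only [h]
  rw [← Complex.ofReal_sum, Complex.norm_real]
  refine le_trans ?_ (le_abs_self _)
  have h0 : (0 : Fin n → ℕ) ∈ multiIndices n q := by simp [multiIndices]
  refine le_trans (by simp) (Finset.single_le_sum (f := fun α : Fin n → ℕ =>
    ∏ i : Fin n, ((k i.succ : ℝ) ^ 2) ^ α i) (fun α _ => ?_) h0)
  exact Finset.prod_nonneg fun i _ => by positivity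

theorem pairing_eq (p : ℤ) (q : ℕ) (l a : Coeffs n) :
    pairing p q l a = (2 * Real.pi * Complex.I)⁻¹ * ∫ z in box n, (weight p *
      ∑ j, ∑ α ∈ multiIndices n q, dMulti α (coef l j) * dMulti α (coef a j) :
        Pt n → ℂ) z := by
  simp only [pairing, Pi.mul_apply, Finset.sum_apply, weight]
  rfl

/-- The pairing in terms of the elliptic operator `∑ (-1)^|α| ∂^{2α}`. -/
theorem exists_laplacian (n : ℕ) (p : ℤ) (q : ℕ) :
    ∃ Λ M : (Pt n → ℂ) → Pt n → ℂ, IsTorusOp Λ ∧ IsTorusOp M ∧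
      (∀ f, IsTorusFun f → Λ (M f) = f) ∧
      ∀ l a : Coeffs n, IsLoop l → IsLoop a → pairing p q l a =
        (2 * Real.pi * Complex.I)⁻¹ *
          ∫ z in box n, (weight p * ∑ j, Λ (coef l j) * coef a j : Pt n → ℂ) z := by
  have h := fun α : Fin n → ℕ => exists_transpose_dList (isTorusFun_weight p)
    (pd_succ_weight p) (List.finRange n) α
  choose D' hD' ht using h
  -- Λ is the sum over α of the transpose of ∂^α composed with ∂^α. Transposing needs no correction
  -- from the weight because the weight depends on λ only.
  have hΛ := IsConstOp.sum (multiIndices n q)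
    fun α _ => (hD' α).comp (isConstOp_dList (List.finRange n) α)
  obtain ⟨M, hM, hΛM⟩ := hΛ.exists_rightInverse (one_le_norm_laplacian_symbol q)
  refine ⟨_, M, hΛ.op, hM, hΛM, fun l a hl ha => ?_⟩
  rw [pairing_eq]
  congr 1
  have hρ := isTorusFun_weight (n := n) p
  simp only [Finset.mul_sum, Finset.sum_mul, Finset.sum_apply]
  have hd : ∀ (α : Fin n → ℕ) {b : Coeffs n}, IsLoop b → ∀ j, IsTorusFun (dMulti α (coef b j)) :=
    fun α b hb j => (opMulti α).torusFun (hb.coef j)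
  rw [integral_finsetSum, integral_finsetSum]
  · refine Finset.sum_congr rfl fun j _ => ?_
    rw [integral_finsetSum, integral_finsetSum]
    · refine Finset.sum_congr rfl fun α _ => ?_
      have := ht α _ _ (hd α hl j) (ha.coef j)
      simp only [← dMulti_eq, mul_assoc] at this ⊢
      exact this
    · exact fun α _ => (hρ.mul (((hD' α).op.torusFun (hd α hl j)).mul (ha.coef j))).integrableOn_box
    · exact fun α _ => (hρ.mul ((hd α hl j).mul (hd α ha j))).integrableOn_box
  · exact fun j _ => integrable_finsetSum _ fun α _ =>
      (hρ.mul (((hD' α).op.torusFun (hd α hl j)).mul (ha.coef j))).integrableOn_box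
  · exact fun j _ => integrable_finsetSum _ fun α _ =>
      (hρ.mul ((hd α hl j).mul (hd α ha j))).integrableOn_box

theorem pairing_comm (p : ℤ) (q : ℕ) (l a : Coeffs n) : pairing p q l a = pairing p q a l := by
  simp only [pairing_eq, mul_comm]

theorem pairing_add_right {p : ℤ} {q : ℕ} {l a b : Coeffs n} (hl : IsLoop l) (ha : IsLoop a)
    (hb : IsLoop b) : pairing p q l (a + b) = pairing p q l a + pairing p q l b := by
  obtain ⟨Λ, M, hΛ, -, -, h⟩ := exists_laplacian n p q
  have hi : ∀ {b : Coeffs n}, IsLoop b → IsTorusFun (weight p * ∑ j, Λ (coef l j) * coef b j) :=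
    fun hb => (isTorusFun_weight p).mul (IsTorusFun.sum _ fun j _ =>
      (hΛ.torusFun (hl.coef j)).mul (hb.coef j))
  rw [h l _ hl (ha.add hb), h l a hl ha, h l b hl hb, ← mul_add,
    ← integral_add (hi ha).integrableOn_box (hi hb).integrableOn_box]
  simp only [coef_add, mul_add, Finset.sum_add_distrib, Pi.add_apply]

theorem pairing_smul_right {p : ℤ} {q : ℕ} {l a : Coeffs n} (c : ℂ) (hl : IsLoop l)
    (ha : IsLoop a) : pairing p q l (c • a) = c * pairing p q l a := by
  obtain ⟨Λ, M, hΛ, -, -, h⟩ := exists_laplacian n p q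
  rw [h l _ hl (ha.smul c), h l a hl ha, mul_left_comm]
  simp only [coef_smul, mul_smul_comm, ← Finset.smul_sum, Pi.smul_apply, smul_eq_mul]
  rw [integral_const_mul]

theorem pairing_neg_right {p : ℤ} {q : ℕ} {l a : Coeffs n} (hl : IsLoop l) (ha : IsLoop a) :
    pairing p q l (-a) = -pairing p q l a := by
  simpa using pairing_smul_right (p := p) (q := q) (-1) hl ha

theorem pairing_sub_right {p : ℤ} {q : ℕ} {l a b : Coeffs n} (hl : IsLoop l) (ha : IsLoop a)
    (hb : IsLoop b) : pairing p q l (a - b) = pairing p q l a - pairing p q l b := by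
  rw [sub_eq_add_neg, pairing_add_right hl ha hb.neg, pairing_neg_right hl hb, sub_eq_add_neg]

theorem pairing_sub_left {p : ℤ} {q : ℕ} {l a b : Coeffs n} (hl : IsLoop l) (ha : IsLoop a)
    (hb : IsLoop b) : pairing p q (a - b) l = pairing p q a l - pairing p q b l := by
  rw [pairing_comm, pairing_sub_right hl ha hb, pairing_comm _ _ l, pairing_comm _ _ l]

theorem pairing_neg_left {p : ℤ} {q : ℕ} {l a : Coeffs n} (hl : IsLoop l) (ha : IsLoop a) :
    pairing p q (-a) l = -pairing p q a l := by
  rw [pairing_comm, pairing_neg_right hl ha, pairing_comm]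

theorem pairing_zero_left {p : ℤ} {q : ℕ} {l : Coeffs n} (hl : IsLoop l) :
    pairing p q 0 l = 0 := by
  simpa using pairing_sub_left (p := p) (q := q) hl hl hl

/-! ### Nondegeneracy of the pairing -/

theorem dList_mul_of_pd_eq_zero {g : Pt n → ℂ} (hg : IsTorusFun g)
    (hg' : ∀ i : Fin n, pd i.succ g = 0) (L : List (Fin n)) (α : Fin n → ℕ) {f : Pt n → ℂ}
    (hf : IsTorusFun f) : dList L α (g * f) = g * dList L α f := by
  have hit : ∀ (i : Fin n) (m : ℕ) {f : Pt n → ℂ}, IsTorusFun f →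
      (pd i.succ)^[m] (g * f) = g * (pd i.succ)^[m] f := by
    intro i m
    induction m with
    | zero => intro f _; rfl
    | succ m ih =>
      intro f hf
      rw [Function.iterate_succ_apply, Function.iterate_succ_apply, pd_mul hg hf, hg', zero_mul,
        zero_add, ih (hf.pd _)]
  induction L with
  | nil => rfl
  | cons i L ih =>
    change (pd i.succ)^[α i] (dList L α (g * f)) = g * (pd i.succ)^[α i] (dList L α f)
    rw [ih, hit i (α i) ((isConstOp_dList L α).op.torusFun hf)]

theorem dList_conj (L : List (Fin n)) (α : Fin n → ℕ) {f : Pt n → ℂ} (hf : IsTorusFun f) :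
    dList L α (fun z => (starRingEnd ℂ) (f z)) = fun z => (starRingEnd ℂ) (dList L α f z) := by
  have hit : ∀ (i : Fin n) (m : ℕ) {f : Pt n → ℂ}, IsTorusFun f →
      (pd i.succ)^[m] (fun z => (starRingEnd ℂ) (f z)) =
        fun z => (starRingEnd ℂ) ((pd i.succ)^[m] f z) := by
    intro i m
    induction m with
    | zero => intro f _; rfl
    | succ m ih =>
      intro f hf
      rw [Function.iterate_succ_apply, Function.iterate_succ_apply, pd_conj hf, ih (hf.pd _)]
  induction L with
  | nil => rfl
  | cons i L ih =>
    change (pd i.succ)^[α i] (dList L α _) = fun z => (starRingEnd ℂ) ((pd i.succ)^[α i] (dList L α f) z)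
    rw [ih, hit i (α i) ((isConstOp_dList L α).op.torusFun hf)]

theorem IsTorusFun.eq_zero_of_box {f : Pt n → ℂ} (hf : IsTorusFun f) (h : ∀ z ∈ box n, f z = 0) :
    f = 0 := by
  ext z
  have hpi : 0 < 2 * Real.pi := by positivity
  let m : Fin (n + 1) → ℤ := fun i => -⌊z i / (2 * Real.pi)⌋
  rw [← hf.periodic_lattice m z]
  refine h _ ⟨fun i => ?_, fun i => ?_⟩
  · have := Int.floor_le (z i / (2 * Real.pi))
    rw [le_div_iff₀ hpi] at this
    simp only [m, Pi.zero_apply, Pi.add_apply]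
    push_cast
    linarith
  · have := (Int.lt_floor_add_one (z i / (2 * Real.pi))).le
    rw [div_le_iff₀ hpi] at this
    simp only [m, Pi.add_apply]
    push_cast
    linarith

/-- A nonnegative integrand with zero integral vanishes almost everywhere; continuity upgrades this
to every point because the box is contained in the closure of its interior. -/
theorem eq_zero_of_integral_eq_zero {F : Pt n → ℝ} (hF : Continuous F) (h0 : ∀ z, 0 ≤ F z)
    (h : ∫ z in box n, F z = 0) : ∀ z ∈ box n, F z = 0 := by
  have h1 : F =ᵐ[volume.restrict (box n)] 0 :=
    (setIntegral_eq_zero_iff_of_nonneg_ae (ae_of_all _ h0)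
      (hF.continuousOn.integrableOn_compact isCompact_box)).1 h
  refine Measure.eqOn_of_ae_eq h1 hF.continuousOn continuousOn_const ?_
  have hpi : (0 : ℝ) ≠ 2 * Real.pi := by positivity
  rw [box, ← pi_univ_Icc, interior_pi_set finite_univ, closure_pi_set]
  simp only [interior_Icc, Pi.zero_apply, closure_Ioo hpi]
  exact Subset.rfl

/-- Test against b = ρ⁻¹ times the complex conjugate of m, with ρ the weight. The factor ρ⁻¹ depends
on λ only, so it commutes with the torus derivatives and cancels ρ, and the integrand becomes ∑ |∂^α
mⱼ|². -/
theorem eq_zero_of_pairing_left {p : ℤ} {q : ℕ} {m : Coeffs n} (hm : IsLoop m)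
    (h : ∀ b, IsLoop b → pairing p q m b = 0) : m = 0 := by
  let b : Coeffs n := fun z j => weightInv p z * (starRingEnd ℂ) (m z j)
  have hcb : ∀ j, coef b j = weightInv p * fun z => (starRingEnd ℂ) (coef m j z) := fun j => rfl
  have hb : IsLoop b := isLoop_iff.2 fun j => by
    rw [hcb]
    exact (isTorusFun_weightInv p).mul (hm.coef j).conj
  have hp := h b hb
  rw [pairing_eq] at hp
  have hC : (2 * Real.pi * Complex.I)⁻¹ ≠ 0 := by
    simp [Real.pi_ne_zero, Complex.I_ne_zero]
  have hp := (mul_eq_zero.1 hp).resolve_left hC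
  let F : Pt n → ℝ := fun z => ∑ j, ∑ α ∈ multiIndices n q, ‖dMulti α (coef m j) z‖ ^ 2
  have hF : ∀ z, (weight p * ∑ j, ∑ α ∈ multiIndices n q, dMulti α (coef m j) *
      dMulti α (coef b j) : Pt n → ℂ) z = (F z : ℂ) := fun z => by
    have hw := congrFun (weight_mul_weightInv (n := n) p) z
    simp only [Pi.mul_apply, Pi.one_apply] at hw
    simp only [F, hcb, dMulti_eq, Pi.mul_apply, Finset.sum_apply, Finset.mul_sum]
    push_cast
    refine Finset.sum_congr rfl fun j _ => Finset.sum_congr rfl fun α _ => ?_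
    rw [dList_mul_of_pd_eq_zero (isTorusFun_weightInv p) (pd_succ_weightInv p) _ α (hm.coef j).conj,
      dList_conj _ α (hm.coef j)]
    simp only [Pi.mul_apply]
    rw [← Complex.mul_conj']
    linear_combination (dList (List.finRange n) α (coef m j) z *
      (starRingEnd ℂ) (dList (List.finRange n) α (coef m j) z)) * hw
  simp only [hF] at hp
  rw [integral_complex_ofReal] at hp
  have hp : ∫ z in box n, F z = 0 := by exact_mod_cast hp
  have hFc : Continuous F := continuous_finsetSum _ fun j _ => continuous_finsetSum _ fun α _ =>
    (((opMulti α).torusFun (hm.coef j)).continuous.norm).pow 2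
  have hF0 : ∀ z, 0 ≤ F z := fun z => Finset.sum_nonneg fun j _ => Finset.sum_nonneg fun α _ => by
    positivity
  have hz := eq_zero_of_integral_eq_zero hFc hF0 hp
  refine coeffs_ext fun j => (hm.coef j).eq_zero_of_box fun z hzb => ?_
  have h1 := hz z hzb
  have h2 := (Finset.sum_eq_zero_iff_of_nonneg fun j _ => Finset.sum_nonneg fun α _ => by
    positivity).1 h1 j (Finset.mem_univ j)
  -- Among the vanishing terms the one with α = 0 is |mⱼ|² itself.
  have h0 : (0 : Fin n → ℕ) ∈ multiIndices n q := by simp [multiIndices]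
  have h3 := (Finset.sum_eq_zero_iff_of_nonneg fun α _ => by positivity).1 h2 0 h0
  have h4 : ∀ L : List (Fin n), dList L 0 (coef m j) = coef m j := fun L => by
    induction L with
    | nil => rfl
    | cons i L ih => exact ih
  rw [dMulti_eq, h4] at h3
  simpa using h3

theorem eq_of_pairing_left {p : ℤ} {q : ℕ} {m m' : Coeffs n} (hm : IsLoop m) (hm' : IsLoop m')
    (h : ∀ b, IsLoop b → pairing p q m b = pairing p q m' b) : m = m' :=
  sub_eq_zero.1 <| eq_zero_of_pairing_left (p := p) (q := q) (hm.sub hm') fun b hb => by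
    rw [pairing_sub_left hb hm hm', h b hb, sub_self]

theorem eq_of_pairing_right {p : ℤ} {q : ℕ} {m m' : Coeffs n} (hm : IsLoop m) (hm' : IsLoop m')
    (h : ∀ b, IsLoop b → pairing p q b m = pairing p q b m') : m = m' :=
  eq_of_pairing_left (p := p) (q := q) hm hm' fun b hb => by
    rw [pairing_comm, h b hb, pairing_comm]

/-! ### Derivatives of the pairing along families -/

theorem IsTorusFamily.hasFDerivAt_integral {E : Type} [NormedAddCommGroup E] [NormedSpace ℝ E]
    [LocallyCompactSpace E] {W : Set E} {f : E → Pt n → ℂ} (hf : IsTorusFamily W f) {s : E}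
    (hs : s ∈ W) (v : E) :
    DifferentiableAt ℝ (fun s => ∫ z in box n, f s z) s ∧
      fderiv ℝ (fun s => ∫ z in box n, f s z) s v = ∫ z in box n, HolLoop.parD v f s z := by
  have h1 := contDiffOn_integral_kernel (μ := volume) hf.isOpen (isCompact_box (n := n))
    (κ := fun _ => 1) continuous_const hf.contDiffOn
  have h2 := fderiv_integral_kernel (μ := volume) hf.isOpen (isCompact_box (n := n))
    (κ := fun _ => 1) continuous_const hf.contDiffOn hs v
  simp only [one_mul] at h1 h2
  refine ⟨differentiableAt_of_contDiffOn hf.isOpen h1 hs, h2.trans ?_⟩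
  simp only [hf.parD_eq hs]

theorem hasFDerivAt_pairing {p : ℤ} {q k : ℕ} {W : Set (Fin k → ℝ)}
    {l a : (Fin k → ℝ) → Coeffs n} (hl : IsPlot W l) (ha : IsPlot W a) {s : Fin k → ℝ}
    (hs : s ∈ W) (i : Fin k) :
    fderiv ℝ (fun s => pairing p q (l s) (a s)) s (Pi.single i 1) =
      pairing p q (dpar i l s) (a s) + pairing p q (l s) (dpar i a s) := by
  obtain ⟨Λ, M, hΛ, -, -, h⟩ := exists_laplacian n p q
  have hW := hl.1
  have hw := (isTorusFun_weight (n := n) p).family hW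
  have hF1 : ∀ j, IsTorusFamily W (fun s => Λ (coef (l s) j) * coef (a s) j) := fun j =>
    (hΛ.family (hl.coef j)).mul (ha.coef j)
  have hF2 : IsTorusFamily W (fun s => ∑ j, Λ (coef (l s) j) * coef (a s) j) :=
    IsTorusFamily.sum _ hW fun j _ => hF1 j
  have hF := hw.mul hF2
  have he : (fun s => pairing p q (l s) (a s)) =ᶠ[𝓝 s] fun s => (2 * Real.pi * Complex.I)⁻¹ *
      ∫ z in box n, (weight p * ∑ j, Λ (coef (l s) j) * coef (a s) j : Pt n → ℂ) z := by
    filter_upwards [hW.mem_nhds hs] with s hs using h _ _ (hl.2.1 s hs) (ha.2.1 s hs)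
  have hl' := hl.dpar i
  have ha' := ha.dpar i
  obtain ⟨hd, hd'⟩ := hF.hasFDerivAt_integral hs (Pi.single i 1)
  rw [he.fderiv_eq, fderiv_const_mul hd, smul_apply, hd',
    h _ _ (hl'.2.1 s hs) (ha.2.1 s hs), h _ _ (hl.2.1 s hs) (ha'.2.1 s hs), ← mul_add, smul_eq_mul]
  have hi : ∀ {l a : Coeffs n}, IsLoop l → IsLoop a →
      IntegrableOn (weight p * ∑ j, Λ (coef l j) * coef a j : Pt n → ℂ) (box n) := fun hl ha =>
    ((isTorusFun_weight p).mul (IsTorusFun.sum _ fun j _ =>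
      (hΛ.torusFun (hl.coef j)).mul (ha.coef j))).integrableOn_box
  rw [← integral_add (hi (hl'.2.1 s hs) (ha.2.1 s hs)) (hi (hl.2.1 s hs) (ha'.2.1 s hs))]
  have hpar : HolLoop.parD (Pi.single i 1) (fun s => weight p *
      ∑ j, Λ (coef (l s) j) * coef (a s) j) s =
      weight p * ∑ j, Λ (coef (dpar i l s) j) * coef (a s) j +
        weight p * ∑ j, Λ (coef (l s) j) * coef (dpar i a s) j := by
    rw [hw.parD_mul hF2 hs, parD_const, zero_mul, zero_add,
      IsTorusFamily.parD_sum _ (fun j _ => hF1 j) hs, ← mul_add, ← Finset.sum_add_distrib]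
    congr 1
    refine Finset.sum_congr rfl fun j _ => ?_
    rw [(hΛ.family (hl.coef j)).parD_mul (ha.coef j) hs, hΛ.parD (hl.coef j) s hs]
    rfl
  rw [hpar]
  rfl

theorem dpar_const {k : ℕ} (i : Fin k) (a : Coeffs n) (s : Fin k → ℝ) :
    dpar i (fun _ => a) s = 0 := by
  ext z j
  simp [dpar]

theorem isLoop_dpar {k : ℕ} {W : Set (Fin k → ℝ)} {c : (Fin k → ℝ) → Coeffs n}
    (hc : IsPlot W c) {s : Fin k → ℝ} (hs : s ∈ W) (i : Fin k) : IsLoop (dpar i c s) :=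
  (hc.dpar i).2.1 s hs

/-! ### The coadjoint action -/

/-- Unlike the torus derivatives, ∂/∂λ differentiates the weight ρ and has a nonconstant coefficient
c. The transpose is therefore g ↦ -ρ⁻¹ ∂ᵢ(ρ c g). -/
theorem isTranspose_dd (p : ℤ) (i : Fin (n + 1)) :
    ∃ D', IsTorusOp D' ∧ IsTranspose (weight (n := n) p) (dd i) D' := by
  have hw := isTorusFun_weight (n := n) p
  have hc := hw.mul (isTorusFun_ddCoeff i)
  refine ⟨fun g => (-1 : ℂ) • (weightInv p * pd i (weight p * ddCoeff i * g)),
    (((IsTorusOp.opPd i).comp (IsTorusOp.id.mulLeft hc)).mulLeft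
      (isTorusFun_weightInv p)).opSMul (-1), fun u v hu hv => ?_⟩
  have h := integral_mul_pd (hc.mul hu) hv i
  have h1 : weight p * u * dd i v = weight p * ddCoeff i * u * pd i v := by
    rw [dd_eq]; ring
  have h2 : weight p * ((-1 : ℂ) • (weightInv p * pd i (weight p * ddCoeff i * u))) * v =
      -(pd i (weight p * ddCoeff i * u) * v) := by
    rw [neg_one_smul, mul_neg, neg_mul, ← mul_assoc, weight_mul_weightInv, one_mul]
  rw [h1, h2]
  simp only [Pi.neg_apply]
  rw [integral_neg]
  exact h

theorem isCoadjoint_unique {p : ℤ} {q : ℕ} {a l m m' : Coeffs n} (h : IsCoadjoint p q a l m)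
    (h' : IsCoadjoint p q a l m') : m = m' :=
  eq_of_pairing_left h.1 h'.1 fun b hb => by rw [h.2 b hb, h'.2 b hb]

theorem coad_eq {p : ℤ} {q : ℕ} {a l m : Coeffs n} (h : IsCoadjoint p q a l m) :
    coad p q a l = m := by
  have hex : ∃ m, IsCoadjoint p q a l m := ⟨m, h⟩
  rw [coad, dif_pos hex]
  exact isCoadjoint_unique hex.choose_spec h

/-- The coadjoint action exists and depends smoothly on parameters. -/
theorem exists_coadjoint (n : ℕ) (p : ℤ) (q : ℕ) :
    ∃ A : Coeffs n → Coeffs n → Coeffs n,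
      (∀ {k : ℕ} {W : Set (Fin k → ℝ)} {a l : (Fin k → ℝ) → Coeffs n}, IsPlot W a → IsPlot W l →
        IsPlot W fun s => A (a s) (l s)) ∧
      ∀ a l, IsLoop a → IsLoop l → IsCoadjoint p q a l (A a l) := by
  obtain ⟨Λ, M, hΛ, hM, hΛM, h⟩ := exists_laplacian n p q
  choose T hT htr using isTranspose_dd (n := n) p
  -- Expanding -(l, [a, b]) and integrating by parts until b is undifferentiated gives ∫ ρ ∑ Vⱼ bⱼ.
  -- Matching with ∫ ρ ∑ Λ(mⱼ) bⱼ forces Λ mⱼ = Vⱼ, solved by mⱼ = M Vⱼ.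
  let V : Coeffs n → Coeffs n → Fin (n + 1) → Pt n → ℂ := fun a l j =>
    ∑ i, (Λ (coef l i) * dd j (coef a i) - T i (coef a i * Λ (coef l j)))
  have hV : ∀ {k : ℕ} {W : Set (Fin k → ℝ)} {a l : (Fin k → ℝ) → Coeffs n}, IsPlot W a →
      IsPlot W l → ∀ j, IsTorusFamily W fun s => V (a s) (l s) j := fun ha hl j =>
    IsTorusFamily.sum _ ha.1 fun i _ =>
      ((hΛ.family (hl.coef i)).mul ((IsTorusOp.opDd j).family (ha.coef i))).sub
        ((hT i).family ((ha.coef i).mul (hΛ.family (hl.coef j))))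
  have hA : ∀ {k : ℕ} {W : Set (Fin k → ℝ)} {a l : (Fin k → ℝ) → Coeffs n}, IsPlot W a →
      IsPlot W l → IsPlot W fun s => (fun z j => M (V (a s) (l s) j) z : Coeffs n) :=
    fun ha hl => isPlot_iff.2 fun j => hM.family (hV ha hl j)
  refine ⟨fun a l z j => M (V a l j) z, hA, fun a l ha hl => ?_⟩
  have hpa := isPlot_const (k := 0) isOpen_univ ha
  have hpl := isPlot_const (k := 0) isOpen_univ hl
  have hVl : ∀ j, IsTorusFun (V a l j) := fun j => (hV hpa hpl j).torusFun (mem_univ 0)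
  have hm : IsLoop (fun z j => M (V a l j) z : Coeffs n) := (hA hpa hpl).2.1 0 (mem_univ 0)
  refine ⟨hm, fun b hb => ?_⟩
  have hw := isTorusFun_weight (n := n) p
  rw [h _ _ hm hb, h _ _ hl (ha.bracket hb), ← mul_neg, ← integral_neg]
  congr 1
  have e1 : (weight p * ∑ j, Λ (coef (fun z j => M (V a l j) z : Coeffs n) j) * coef b j
      : Pt n → ℂ) = ∑ j, ∑ i, (weight p * Λ (coef l i) * dd j (coef a i) * coef b j -
        weight p * T i (coef a i * Λ (coef l j)) * coef b j) := by
    rw [Finset.mul_sum]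
    refine Finset.sum_congr rfl fun j _ => ?_
    have : Λ (coef (fun z j => M (V a l j) z : Coeffs n) j) = V a l j := hΛM _ (hVl j)
    rw [this, Finset.sum_mul, Finset.mul_sum]
    refine Finset.sum_congr rfl fun i _ => ?_
    ring
  have e2 : (fun z => -(weight p * ∑ j, Λ (coef l j) * coef (bracket a b) j : Pt n → ℂ) z) =
      ∑ j, ∑ i, (weight p * Λ (coef l i) * dd j (coef a i) * coef b j -
        weight p * (coef a i * Λ (coef l j)) * dd i (coef b j)) := by
    have : (fun z => -(weight p * ∑ j, Λ (coef l j) * coef (bracket a b) j : Pt n → ℂ) z) =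
        -(weight p * ∑ j, Λ (coef l j) * coef (bracket a b) j) := rfl
    rw [this]
    simp only [Finset.sum_sub_distrib]
    rw [Finset.sum_comm (f := fun j i => weight p * Λ (coef l i) * dd j (coef a i) * coef b j),
      ← Finset.sum_sub_distrib, Finset.mul_sum, ← Finset.sum_neg_distrib]
    refine Finset.sum_congr rfl fun j _ => ?_
    rw [coef_bracket, lieD, lieD, ← Finset.sum_sub_distrib, ← Finset.sum_sub_distrib,
      Finset.mul_sum, Finset.mul_sum, ← Finset.sum_neg_distrib]
    refine Finset.sum_congr rfl fun i _ => ?_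
    ring
  have e2' := congrFun e2
  simp only [e1, e2']
  have hint1 : ∀ i j, IsTorusFun (weight p * Λ (coef l i) * dd j (coef a i) * coef b j) :=
    fun i j => ((hw.mul (hΛ.torusFun (hl.coef i))).mul ((ha.coef i).dd j)).mul (hb.coef j)
  have hint0 : ∀ i j, IsTorusFun (coef a i * Λ (coef l j)) :=
    fun i j => (ha.coef i).mul (hΛ.torusFun (hl.coef j))
  have hint2 : ∀ i j, IsTorusFun (weight p * T i (coef a i * Λ (coef l j)) * coef b j) :=
    fun i j => (hw.mul ((hT i).torusFun (hint0 i j))).mul (hb.coef j)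
  have hint3 : ∀ i j, IsTorusFun (weight p * (coef a i * Λ (coef l j)) * dd i (coef b j)) :=
    fun i j => (hw.mul (hint0 i j)).mul ((hb.coef j).dd i)
  simp only [Finset.sum_apply]
  rw [integral_finsetSum, integral_finsetSum]
  · refine Finset.sum_congr rfl fun j _ => ?_
    rw [integral_finsetSum, integral_finsetSum]
    · refine Finset.sum_congr rfl fun i _ => ?_
      simp only [Pi.sub_apply]
      rw [integral_sub (hint1 i j).integrableOn_box (hint2 i j).integrableOn_box,
        integral_sub (hint1 i j).integrableOn_box (hint3 i j).integrableOn_box,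
        htr i _ _ (hint0 i j) (hb.coef j)]
    · exact fun i _ => ((hint1 i j).sub (hint3 i j)).integrableOn_box
    · exact fun i _ => ((hint1 i j).sub (hint2 i j)).integrableOn_box
  · exact fun j _ => integrable_finsetSum _ fun i _ =>
      ((hint1 i j).sub (hint3 i j)).integrableOn_box
  · exact fun j _ => integrable_finsetSum _ fun i _ =>
      ((hint1 i j).sub (hint2 i j)).integrableOn_box

theorem isCoadjoint_coad {p : ℤ} {q : ℕ} {a l : Coeffs n} (ha : IsLoop a) (hl : IsLoop l) :
    IsCoadjoint p q a l (coad p q a l) := by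
  obtain ⟨A, -, h⟩ := exists_coadjoint n p q
  rw [coad_eq (h a l ha hl)]
  exact h a l ha hl

theorem IsPlot.coad {p : ℤ} {q k : ℕ} {W : Set (Fin k → ℝ)} {a l : (Fin k → ℝ) → Coeffs n}
    (ha : IsPlot W a) (hl : IsPlot W l) : IsPlot W fun s => coad p q (a s) (l s) := by
  obtain ⟨A, hA, h⟩ := exists_coadjoint n p q
  refine isPlot_iff.2 fun j => ((hA ha hl).coef j).congr fun s hs => ?_
  rw [coad_eq (h _ _ (ha.2.1 s hs) (hl.2.1 s hs))]

theorem pairing_coad {p : ℤ} {q : ℕ} {a l b : Coeffs n} (ha : IsLoop a) (hl : IsLoop l)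
    (hb : IsLoop b) : pairing p q (coad p q a l) b = -pairing p q l (bracket a b) :=
  (isCoadjoint_coad ha hl).2 b hb

/-! ### Fourier series in the spectral parameter -/

/-- Rotation of the spectral parameter. -/
def rot (n : ℕ) : ℝ →L[ℝ] Pt n := ContinuousLinearMap.toSpanSingleton ℝ (Pi.single 0 1)

theorem rot_apply (θ : ℝ) : rot n θ = Pi.single 0 θ := by
  ext i
  by_cases h : i = 0
  · subst h; simp [rot]
  · simp [rot, h]

theorem rot_succ (θ : ℝ) (i : Fin n) : rot n θ i.succ = 0 := by simp [rot_apply]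

theorem rot_zero (θ : ℝ) : rot n θ 0 = θ := by simp [rot_apply]

/-- The conjugate character `exp (-ikθ)`. -/
def circMode (k : ℤ) (θ : ℝ) : ℂ := Complex.exp (-(Complex.I * k * θ))

theorem continuous_circMode (k : ℤ) : Continuous (circMode k) := by
  unfold circMode
  fun_prop

theorem norm_circMode (k : ℤ) (θ : ℝ) : ‖circMode k θ‖ = 1 := by
  have : -(Complex.I * k * θ) = ((-(k * θ) : ℝ) : ℂ) * Complex.I := by push_cast; ring
  rw [circMode, this, Complex.norm_exp_ofReal_mul_I]

theorem circMode_add (k m : ℤ) (θ : ℝ) : circMode (k + m) θ = circMode k θ * circMode m θ := by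
  rw [circMode, circMode, circMode, ← Complex.exp_add]
  push_cast
  ring_nf

theorem circMode_periodic (k : ℤ) : Function.Periodic (circMode k) (2 * Real.pi) := fun θ => by
  rw [circMode, circMode, Complex.exp_eq_exp_iff_exists_int]
  exact ⟨-k, by push_cast; ring⟩

theorem IsTorusFun.rot_periodic {f : Pt n → ℂ} (hf : IsTorusFun f) (z : Pt n) :
    Function.Periodic (fun θ => f (z + rot n θ)) (2 * Real.pi) := fun θ => by
  change f (z + rot n (θ + 2 * Real.pi)) = f (z + rot n θ)
  rw [map_add, ← add_assoc, rot_apply (2 * Real.pi), hf.periodic]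

/-- The component of degree `k` in the spectral parameter. -/
def circOp (k : ℤ) (f : Pt n → ℂ) : Pt n → ℂ :=
  (2 * Real.pi : ℂ)⁻¹ • convOp volume (rot n) (Icc 0 (2 * Real.pi)) (circMode k) f

theorem opCirc (k : ℤ) : IsTorusOp (circOp (n := n) k) :=
  (IsTorusOp.opConv _ isCompact_Icc (continuous_circMode k)).opSMul _

theorem circOp_eq (k : ℤ) (f : Pt n → ℂ) (z : Pt n) : circOp k f z =
    (2 * Real.pi : ℂ)⁻¹ * ∫ θ in (0 : ℝ)..(2 * Real.pi), circMode k θ * f (z + rot n θ) := by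
  rw [intervalIntegral.integral_of_le (by positivity), ← integral_Icc_eq_integral_Ioc]
  rfl

theorem pd_circOp {f : Pt n → ℂ} (hf : IsTorusFun f) (k : ℤ) (i : Fin (n + 1)) :
    pd i (circOp k f) = circOp k (pd i f) := by
  have h := IsTorusOp.opConv (μ := volume) (rot n) (isCompact_Icc (a := (0 : ℝ))
    (b := 2 * Real.pi)) (continuous_circMode k)
  rw [circOp, pd_smul (h.torusFun hf), pd_convOp hf isCompact_Icc (continuous_circMode k)]
  rfl

/-- The component of degree k is aₖ(x) λ^k, with the power of λ included. Rotating by t multiplies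
it by exp(ikt), and on the slice θ = 0 it is the Laurent coefficient aₖ(x). The proof shifts an
integral over a full period. -/
theorem circOp_rot {f : Pt n → ℂ} (hf : IsTorusFun f) (k : ℤ) (z : Pt n) (t : ℝ) :
    circOp k f (z + rot n t) = circMode (-k) t * circOp k f z := by
  rw [circOp_eq, circOp_eq, mul_left_comm]
  congr 1
  have hper : Function.Periodic (fun θ => circMode k θ * f (z + rot n θ)) (2 * Real.pi) :=
    fun θ => by
      exact congrArg₂ (· * ·) (circMode_periodic k θ) (hf.rot_periodic z θ)
  have h := hper.intervalIntegral_add_eq 0 t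
  rw [zero_add] at h
  rw [h, ← intervalIntegral.integral_const_mul]
  have h3 := intervalIntegral.integral_comp_add_right
    (fun θ => circMode (-k) t * (circMode k θ * f (z + rot n θ))) t (a := 0) (b := 2 * Real.pi)
  rw [zero_add, add_comm (2 * Real.pi) t] at h3
  rw [← h3]
  refine intervalIntegral.integral_congr fun θ _ => ?_
  have h4 : circMode (-k) t * circMode k (θ + t) = circMode k θ := by
    rw [circMode, circMode, circMode, ← Complex.exp_add]
    push_cast
    ring_nf
  rw [← mul_assoc, h4, map_add, add_assoc, add_comm (rot n t)]

theorem circOp_pd_zero {f : Pt n → ℂ} (hf : IsTorusFun f) (k : ℤ) :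
    circOp k (pd 0 f) = (Complex.I * k) • circOp k f := by
  rw [← pd_circOp hf]
  ext z
  have hd : DifferentiableAt ℝ (circOp k f) z := ((opCirc k).torusFun hf).differentiable z
  rw [pd, ← hd.lineDeriv_eq_fderiv, lineDeriv]
  have h : ∀ t : ℝ, circOp k f (z + t • Pi.single 0 1) =
      Complex.exp (Complex.I * k * t) * circOp k f z := fun t => by
    have h1 : t • (Pi.single 0 1 : Pt n) = rot n t := rfl
    rw [h1, circOp_rot hf, circMode]
    push_cast
    ring_nf
  simp only [h]
  have h0 : HasDerivAt (fun t : ℝ => Complex.exp (Complex.I * k * t) * circOp k f z)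
      (Complex.exp (Complex.I * k * (0 : ℝ)) * (Complex.I * k * 1) * circOp k f z) 0 :=
    (((hasDerivAt_id (0 : ℝ)).ofReal_comp.const_mul (Complex.I * k)).cexp).mul_const _
  rw [h0.deriv]
  simp

theorem norm_circOp_le (f : Pt n → ℂ) (z : Pt n) : ∃ C, ∀ k, ‖circOp k f z‖ ≤ C := by
  refine ⟨‖(2 * Real.pi : ℂ)⁻¹‖ * ∫ θ in Icc 0 (2 * Real.pi), ‖f (z + rot n θ)‖, fun k => ?_⟩
  rw [circOp, Pi.smul_apply, norm_smul]
  refine mul_le_mul_of_nonneg_left ?_ (norm_nonneg _)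
  refine (norm_integral_le_integral_norm _).trans (le_of_eq ?_)
  simp [norm_circMode]

/-- The operator `1 - ∂²/∂θ²`. -/
def angOp (f : Pt n → ℂ) : Pt n → ℂ := f + (-1 : ℂ) • pd 0 (pd 0 f)

theorem opAng : IsTorusOp (angOp (n := n)) :=
  IsTorusOp.id.opAdd (((IsTorusOp.opPd 0).comp (IsTorusOp.opPd 0)).opSMul (-1))

theorem circOp_angOp {f : Pt n → ℂ} (hf : IsTorusFun f) (k : ℤ) :
    circOp k (angOp f) = (1 + (k : ℂ) ^ 2) • circOp k f := by
  rw [angOp, (opCirc k).add hf (((hf.pd 0).pd 0).smul _), (opCirc k).smul _ ((hf.pd 0).pd 0),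
    circOp_pd_zero (hf.pd 0), circOp_pd_zero hf, smul_smul, smul_smul, add_smul, one_smul]
  congr 2
  linear_combination (-(k : ℂ) ^ 2) * Complex.I_sq

theorem one_add_sq_ne_zero (k : ℤ) : (1 + (k : ℂ) ^ 2) ≠ 0 := by
  have : (1 + (k : ℝ) ^ 2) ≠ 0 := by positivity
  exact_mod_cast this

theorem norm_one_add_sq (k : ℤ) : ‖(1 + (k : ℂ) ^ 2)‖ = 1 + (k : ℝ) ^ 2 := by
  have : (1 + (k : ℂ) ^ 2) = ((1 + (k : ℝ) ^ 2 : ℝ) : ℂ) := by push_cast; ring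
  rw [this, Complex.norm_real, Real.norm_of_nonneg (by positivity)]

/-- Applying 1 - ∂²/∂θ² multiplies the k-th component by 1 + k², and the components of the result
are bounded. -/
theorem summable_circOp {f : Pt n → ℂ} (hf : IsTorusFun f) (z : Pt n) :
    Summable fun k => circOp k f z := by
  obtain ⟨C, hC⟩ := norm_circOp_le (angOp f) z
  refine Summable.of_norm_bounded (summable_one_add_sq_inv.mul_right C) fun k => ?_
  have h := hC k
  rw [circOp_angOp hf, Pi.smul_apply, norm_smul, norm_one_add_sq] at h
  rw [inv_mul_eq_div, le_div_iff₀ (by positivity)]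
  linarith

theorem summable_circOp_nat {f : Pt n → ℂ} (hf : IsTorusFun f) (z : Pt n) :
    Summable fun k : ℕ => circOp (k : ℤ) f z :=
  (summable_circOp hf z).comp_injective Nat.cast_injective

theorem hasSum_circOp {f : Pt n → ℂ} (hf : IsTorusFun f) (z : Pt n) :
    HasSum (fun k => circOp k f z) (f z) := by
  have hpos : 0 < 2 * Real.pi := by positivity
  have : Fact (0 < 2 * Real.pi) := ⟨hpos⟩
  have hcont : Continuous fun θ => f (z + rot n θ) := continuous_translate hf (rot n) z
  let g : C(AddCircle (2 * Real.pi), ℂ) :=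
    ⟨(hf.rot_periodic z).lift, continuous_coinduced_dom.2 hcont⟩
  have hg : ∀ θ : ℝ, g (θ : AddCircle (2 * Real.pi)) = f (z + rot n θ) := fun θ => rfl
  have hc : ∀ k, fourierCoeff g k = circOp k f z := fun k => by
    rw [fourierCoeff_eq_intervalIntegral g k 0, zero_add, circOp_eq, Complex.real_smul]
    congr 1
    · push_cast; simp
    · refine intervalIntegral.integral_congr fun θ _ => ?_
      rw [hg, smul_eq_mul, fourier_coe_apply, circMode]
      congr 2
      have : (Real.pi : ℂ) ≠ 0 := by exact_mod_cast Real.pi_ne_zero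
      push_cast
      field_simp
  have hs : Summable (fourierCoeff g) := by
    rw [funext hc]
    exact summable_circOp hf z
  have h := has_pointwise_sum_fourier_series_of_summable hs ((0 : ℝ) : AddCircle (2 * Real.pi))
  rw [hg] at h
  simpa [hc] using h

/-- Multiplication by an absolutely convergent Fourier series. -/
theorem hasSum_circOp_mul {ι : Type*} [Countable ι] {c : ι → ℂ} (hc : Summable c) (r : ι → ℤ)
    {u v : Pt n → ℂ} (hu : IsTorusFun u) {z : Pt n}
    (h : ∀ θ, HasSum (fun m => c m * circMode (-r m) θ) (v (z + rot n θ))) (k : ℤ) :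
    HasSum (fun m => c m * circOp (k - r m) u z) (circOp k (u * v) z) := by
  have h1 := hasSum_convOp (μ := volume) (A := rot n) (K := Icc 0 (2 * Real.pi))
    (fun m => continuous_circMode (k - r m)) (fun m θ => (norm_circMode (k - r m) θ).le) hc
    isCompact_Icc hu z
  have h2 := h1.mul_left (2 * Real.pi : ℂ)⁻¹
  have hv : convOp volume (rot n) (Icc 0 (2 * Real.pi))
      (fun w => ∑' m, c m * circMode (k - r m) w) u z =
      convOp volume (rot n) (Icc 0 (2 * Real.pi)) (circMode k) (u * v) z := by
    simp only [convOp]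
    congr 1
    ext θ
    have h3 : ∑' m, c m * circMode (k - r m) θ = circMode k θ * v (z + rot n θ) := by
      rw [← ((h θ).mul_left (circMode k θ)).tsum_eq]
      refine tsum_congr fun m => ?_
      rw [sub_eq_add_neg, circMode_add]
      ring
    rw [h3, Pi.mul_apply]
    ring
  rw [hv] at h2
  refine h2.congr_fun fun m => ?_
  simp only [circOp, Pi.smul_apply, smul_eq_mul]
  ring

theorem circOp_one (k : ℤ) (z : Pt n) : circOp k (fun _ => 1) z = if k = 0 then 1 else 0 := by
  split_ifs with h
  · subst h
    rw [circOp_eq]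
    have : (Real.pi : ℂ) ≠ 0 := by exact_mod_cast Real.pi_ne_zero
    simp [circMode]
    field_simp
  · have h1 := congrFun (circOp_pd_zero (isTorusFun_const (n := n) 1) k) z
    have h2 : pd (0 : Fin (n + 1)) (fun _ : Pt n => (1 : ℂ)) = 0 := by
      ext; simp [pd]
    rw [h2, (opCirc k).zero] at h1
    have h3 : Complex.I * (k : ℂ) ≠ 0 := mul_ne_zero Complex.I_ne_zero (by exact_mod_cast h)
    exact (mul_eq_zero.1 h1.symm).resolve_left h3

/-- The projection onto nonnegative degrees in the spectral parameter. -/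
def plusOp (f : Pt n → ℂ) : Pt n → ℂ := fun z => ∑' k : ℕ, circOp (k : ℤ) f z

/-- The sum ∑ exp(-ikθ) over k ≥ 0 that would represent P₊ does not converge to a function. Letting
1 - ∂²/∂θ² act on f first divides its coefficients by 1 + k², which makes the kernel continuous. -/
theorem exists_plusOp_kernel : ∃ κ : ℝ → ℂ, Continuous κ ∧ ∀ f : Pt n → ℂ, IsTorusFun f →
    plusOp f = convOp volume (rot n) (Icc 0 (2 * Real.pi)) κ (angOp f) := by
  let c : ℕ → ℂ := fun k => (2 * Real.pi : ℂ)⁻¹ * (1 + ((k : ℤ) : ℂ) ^ 2)⁻¹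
  have hc : Summable c := by
    refine Summable.mul_left _ (Summable.of_norm_bounded
      (summable_one_add_sq_inv.comp_injective Nat.cast_injective) fun k => ?_)
    rw [norm_inv, norm_one_add_sq]
    rfl
  refine ⟨_, continuous_tsum_kernel (fun k : ℕ => continuous_circMode (k : ℤ))
    (fun k θ => (norm_circMode _ θ).le) hc, fun f hf => ?_⟩
  ext z
  have h := hasSum_convOp (μ := volume) (A := rot n) (K := Icc 0 (2 * Real.pi))
    (fun k : ℕ => continuous_circMode (k : ℤ)) (fun k θ => (norm_circMode _ θ).le) hc
    isCompact_Icc (opAng.torusFun hf) z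
  rw [← h.tsum_eq]
  refine tsum_congr fun k => ?_
  have h1 := congrFun (circOp_angOp hf (k : ℤ)) z
  rw [circOp, Pi.smul_apply, Pi.smul_apply, smul_eq_mul, smul_eq_mul] at h1
  simp only [c]
  rw [mul_right_comm, h1, mul_right_comm, mul_inv_cancel₀ (one_add_sq_ne_zero _), one_mul]

/-- Agreement on smooth functions suffices: values on other functions, such as those of divergent
series or integrals, play no role. -/
theorem IsTorusOp.of_eq {D D' : (Pt n → ℂ) → Pt n → ℂ} (hD : IsTorusOp D)
    (h : ∀ f, IsTorusFun f → D' f = D f) : IsTorusOp D' where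
  family hf := (hD.family hf).congr fun s hs => h _ (hf.torusFun hs)
  parD hf s hs v := by
    rw [h _ ((hf.parD v).torusFun hs), ← hD.parD hf s hs]
    exact IsTorusFamily.parD_congr (fun s hs => h _ (hf.torusFun hs)) hf.isOpen hs v
  add hf hg := by rw [h _ (hf.add hg), h _ hf, h _ hg, hD.add hf hg]
  smul c f hf := by rw [h _ (hf.smul c), h _ hf, hD.smul c hf]

theorem opPlus : IsTorusOp (plusOp (n := n)) := by
  obtain ⟨κ, hκ, h⟩ := exists_plusOp_kernel (n := n)
  exact ((IsTorusOp.opConv _ isCompact_Icc hκ).comp opAng).of_eq h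

theorem hasSum_plusOp_rot {f : Pt n → ℂ} (hf : IsTorusFun f) (z : Pt n) (θ : ℝ) :
    HasSum (fun m : ℕ => circOp (m : ℤ) f z * circMode (-(m : ℤ)) θ) (plusOp f (z + rot n θ)) := by
  refine (summable_circOp_nat hf (z + rot n θ)).hasSum.congr_fun fun m => ?_
  rw [circOp_rot hf, mul_comm]

/-- This is the product formula with first factor 1, whose only nonzero component has degree 0; it
justifies taking components termwise. -/
theorem hasSum_circOp_plusOp {f : Pt n → ℂ} (hf : IsTorusFun f) (k : ℤ) (z : Pt n) :
    HasSum (fun m : ℕ => circOp (m : ℤ) f z * if k - m = 0 then 1 else 0)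
      (circOp k (plusOp f) z) := by
  have h := hasSum_circOp_mul (summable_circOp_nat hf z) (fun m : ℕ => (m : ℤ))
    (isTorusFun_const (n := n) 1) (hasSum_plusOp_rot hf z) k
  have h1 : (fun _ : Pt n => (1 : ℂ)) * plusOp f = plusOp f := by ext; simp
  rw [h1] at h
  simpa only [circOp_one] using h

theorem circOp_plusOp_of_neg {f : Pt n → ℂ} (hf : IsTorusFun f) {k : ℤ} (hk : k < 0) :
    circOp k (plusOp f) = 0 := by
  ext z
  refine (hasSum_circOp_plusOp hf k z).unique (hasSum_zero.congr_fun fun m => ?_)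
  rw [if_neg (by omega), mul_zero]

theorem circOp_plusOp_of_nonneg {f : Pt n → ℂ} (hf : IsTorusFun f) {k : ℤ} (hk : 0 ≤ k) :
    circOp k (plusOp f) = circOp k f := by
  ext z
  obtain ⟨m, rfl⟩ := Int.eq_ofNat_of_zero_le hk
  refine (hasSum_circOp_plusOp hf _ z).unique ?_
  have h := hasSum_single (f := fun m' : ℕ => circOp (m' : ℤ) f z *
    if (m : ℤ) - m' = 0 then 1 else 0) m fun m' hm' => by
      rw [if_neg (by omega), mul_zero]
  simpa using h

/-- Functions that extend holomorphically inside the circle. -/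
def IsPlus (f : Pt n → ℂ) : Prop := ∀ k < 0, circOp k f = 0

/-- Functions that extend holomorphically outside the circle and vanish at infinity. -/
def IsMinus (f : Pt n → ℂ) : Prop := ∀ k ≥ 0, circOp k f = 0

theorem isPlus_plusOp {f : Pt n → ℂ} (hf : IsTorusFun f) : IsPlus (plusOp f) :=
  fun _ hk => circOp_plusOp_of_neg hf hk

theorem isMinus_sub_plusOp {f : Pt n → ℂ} (hf : IsTorusFun f) : IsMinus (f - plusOp f) :=
  fun k hk => by
    rw [(opCirc k).sub hf (opPlus.torusFun hf), circOp_plusOp_of_nonneg hf hk, sub_self]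

theorem IsPlus.plusOp_eq {f : Pt n → ℂ} (hf : IsTorusFun f) (h : IsPlus f) : plusOp f = f := by
  ext z
  have h1 : HasSum ((fun k : ℤ => circOp k f z) ∘ ((↑) : ℕ → ℤ)) (f z) := by
    refine (Function.Injective.hasSum_iff Nat.cast_injective fun k hk => ?_).2 (hasSum_circOp hf z)
    have : k < 0 := by
      by_contra hk'
      obtain ⟨m, rfl⟩ := Int.eq_ofNat_of_zero_le (not_lt.1 hk')
      exact hk ⟨m, rfl⟩
    rw [h k this]
    rfl
  exact h1.tsum_eq

theorem IsMinus.plusOp_eq {f : Pt n → ℂ} (h : IsMinus f) : plusOp f = 0 := by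
  ext z
  have : ∀ k : ℕ, circOp (k : ℤ) f z = 0 := fun k => by rw [h k (by positivity)]; rfl
  simp [plusOp, this]

theorem hasSum_circOp_mul_circOp {u v : Pt n → ℂ} (hu : IsTorusFun u) (hv : IsTorusFun v) (k : ℤ)
    (z : Pt n) : HasSum (fun m => circOp m v z * circOp (k - m) u z) (circOp k (u * v) z) :=
  hasSum_circOp_mul (summable_circOp hv z) (fun m => m) hu
    (fun θ => (hasSum_circOp hv (z + rot n θ)).congr_fun fun m => by
      rw [circOp_rot hv, mul_comm]) k

theorem IsPlus.mul {u v : Pt n → ℂ} (hu : IsTorusFun u) (hv : IsTorusFun v) (hu' : IsPlus u)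
    (hv' : IsPlus v) : IsPlus (u * v) := fun k hk => by
  ext z
  refine (hasSum_circOp_mul_circOp hu hv k z).unique (hasSum_zero.congr_fun fun m => ?_)
  by_cases hm : m < 0
  · simp [hv' m hm]
  · simp [hu' (k - m) (by omega)]

theorem IsMinus.mul {u v : Pt n → ℂ} (hu : IsTorusFun u) (hv : IsTorusFun v) (hu' : IsMinus u)
    (hv' : IsMinus v) : IsMinus (u * v) := fun k hk => by
  ext z
  refine (hasSum_circOp_mul_circOp hu hv k z).unique (hasSum_zero.congr_fun fun m => ?_)
  by_cases hm : 0 ≤ m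
  · simp [hv' m hm]
  · simp [hu' (k - m) (by omega)]

theorem circOp_lam_inv_mul {f : Pt n → ℂ} (k : ℤ) (z : Pt n) :
    circOp k ((fun z : Pt n => lam z ^ (-1 : ℤ)) * f) z = lam z ^ (-1 : ℤ) * circOp (k + 1) f z := by
  rw [circOp_eq, circOp_eq, mul_left_comm,
    ← intervalIntegral.integral_const_mul (lam z ^ (-1 : ℤ))]
  congr 1
  refine intervalIntegral.integral_congr fun θ _ => ?_
  have h : circMode k θ * lam (z + rot n θ) ^ (-1 : ℤ) = lam z ^ (-1 : ℤ) * circMode (k + 1) θ := by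
    rw [circMode_add, mul_left_comm]
    congr 1
    rw [lam_zpow, lam_zpow, circMode, ← Complex.exp_add, Pi.add_apply, rot_zero]
    push_cast
    ring_nf
  simp only [Pi.mul_apply]
  rw [← mul_assoc, h, mul_assoc]

/-- ∂/∂λ sends a_{k+1} λ^{k+1} to (k + 1) a_{k+1} λ^k. The factor λ⁻¹ appears because a component
includes its power of λ. -/
theorem circOp_dd_zero {f : Pt n → ℂ} (hf : IsTorusFun f) (k : ℤ) (z : Pt n) :
    circOp k (dd 0 f) z = (k + 1) * (lam z ^ (-1 : ℤ) * circOp (k + 1) f z) := by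
  have h1 : dd 0 f = (-Complex.I) • ((fun z => lam z ^ (-1 : ℤ)) * pd 0 f) := by
    simp only [dd_eq, ddCoeff_zero, smul_mul_assoc]
  rw [h1, (opCirc k).smul _ ((isTorusFun_lam_zpow _).mul (hf.pd 0)), Pi.smul_apply,
    circOp_lam_inv_mul, circOp_pd_zero hf]
  simp only [Pi.smul_apply, smul_eq_mul]
  push_cast
  linear_combination (-(lam z ^ (-1 : ℤ) * circOp (k + 1) f z) * (k + 1)) * Complex.I_sq

theorem dd_of_ne_zero {i : Fin (n + 1)} (hi : i ≠ 0) (f : Pt n → ℂ) : dd i f = pd i f := by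
  ext z
  simp [dd, hi]

theorem pd_zero_fun (i : Fin (n + 1)) : pd i (0 : Pt n → ℂ) = 0 := (IsTorusOp.opPd i).zero

theorem IsPlus.dd {f : Pt n → ℂ} (hf : IsTorusFun f) (h : IsPlus f) (i : Fin (n + 1)) :
    IsPlus (dd i f) := fun k hk => by
  by_cases hi : i = 0
  · subst hi
    ext z
    rw [circOp_dd_zero hf]
    -- Only in degree -1 could the constant term in λ leak into negative degrees, and there the
    -- factor k + 1 vanishes.
    by_cases hk1 : k = -1
    · subst hk1; simp
    · simp [h (k + 1) (by omega)]
  · rw [dd_of_ne_zero hi, ← pd_circOp hf, h k hk, pd_zero_fun]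

theorem IsMinus.dd {f : Pt n → ℂ} (hf : IsTorusFun f) (h : IsMinus f) (i : Fin (n + 1)) :
    IsMinus (dd i f) := fun k hk => by
  by_cases hi : i = 0
  · subst hi
    ext z
    rw [circOp_dd_zero hf]
    simp [h (k + 1) (by omega)]
  · rw [dd_of_ne_zero hi, ← pd_circOp hf, h k hk, pd_zero_fun]

theorem circOp_lieD_eq_zero {a : Coeffs n} (ha : IsLoop a) {f : Pt n → ℂ} (hf : IsTorusFun f)
    {k : ℤ} (h : ∀ i, circOp k (coef a i * dd i f) = 0) : circOp k (lieD a f) = 0 := by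
  rw [lieD, (opCirc k).sum _ fun i _ => (ha.coef i).mul (hf.dd i)]
  exact Finset.sum_eq_zero fun i _ => h i

theorem isPlus_bracket {a b : Coeffs n} (ha : IsLoop a) (hb : IsLoop b)
    (ha' : ∀ j, IsPlus (coef a j)) (hb' : ∀ j, IsPlus (coef b j)) (j : Fin (n + 1)) :
    IsPlus (coef (bracket a b) j) := fun k hk => by
  rw [coef_bracket, (opCirc k).sub ((IsTorusOp.opLieD ha).torusFun (hb.coef j))
    ((IsTorusOp.opLieD hb).torusFun (ha.coef j)),
    circOp_lieD_eq_zero ha (hb.coef j) fun i => (IsPlus.mul (ha.coef i) ((hb.coef j).dd i) (ha' i)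
      (IsPlus.dd (hb.coef j) (hb' j) i)) k hk,
    circOp_lieD_eq_zero hb (ha.coef j) fun i => (IsPlus.mul (hb.coef i) ((ha.coef j).dd i) (hb' i)
      (IsPlus.dd (ha.coef j) (ha' j) i)) k hk, sub_self]

theorem isMinus_bracket {a b : Coeffs n} (ha : IsLoop a) (hb : IsLoop b)
    (ha' : ∀ j, IsMinus (coef a j)) (hb' : ∀ j, IsMinus (coef b j)) (j : Fin (n + 1)) :
    IsMinus (coef (bracket a b) j) := fun k hk => by
  rw [coef_bracket, (opCirc k).sub ((IsTorusOp.opLieD ha).torusFun (hb.coef j))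
    ((IsTorusOp.opLieD hb).torusFun (ha.coef j)),
    circOp_lieD_eq_zero ha (hb.coef j) fun i => (IsMinus.mul (ha.coef i) ((hb.coef j).dd i) (ha' i)
      (IsMinus.dd (hb.coef j) (hb' j) i)) k hk,
    circOp_lieD_eq_zero hb (ha.coef j) fun i => (IsMinus.mul (hb.coef i) ((ha.coef j).dd i) (hb' i)
      (IsMinus.dd (ha.coef j) (ha' j) i)) k hk, sub_self]

/-! ### The projections of vector fields -/

theorem lamCoeff_eq (a : Coeffs n) (k : ℕ) (x : Fin n → ℝ) (j : Fin (n + 1)) :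
    lamCoeff a k x j = circOp (k : ℤ) (coef a j) (Fin.cons 0 x : Pt n) := by
  rw [lamCoeff, circOp_eq]
  congr 1
  refine intervalIntegral.integral_congr fun θ _ => ?_
  have : (Fin.cons θ x : Pt n) = (Fin.cons 0 x : Pt n) + rot n θ := by
    ext i
    refine Fin.cases ?_ (fun i => ?_) i
    · simp [rot_zero]
    · simp [rot_succ]
  simp only [this, circMode, coef]
  push_cast
  rfl

theorem lamCoeff_mul_lam_pow {a : Coeffs n} (ha : IsLoop a) (k : ℕ) (z : Pt n)
    (j : Fin (n + 1)) : lamCoeff a k (fun i => z i.succ) j * lam z ^ k =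
      circOp (k : ℤ) (coef a j) z := by
  have hz : z = (Fin.cons 0 (fun i => z i.succ) : Pt n) + rot n (z 0) := by
    ext i
    refine Fin.cases ?_ (fun i => ?_) i
    · simp [rot_zero]
    · simp [rot_succ]
  have h1 : circMode (-(k : ℤ)) (z 0) = lam z ^ k := by
    rw [← zpow_natCast, lam_zpow, circMode]
    push_cast
    ring_nf
  conv_rhs => rw [hz, circOp_rot (ha.coef j), h1, ← lamCoeff_eq]
  rw [mul_comm]

theorem coef_plusPart {a : Coeffs n} (ha : IsLoop a) (j : Fin (n + 1)) :
    coef (plusPart a) j = plusOp (coef a j) := by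
  ext z
  exact tsum_congr fun k => lamCoeff_mul_lam_pow ha k z j

theorem IsPlot.plusPart {k : ℕ} {W : Set (Fin k → ℝ)} {a : (Fin k → ℝ) → Coeffs n}
    (ha : IsPlot W a) : IsPlot W fun s => plusPart (a s) :=
  isPlot_iff.2 fun j => (opPlus.family (ha.coef j)).congr fun s hs => coef_plusPart (ha.2.1 s hs) j

theorem IsLoop.plusPart {a : Coeffs n} (ha : IsLoop a) : IsLoop (plusPart a) :=
  isLoop_iff.2 fun j => by
    rw [coef_plusPart ha]
    exact opPlus.torusFun (ha.coef j)

theorem dpar_plusPart {k : ℕ} {W : Set (Fin k → ℝ)} {a : (Fin k → ℝ) → Coeffs n}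
    (ha : IsPlot W a) {s : Fin k → ℝ} (hs : s ∈ W) (i : Fin k) :
    dpar i (fun s => HolLoop.plusPart (a s)) s = HolLoop.plusPart (dpar i a s) :=
  coeffs_ext fun j => by
    rw [coef_plusPart (isLoop_dpar ha hs i), coef_dpar, coef_dpar, ← opPlus.parD (ha.coef j) s hs]
    exact IsTorusFamily.parD_congr (fun s hs => coef_plusPart (ha.2.1 s hs) j) ha.1 hs _

theorem plusPart_sub {a b : Coeffs n} (ha : IsLoop a) (hb : IsLoop b) :
    plusPart (a - b) = plusPart a - plusPart b := coeffs_ext fun j => by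
  rw [coef_sub, coef_plusPart (ha.sub hb), coef_plusPart ha, coef_plusPart hb, coef_sub,
    opPlus.sub (ha.coef j) (hb.coef j)]

theorem isPlus_plusPart {a : Coeffs n} (ha : IsLoop a) (j : Fin (n + 1)) :
    IsPlus (coef (plusPart a) j) := by
  rw [coef_plusPart ha]
  exact isPlus_plusOp (ha.coef j)

theorem isMinus_sub_plusPart {a : Coeffs n} (ha : IsLoop a) (j : Fin (n + 1)) :
    IsMinus (coef (a - plusPart a) j) := by
  rw [coef_sub, coef_plusPart ha]
  exact isMinus_sub_plusOp (ha.coef j)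

/-- The zero curvature identity for the positive parts of commuting vector fields. -/
theorem plusPart_bracket_of_commute {a b : Coeffs n} (ha : IsLoop a) (hb : IsLoop b)
    (hab : bracket a b = 0) :
    plusPart (bracket a (plusPart b)) - plusPart (bracket b (plusPart a)) =
      bracket (plusPart a) (plusPart b) := by
  have ha' := ha.plusPart
  have hb' := hb.plusPart
  have ham := ha.sub ha'
  have hbm := hb.sub hb'
  -- Expand [a - a₊, b - b₊] and drop [a, b] = 0.
  have hid : bracket a (plusPart b) - bracket b (plusPart a) =
      bracket (plusPart a) (plusPart b) - bracket (a - plusPart a) (b - plusPart b) := by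
    rw [bracket_sub_right ham hb hb', bracket_sub_left ha ha' hb, bracket_sub_left ha ha' hb', hab,
      bracket_antisymm b (plusPart a)]
    abel
  rw [← plusPart_sub (ha.bracket hb') (hb.bracket ha'), hid,
    plusPart_sub (ha'.bracket hb') (ham.bracket hbm)]
  have h1 : plusPart (bracket (plusPart a) (plusPart b)) = bracket (plusPart a) (plusPart b) :=
    coeffs_ext fun j => by
      rw [coef_plusPart (ha'.bracket hb')]
      exact IsPlus.plusOp_eq ((ha'.bracket hb').coef j)
        (isPlus_bracket ha' hb' (isPlus_plusPart ha) (isPlus_plusPart hb) j)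
  have h2 : plusPart (bracket (a - plusPart a) (b - plusPart b)) = 0 :=
    coeffs_ext fun j => by
      rw [coef_plusPart (ham.bracket hbm)]
      exact IsMinus.plusOp_eq
        (isMinus_bracket ham hbm (isMinus_sub_plusPart ha) (isMinus_sub_plusPart hb) j)
  rw [h1, h2, sub_zero]

variable {p : ℤ} {q : ℕ} {U : Set (Coeffs n)}

/-! ### Plots -/

theorem IsPlot.mono {k : ℕ} {W W' : Set (Fin k → ℝ)} {c : (Fin k → ℝ) → Coeffs n}
    (hc : IsPlot W c) (hW' : IsOpen W') (h : W' ⊆ W) : IsPlot W' c :=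
  isPlot_iff.2 fun j => (hc.coef j).mono hW' h

theorem IsPlot.neg {k : ℕ} {W : Set (Fin k → ℝ)} {c : (Fin k → ℝ) → Coeffs n}
    (hc : IsPlot W c) : IsPlot W fun s => -c s :=
  isPlot_iff.2 fun j => (hc.coef j).neg

theorem IsPlot.dpar_eq_deriv {k : ℕ} {W : Set (Fin k → ℝ)} {c : (Fin k → ℝ) → Coeffs n}
    (hc : IsPlot W c) {s : Fin k → ℝ} (hs : s ∈ W) (i : Fin k) (z : Pt n) (j : Fin (n + 1)) :
    HolLoop.dpar i c s z j = deriv (fun ε : ℝ => c (s + ε • Pi.single i 1) z j) 0 := by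
  have hd : DifferentiableAt ℝ (fun s => c s z j) s := (hc.coef j).differentiableAt_param hs z
  rw [HolLoop.dpar, ← hd.lineDeriv_eq_fderiv]
  rfl

theorem dpar_congr {k : ℕ} {W : Set (Fin k → ℝ)} {c c' : (Fin k → ℝ) → Coeffs n}
    (hW : IsOpen W) (h : ∀ s ∈ W, c s = c' s) {s : Fin k → ℝ} (hs : s ∈ W) (i : Fin k) :
    dpar i c s = dpar i c' s :=
  coeffs_ext fun j => IsTorusFamily.parD_congr (fun s hs => by rw [h s hs]) hW hs _

theorem IsPlot.dpar_comm {k : ℕ} {W : Set (Fin k → ℝ)} {c : (Fin k → ℝ) → Coeffs n}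
    (hc : IsPlot W c) {s : Fin k → ℝ} (hs : s ∈ W) (i i' : Fin k) :
    HolLoop.dpar i (HolLoop.dpar i' c) s = HolLoop.dpar i' (HolLoop.dpar i c) s :=
  coeffs_ext fun j => (hc.coef j).parD_comm hs _ _

/-- The family obtained by moving along the `i`-th parameter and adding multiples of `m`. -/
theorem IsPlot.variation {k : ℕ} {W : Set (Fin k → ℝ)} {c : (Fin k → ℝ) → Coeffs n}
    (hc : IsPlot W c) {m : Coeffs n} (hm : IsLoop m) (s : Fin k → ℝ) (v : Fin k → ℝ) :
    IsPlot {r : Fin 2 → ℝ | s + r 0 • v ∈ W} (fun r => c (s + r 0 • v) + r 1 • m) := by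
  have hφ : ContDiff ℝ ∞ fun r : Fin 2 → ℝ => s + r 0 • v := by fun_prop
  have hO : IsOpen {r : Fin 2 → ℝ | s + r 0 • v ∈ W} := hc.1.preimage hφ.continuous
  refine isPlot_iff.2 fun j => ?_
  have h1 := (hc.coef j).reparam hO hφ.contDiffOn fun r hr => hr
  have hψ : ContDiff ℝ ∞ fun r : Fin 2 → ℝ => ((r 1 : ℝ) : ℂ) :=
    Complex.ofRealCLM.contDiff.comp (contDiff_apply ℝ ℝ 1)
  exact h1.add (((hm.coef j).family hO).smul_param hψ.contDiffOn)

/-- Straight lines. -/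
theorem isPlot_line {l m : Coeffs n} (hl : IsLoop l) (hm : IsLoop m) :
    IsPlot univ (fun r : Fin 1 → ℝ => l + r 0 • m) := by
  refine isPlot_iff.2 fun j => ?_
  have hψ : ContDiff ℝ ∞ fun r : Fin 1 → ℝ => ((r 0 : ℝ) : ℂ) :=
    Complex.ofRealCLM.contDiff.comp (contDiff_apply ℝ ℝ 0)
  exact ((hl.coef j).family isOpen_univ).add
    (((hm.coef j).family isOpen_univ).smul_param hψ.contDiffOn)

theorem deriv_line (l m : Coeffs n) (z : Pt n) (j : Fin (n + 1)) :
    deriv (fun ε : ℝ => (l + ε • m) z j) 0 = m z j := by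
  have h : HasDerivAt (fun ε : ℝ => l z j + ε • m z j) ((1 : ℝ) • m z j) 0 :=
    ((hasDerivAt_id (0 : ℝ)).smul_const (m z j)).const_add (l z j)
  rw [one_smul] at h
  exact h.deriv

/-- Straight lines inside an open domain. -/
theorem IsOpenDomain.line (hU : IsOpenDomain U) {l m : Coeffs n} (hl : l ∈ U) (hm : IsLoop m) :
    ∃ W : Set (Fin 1 → ℝ), 0 ∈ W ∧ IsPlot W (fun r => l + r 0 • m) ∧
      MapsTo (fun r => l + r 0 • m) W U ∧ dpar 0 (fun r : Fin 1 → ℝ => l + r 0 • m) 0 = m := by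
  have hp := isPlot_line (hU.1 l hl) hm
  have hW := hU.2 1 _ _ hp
  refine ⟨{s : Fin 1 → ℝ | s ∈ univ ∧ l + s 0 • m ∈ U}, ⟨mem_univ _, by simpa using hl⟩,
    hp.mono hW (subset_univ _), fun r hr => hr.2, ?_⟩
  ext z j
  rw [hp.dpar_eq_deriv (mem_univ _)]
  simpa using deriv_line l m z j

theorem IsSmoothMap.isLoop {X : Coeffs n → Coeffs n} (hU : IsOpenDomain U) (hX : IsSmoothMap U X)
    {l : Coeffs n} (hl : l ∈ U) : IsLoop (X l) :=
  (hX 0 univ (fun _ => l) (isPlot_const isOpen_univ (hU.1 l hl)) fun _ _ => hl).2.1 0 (mem_univ _)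

theorem bracket_zero_right {a : Coeffs n} (ha : IsLoop a) : bracket a 0 = 0 := by
  simpa using bracket_sub_right ha ha ha

/-! ### Gradients of Casimir functions -/

/-- Differentiating ∂ᵢ h = (∂ᵢ c, ∇h) once more gives (∂ᵢ'∂ᵢ c, ∇h) + (∂ᵢ c, ∂ᵢ' ∇h). The total and
its first term are symmetric in i and i', hence so is the second. -/
theorem hessian_symm {h : Coeffs n → ℂ} {g : Coeffs n → Coeffs n}
    (hf : IsSmoothFunctional p q U h g) {k : ℕ} {W : Set (Fin k → ℝ)}
    {c : (Fin k → ℝ) → Coeffs n} (hc : IsPlot W c) (hcU : MapsTo c W U) {s : Fin k → ℝ}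
    (hs : s ∈ W) (i i' : Fin k) :
    pairing p q (dpar i c s) (dpar i' (fun s => g (c s)) s) =
      pairing p q (dpar i' c s) (dpar i (fun s => g (c s)) s) := by
  have hH := hf.smooth k W c hc hcU
  have hg := hf.smooth_grad k W c hc hcU
  have key : ∀ i i' : Fin k,
      fderiv ℝ (fun s => fderiv ℝ (fun s => h (c s)) s (Pi.single i 1)) s (Pi.single i' 1) =
      pairing p q (dpar i' (dpar i c) s) (g (c s)) +
        pairing p q (dpar i c s) (dpar i' (fun s => g (c s)) s) := fun i i' => by
    have he : (fun s => fderiv ℝ (fun s => h (c s)) s (Pi.single i 1)) =ᶠ[𝓝 s]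
        fun s => pairing p q (dpar i c s) (g (c s)) := by
      filter_upwards [hc.1.mem_nhds hs] with s hs using hf.grad k W c hc hcU s hs i
    rw [he.fderiv_eq, hasFDerivAt_pairing (hc.dpar i) hg hs]
  have hsym := fderiv_fderiv_apply_comm hc.1 hH hs (Pi.single i 1) (Pi.single i' 1)
  rw [key, key, hc.dpar_comm hs] at hsym
  exact add_left_cancel hsym

theorem IsCasimir.pairing_bracket {h : Coeffs n → ℂ} {g : Coeffs n → Coeffs n}
    (hC : IsCasimir p q U h g) {l b : Coeffs n} (hl : l ∈ U) (hb : IsLoop b) :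
    pairing p q l (bracket (g l) b) = 0 := by
  have h := (hC.casimir l hl).2 b hb
  rw [pairing_zero_left hb] at h
  exact neg_eq_zero.1 h.symm

/-- Infinitesimal equivariance of the gradient of a Casimir function. -/
theorem IsCasimir.dpar_grad (hU : IsOpenDomain U) {h : Coeffs n → ℂ} {g : Coeffs n → Coeffs n}
    (hC : IsCasimir p q U h g) {k : ℕ} {W : Set (Fin k → ℝ)} {c : (Fin k → ℝ) → Coeffs n}
    (hc : IsPlot W c) (hcU : MapsTo c W U) {s : Fin k → ℝ} (hs : s ∈ W) {i : Fin k}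
    {b : Coeffs n} (hb : IsLoop b) (hcb : dpar i c s = -coad p q b (c s)) :
    dpar i (fun s => g (c s)) s = bracket (g (c s)) b := by
  have hgc := hC.smooth_grad k W c hc hcU
  have hl := hc.2.1 s hs
  have hgl := hgc.2.1 s hs
  refine eq_of_pairing_right (p := p) (q := q) (isLoop_dpar hgc hs i) (hgl.bracket hb)
    fun m hm => ?_
  -- The second parameter moves c in the arbitrary direction m, while the first follows the given
  -- curve. The symmetry of the Hessian in these two parameters transfers the derivative of ∇h along
  -- c to its derivative D along m.
  set C : (Fin 2 → ℝ) → Coeffs n := fun r => c (s + r 0 • Pi.single i 1) + r 1 • m with hCdef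
  have hV := hc.variation hm s (Pi.single i 1)
  have hO := hU.2 2 _ _ hV
  have hC0 : C 0 = c s := by simp [hCdef]
  set V : Set (Fin 2 → ℝ) := _
  change IsOpen V at hO
  have hCp : IsPlot V C := hV.mono hO fun r hr => hr.1
  have hCU : MapsTo C V U := fun r hr => hr.2
  have h0 : (0 : Fin 2 → ℝ) ∈ V := ⟨by simpa using hs, by simpa using hcU hs⟩
  have hgC := hC.smooth_grad 2 V C hCp hCU
  have e1 : dpar 1 C 0 = m := by
    ext z j
    rw [hCp.dpar_eq_deriv h0]
    simpa [hCdef] using deriv_line (c s) m z j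
  have e2 : dpar 0 C 0 = dpar i c s := by
    ext z j
    rw [hCp.dpar_eq_deriv h0, hc.dpar_eq_deriv hs]
    simp [hCdef]
  have e3 : dpar 0 (fun r => g (C r)) 0 = dpar i (fun s => g (c s)) s := by
    ext z j
    rw [hgC.dpar_eq_deriv h0, hgc.dpar_eq_deriv hs]
    simp [hCdef]
  have hes := hessian_symm hC.toIsSmoothFunctional hCp hCU h0 0 1
  rw [e1, e2, e3] at hes
  set D := dpar 1 (fun r => g (C r)) 0 with hD
  have hDl : IsLoop D := isLoop_dpar hgC h0 1
  have hbp := isPlot_const (n := n) hO hb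
  have hz : (fun r => pairing p q (C r) (bracket (g (C r)) b)) =ᶠ[𝓝 0] fun _ => 0 := by
    filter_upwards [hO.mem_nhds h0] with r hr using hC.pairing_bracket (hCU hr) hb
  -- The derivative along m of the Casimir identity reads 0 = (m, [∇h, b]) + (ad*_b l, D). The
  -- Hessian symmetry reads -(ad*_b l, D) = (m, ∂ᵢ∇h). Adding them identifies ∂ᵢ∇h.
  have hder := hasFDerivAt_pairing (p := p) (q := q) hCp (hgC.bracket hbp) h0 1
  rw [hz.fderiv_eq, dpar_bracket hgC hbp h0, dpar_const, ← hD, e1, hC0, bracket_zero_right hgl,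
    add_zero, bracket_antisymm D b, pairing_neg_right hl (hb.bracket hDl),
    ← pairing_coad hb hl hDl] at hder
  rw [hcb, pairing_neg_left hDl (isCoadjoint_coad hb hl).1] at hes
  simp only [fderiv_fun_const, Pi.zero_apply, zero_apply] at hder
  linear_combination hder - hes

/-- Because ad*_{∇h₂(l)} l = 0, the constant family at l satisfies the hypothesis of the
equivariance formula with b = ∇h₂(l), and the derivative of ∇h₁ along it is 0. -/
theorem IsCasimir.bracket_grad (hU : IsOpenDomain U) {h₁ h₂ : Coeffs n → ℂ}
    {g₁ g₂ : Coeffs n → Coeffs n} (hC₁ : IsCasimir p q U h₁ g₁) (hC₂ : IsCasimir p q U h₂ g₂)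
    {l : Coeffs n} (hl : l ∈ U) : bracket (g₁ l) (g₂ l) = 0 := by
  have hp := isPlot_const (k := 1) isOpen_univ (hU.1 l hl)
  have h := hC₁.dpar_grad hU hp (fun _ _ => hl) (mem_univ 0) (i := 0)
    (hC₂.smooth_grad.isLoop hU hl) (by
      rw [dpar_const, coad_eq (hC₂.casimir l hl), neg_zero])
  rw [dpar_const] at h
  exact h.symm

/-! ### The flows -/

theorem isSmoothMap_flowField {g : Coeffs n → Coeffs n} (hg : IsSmoothMap U g) :
    IsSmoothMap U (flowField p q g) := fun k W c hc hcU =>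
  ((hg k W c hc hcU).plusPart.coad hc).neg

theorem pairing_flowField (hU : IsOpenDomain U) {g : Coeffs n → Coeffs n} (hg : IsSmoothMap U g)
    {l b : Coeffs n} (hl : l ∈ U) (hb : IsLoop b) :
    pairing p q (flowField p q g l) b = pairing p q l (bracket (plusPart (g l)) b) := by
  have hp := (hg.isLoop hU hl).plusPart
  rw [flowField, pairing_neg_left hb (isCoadjoint_coad hp (hU.1 l hl)).1,
    pairing_coad hp (hU.1 l hl) hb, neg_neg]

theorem rMap_eq (a : Coeffs n) : rMap a = plusPart a - (2⁻¹ : ℂ) • a := by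
  ext z j
  simp only [rMap, minusPart, Pi.smul_apply, Pi.sub_apply, smul_eq_mul]
  ring

theorem IsLoop.rMap {a : Coeffs n} (ha : IsLoop a) : IsLoop (rMap a) := by
  rw [rMap_eq]
  exact ha.plusPart.sub (ha.smul _)

/-- Since R a = a₊ - a/2, the R-bracket is [g₊, gf] plus the terms -[g, gf]/2 and [g, R gf], which
pair to zero with l by the Casimir property. -/
theorem IsCasimir.poissonR_eq (hU : IsOpenDomain U) {h : Coeffs n → ℂ} {g gf : Coeffs n → Coeffs n}
    (hC : IsCasimir p q U h g) (hgf : IsSmoothMap U gf) {l : Coeffs n} (hl : l ∈ U) :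
    poissonR p q g gf l = pairing p q l (bracket (plusPart (g l)) (gf l)) := by
  have hg := hC.smooth_grad.isLoop hU hl
  have hf := hgf.isLoop hU hl
  have hL := hU.1 l hl
  rw [poissonR, bracketR, pairing_add_right hL (hg.rMap.bracket hf) (hg.bracket hf.rMap),
    hC.pairing_bracket hl hf.rMap, add_zero, rMap_eq, bracket_sub_left hg.plusPart (hg.smul _) hf,
    bracket_antisymm ((2⁻¹ : ℂ) • g l), bracket_smul_right _ hf hg, bracket_antisymm (gf l) (g l),
    pairing_sub_right hL (hg.plusPart.bracket hf) (((hg.bracket hf).neg.smul _).neg),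
    smul_neg, neg_neg, pairing_smul_right _ hL (hg.bracket hf), hC.pairing_bracket hl hf,
    mul_zero, sub_zero]

/-- The first Casimir property reduces the bracket to (l, [g₁₊, g₂]), and the second kills that. -/
theorem IsCasimir.poissonR_eq_zero (hU : IsOpenDomain U) {h₁ h₂ : Coeffs n → ℂ}
    {g₁ g₂ : Coeffs n → Coeffs n} (hC₁ : IsCasimir p q U h₁ g₁) (hC₂ : IsCasimir p q U h₂ g₂)
    {l : Coeffs n} (hl : l ∈ U) : poissonR p q g₁ g₂ l = 0 := by
  have hg₁ := hC₁.smooth_grad.isLoop hU hl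
  have hg₂ := hC₂.smooth_grad.isLoop hU hl
  rw [hC₁.poissonR_eq hU hC₂.smooth_grad hl, bracket_antisymm,
    pairing_neg_right (hU.1 l hl) (hg₂.bracket hg₁.plusPart),
    hC₂.pairing_bracket hl hg₁.plusPart, neg_zero]

theorem IsCasimir.isHamiltonianField (hU : IsOpenDomain U) {h : Coeffs n → ℂ}
    {g : Coeffs n → Coeffs n} (hC : IsCasimir p q U h g) :
    IsHamiltonianField p q U g (flowField p q g) := by
  intro f gf hf l hl
  have hX : IsLoop (flowField p q g l) :=
    (isSmoothMap_flowField (p := p) (q := q) hC.smooth_grad).isLoop hU hl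
  obtain ⟨W, h0, hp, hm, hd⟩ := hU.line hl hX
  have hsm := hf.smooth 1 W _ hp hm
  have hgr := hf.grad 1 W _ hp hm 0 h0 0
  rw [hd] at hgr
  have e0 : l + (0 : Fin 1 → ℝ) 0 • flowField p q g l = l := by simp
  rw [e0, pairing_flowField hU hC.smooth_grad hl (hf.smooth_grad.isLoop hU hl),
    ← hC.poissonR_eq hU hf.smooth_grad hl] at hgr
  have hda := (differentiableAt_of_contDiffOn hp.1 hsm h0).hasFDerivAt
  have hlin : HasDerivAt (fun ε : ℝ => ε • (Pi.single 0 1 : Fin 1 → ℝ)) (Pi.single 0 1) 0 := by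
    simpa using (hasDerivAt_id (0 : ℝ)).smul_const (Pi.single 0 1 : Fin 1 → ℝ)
  have hda' : HasFDerivAt (fun s : Fin 1 → ℝ => f (l + s 0 • flowField p q g l))
      (fderiv ℝ (fun s : Fin 1 → ℝ => f (l + s 0 • flowField p q g l)) 0)
      ((fun ε : ℝ => ε • (Pi.single 0 1 : Fin 1 → ℝ)) 0) := by simpa using hda
  have hcomp := hda'.comp_hasDerivAt (0 : ℝ) hlin
  rw [hgr] at hcomp
  refine hcomp.congr_of_eventuallyEq (Eventually.of_forall fun ε => ?_)
  simp

/-- The flow of h₂ is -ad* of g₂₊, so the equivariance formula applies with b = g₂₊; P₊ commutes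
with the parameter derivative. -/
theorem IsCasimir.dpar_plusPart_grad (hU : IsOpenDomain U) {h₁ : Coeffs n → ℂ}
    {g₁ g₂ : Coeffs n → Coeffs n} (hC₁ : IsCasimir p q U h₁ g₁) (hg₂ : IsSmoothMap U g₂)
    {k : ℕ} {W : Set (Fin k → ℝ)} {c : (Fin k → ℝ) → Coeffs n}
    (hc : IsPlot W c) (hcU : MapsTo c W U) {s : Fin k → ℝ} (hs : s ∈ W) {i : Fin k}
    (hci : dpar i c s = flowField p q g₂ (c s)) :
    dpar i (fun s => plusPart (g₁ (c s))) s =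
      plusPart (bracket (g₁ (c s)) (plusPart (g₂ (c s)))) := by
  rw [dpar_plusPart (hC₁.smooth_grad k W c hc hcU) hs,
    hC₁.dpar_grad hU hc hcU hs (hg₂.isLoop hU (hcU hs)).plusPart hci]

theorem laxRelation_of_isJointSolution (hU : IsOpenDomain U) {hy ht : Coeffs n → ℂ}
    {gy gt : Coeffs n → Coeffs n} (hCy : IsCasimir p q U hy gy) (hCt : IsCasimir p q U ht gt)
    {W : Set (Fin 2 → ℝ)} {l : (Fin 2 → ℝ) → Coeffs n} (hl : IsPlot W l) (hlU : MapsTo l W U)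
    (h : IsJointSolution p q gt gy W l) : LaxRelation gt gy W l := fun s hs => by
  rw [hCt.dpar_plusPart_grad hU hCy.smooth_grad hl hlU hs (h s hs).2,
    hCy.dpar_plusPart_grad hU hCt.smooth_grad hl hlU hs (h s hs).1]
  exact plusPart_bracket_of_commute (hCt.smooth_grad.isLoop hU (hlU hs))
    (hCy.smooth_grad.isLoop hU (hlU hs)) (hCt.bracket_grad hU hCy (hlU hs))

/-- Both sides are mixed second derivatives of the family l; the Casimir property is not involved.
-/
theorem flowsCompatible_of_isJointSolution {gy gt : Coeffs n → Coeffs n}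
    {W : Set (Fin 2 → ℝ)} {l : (Fin 2 → ℝ) → Coeffs n} (hl : IsPlot W l)
    (h : IsJointSolution p q gt gy W l) : FlowsCompatible p q gt gy W l := fun s hs => by
  rw [← dpar_congr hl.1 (fun s hs => (h s hs).1) hs, ← dpar_congr hl.1 (fun s hs => (h s hs).2) hs]
  exact hl.dpar_comm hs 1 0

/-- Differentiate (X₁(c), b) = (c, [g₁₊, b]) along X₂. The first term comes from moving c, the
second from the evolution of g₁₊. -/
theorem IsCasimir.pairing_dpar_flowField (hU : IsOpenDomain U) {h₁ : Coeffs n → ℂ}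
    {g₁ g₂ : Coeffs n → Coeffs n} (hC₁ : IsCasimir p q U h₁ g₁) (hg₂ : IsSmoothMap U g₂)
    {k : ℕ} {W : Set (Fin k → ℝ)} {c : (Fin k → ℝ) → Coeffs n}
    (hc : IsPlot W c) (hcU : MapsTo c W U) {s : Fin k → ℝ} (hs : s ∈ W) {i : Fin k}
    (hci : dpar i c s = flowField p q g₂ (c s)) {b : Coeffs n} (hb : IsLoop b) :
    pairing p q (dpar i (fun s => flowField p q g₁ (c s)) s) b =
      pairing p q (c s) (bracket (plusPart (g₂ (c s))) (bracket (plusPart (g₁ (c s))) b)) +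
      pairing p q (c s) (bracket (plusPart (bracket (g₁ (c s)) (plusPart (g₂ (c s))))) b) := by
  have hX := isSmoothMap_flowField (p := p) (q := q) hC₁.smooth_grad k W c hc hcU
  have hb' := isPlot_const hc.1 hb
  have hP := (hC₁.smooth_grad k W c hc hcU).plusPart
  have h1 := hasFDerivAt_pairing (p := p) (q := q) hX hb' hs i
  have he : (fun s => pairing p q (flowField p q g₁ (c s)) b) =ᶠ[𝓝 s]
      fun s => pairing p q (c s) (bracket (plusPart (g₁ (c s))) b) := by
    filter_upwards [hc.1.mem_nhds hs] with s hs using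
      pairing_flowField hU hC₁.smooth_grad (hcU hs) hb
  rw [he.fderiv_eq, hasFDerivAt_pairing hc (hP.bracket hb') hs, dpar_bracket hP hb' hs,
    dpar_const, bracket_zero_right (hP.2.1 s hs), add_zero, hci,
    hC₁.dpar_plusPart_grad hU hg₂ hc hcU hs hci,
    pairing_flowField hU hg₂ (hcU hs) ((hP.2.1 s hs).bracket hb), pairing_comm _ _ _ 0,
    pairing_zero_left (hX.2.1 s hs), add_zero] at h1
  exact h1.symm

/-- Tested against b, the two derivatives differ by (l, [[g₁₊, g₂₊], b]) from the Jacobi identity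
minus (l, [P₊[g₁, g₂₊] - P₊[g₂, g₁₊], b]). The zero curvature identity makes these equal, and
nondegeneracy removes b. -/
theorem IsCasimir.commuteOn (hU : IsOpenDomain U) {h₁ h₂ : Coeffs n → ℂ}
    {g₁ g₂ : Coeffs n → Coeffs n} (hC₁ : IsCasimir p q U h₁ g₁) (hC₂ : IsCasimir p q U h₂ g₂) :
    CommuteOn U (flowField p q g₁) (flowField p q g₂) := by
  intro l hl z j
  have hX₁ := isSmoothMap_flowField (p := p) (q := q) hC₁.smooth_grad
  have hX₂ := isSmoothMap_flowField (p := p) (q := q) hC₂.smooth_grad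
  obtain ⟨W₁, h0₁, hp₁, hm₁, hd₁⟩ := hU.line hl (hX₁.isLoop hU hl)
  obtain ⟨W₂, h0₂, hp₂, hm₂, hd₂⟩ := hU.line hl (hX₂.isLoop hU hl)
  have e₁ : l + (0 : Fin 1 → ℝ) 0 • flowField p q g₁ l = l := by simp
  have e₂ : l + (0 : Fin 1 → ℝ) 0 • flowField p q g₂ l = l := by simp
  have hf₁ := hX₂ 1 W₁ _ hp₁ hm₁
  have hf₂ := hX₁ 1 W₂ _ hp₂ hm₂
  have key : dpar 0 (fun r : Fin 1 → ℝ => flowField p q g₂ (l + r 0 • flowField p q g₁ l)) 0 =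
      dpar 0 (fun r : Fin 1 → ℝ => flowField p q g₁ (l + r 0 • flowField p q g₂ l)) 0 := by
    refine eq_of_pairing_left (p := p) (q := q) (isLoop_dpar hf₁ h0₁ 0) (isLoop_dpar hf₂ h0₂ 0)
      fun b hb => ?_
    have k₁ := hC₂.pairing_dpar_flowField hU hC₁.smooth_grad hp₁ hm₁ h0₁ (i := 0)
      (by rw [hd₁, e₁]) hb
    have k₂ := hC₁.pairing_dpar_flowField hU hC₂.smooth_grad hp₂ hm₂ h0₂ (i := 0)
      (by rw [hd₂, e₂]) hb
    rw [e₁] at k₁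
    rw [e₂] at k₂
    have hL := hU.1 l hl
    have hG₁ := hC₁.smooth_grad.isLoop hU hl
    have hG₂ := hC₂.smooth_grad.isLoop hU hl
    have hP₁ := hG₁.plusPart
    have hP₂ := hG₂.plusPart
    have hz := plusPart_bracket_of_commute hG₁ hG₂ (hC₁.bracket_grad hU hC₂ hl)
    have hj := bracket_jacobi hP₁ hP₂ hb
    rw [← hz, bracket_sub_left (hG₁.bracket hP₂).plusPart (hG₂.bracket hP₁).plusPart hb] at hj
    have hj' := congrArg (pairing p q l) hj
    rw [pairing_sub_right hL ((hG₁.bracket hP₂).plusPart.bracket hb)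
        ((hG₂.bracket hP₁).plusPart.bracket hb),
      pairing_sub_right hL (hP₁.bracket (hP₂.bracket hb)) (hP₂.bracket (hP₁.bracket hb))] at hj'
    rw [k₁, k₂]
    linear_combination -hj'
  have k := congrFun (congrFun key z) j
  rw [hf₁.dpar_eq_deriv h0₁, hf₂.dpar_eq_deriv h0₂] at k
  simpa using k

/-! ### Holomorphic extension in the spectral parameter -/

/-- The degree in the spectral parameter of the part of nonnegative degree is at most `N`. -/
def DegLE (N : ℕ∞) (f : Pt n → ℂ) : Prop := ∀ k : ℕ, N < k → circOp (k : ℤ) f = 0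

/-- The domain of holomorphy of functions of degree at most `N`. -/
def specRegion (N : ℕ∞) : Set ℂ := if N = ⊤ then Metric.ball 0 1 else univ

theorem specRegion_top : specRegion ⊤ = Metric.ball 0 1 := if_pos rfl

theorem specRegion_coe (N : ℕ) : specRegion N = univ := if_neg (by simp)

theorem isOpen_specRegion (N : ℕ∞) : IsOpen (specRegion N) := by
  unfold specRegion
  split_ifs
  exacts [Metric.isOpen_ball, isOpen_univ]

theorem isPreconnected_specRegion (N : ℕ∞) : IsPreconnected (specRegion N) := by
  unfold specRegion
  split_ifs
  exacts [(convex_ball 0 1).isPreconnected, isPreconnected_univ]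

theorem ball_subset_specRegion (N : ℕ∞) : Metric.ball 0 1 ⊆ specRegion N := by
  unfold specRegion
  split_ifs
  exacts [Subset.rfl, subset_univ _]

/-- The extension `∑ fₖ μᵏ` of the part of nonnegative degree. -/
def extOp (μ : ℂ) (f : Pt n → ℂ) : Pt n → ℂ := fun z => ∑' k : ℕ, circOp (k : ℤ) f z * μ ^ k

theorem plusExt_eq (a : Coeffs n) (μ : ℂ) (x : Fin n → ℝ) (j : Fin (n + 1)) :
    plusExt a μ x j = extOp μ (coef a j) (Fin.cons 0 x) :=
  tsum_congr fun k => by rw [lamCoeff_eq]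

theorem DegLE.pd {N : ℕ∞} {f : Pt n → ℂ} (hf : IsTorusFun f) (h : DegLE N f) (i : Fin (n + 1)) :
    DegLE N (pd i f) := fun k hk => by
  rw [← pd_circOp hf, h k hk, pd_zero_fun]

theorem DegLE.dd {N : ℕ∞} {f : Pt n → ℂ} (hf : IsTorusFun f) (h : DegLE N f) (i : Fin (n + 1)) :
    DegLE N (dd i f) := fun k hk => by
  by_cases hi : i = 0
  · subst hi
    ext z
    have h1 := h (k + 1) (hk.trans_le (by exact_mod_cast Nat.le_succ k))
    push_cast at h1
    rw [circOp_dd_zero hf, h1]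
    simp
  · rw [dd_of_ne_zero hi]
    exact h.pd hf i k hk

theorem DegLE.parD {E : Type} [NormedAddCommGroup E] [NormedSpace ℝ E] [LocallyCompactSpace E]
    {W : Set E} {u : E → Pt n → ℂ} (hu : IsTorusFamily W u) {N : ℕ∞}
    (h : ∀ s ∈ W, DegLE N (u s)) (v : E) {s : E} (hs : s ∈ W) : DegLE N (parD v u s) :=
  fun k hk => by
    rw [← (opCirc (k : ℤ)).parD hu s hs v,
      IsTorusFamily.parD_congr (g := fun _ => 0) (fun s hs => h s hs k hk) hu.isOpen hs v,
      parD_const]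

theorem degLE_of_cons {N : ℕ∞} {f : Pt n → ℂ} (hf : IsTorusFun f)
    (h : ∀ k : ℕ, N < k → ∀ x : Fin n → ℝ, circOp (k : ℤ) f (Fin.cons 0 x) = 0) : DegLE N f :=
  fun k hk => by
    ext z
    have hz : z = (Fin.cons 0 (fun i => z i.succ) : Pt n) + rot n (z 0) := by
      ext i
      refine Fin.cases ?_ (fun i => ?_) i
      · simp [rot_zero]
      · simp [rot_succ]
    rw [hz, circOp_rot hf, h k hk]
    simp

theorem contDiff_circ_smul : ContDiff ℝ ∞ fun r : ℂ × ℝ => r.1 * circMode 1 r.2 := by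
  unfold circMode
  have : ContDiff ℝ ∞ fun r : ℂ × ℝ => ((r.2 : ℝ) : ℂ) :=
    Complex.ofRealCLM.contDiff.comp contDiff_snd
  fun_prop

theorem circMode_nat (k : ℕ) (θ : ℝ) : circMode (k : ℤ) θ = circMode 1 θ ^ k := by
  rw [circMode, circMode, ← Complex.exp_nat_mul]
  push_cast
  ring_nf

/-- For |μ| < 1 summing the geometric series gives the Cauchy kernel (2π)⁻¹ (1 - μ exp(-iθ))⁻¹; for
bounded degree the truncated sum is polynomial in μ. Either is smooth in (μ, θ), which makes the
extension jointly smooth in μ and all other variables. -/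
theorem exists_extOp_kernel (N : ℕ∞) : ∃ κ : ℂ × ℝ → ℂ,
    ContDiffOn ℝ ∞ κ (specRegion N ×ˢ univ) ∧ ∀ f : Pt n → ℂ, IsTorusFun f → DegLE N f →
      ∀ μ ∈ specRegion N,
        extOp μ f = convOp volume (rot n) (Icc 0 (2 * Real.pi)) (fun θ => κ (μ, θ)) f := by
  induction N using ENat.recTopCoe with
  | top =>
    rw [specRegion_top]
    have hlt : ∀ μ ∈ Metric.ball (0 : ℂ) 1, ∀ θ : ℝ, ‖μ * circMode 1 θ‖ < 1 := fun μ hμ θ => by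
      rw [norm_mul, norm_circMode, mul_one]
      simpa using hμ
    refine ⟨fun r => (2 * Real.pi : ℂ)⁻¹ * (1 - r.1 * circMode 1 r.2)⁻¹, ?_, ?_⟩
    · refine contDiffOn_const.mul
        ((contDiff_const.sub contDiff_circ_smul).contDiffOn.inv fun r hr h0 => ?_)
      have := hlt r.1 hr.1 r.2
      rw [← sub_eq_zero.1 h0, norm_one] at this
      exact lt_irrefl _ this
    · intro f hf _ μ hμ
      ext z
      have hμ1 : ‖μ‖ < 1 := by simpa using hμ
      have hc : Summable fun k : ℕ => (2 * Real.pi : ℂ)⁻¹ * μ ^ k :=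
        (summable_geometric_of_norm_lt_one hμ1).mul_left _
      have h := hasSum_convOp (μ := volume) (A := rot n) (K := Icc 0 (2 * Real.pi))
        (fun k : ℕ => continuous_circMode (k : ℤ)) (fun k θ => (norm_circMode _ θ).le) hc
        isCompact_Icc hf z
      have hk : (fun θ : ℝ => (2 * Real.pi : ℂ)⁻¹ * (1 - μ * circMode 1 θ)⁻¹) =
          fun θ => ∑' k : ℕ, (2 * Real.pi : ℂ)⁻¹ * μ ^ k * circMode (k : ℤ) θ := by
        ext θ
        rw [← tsum_geometric_of_norm_lt_one (hlt μ hμ θ), ← tsum_mul_left]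
        exact tsum_congr fun k => by rw [circMode_nat, mul_pow, mul_assoc]
      simp only [hk, ← h.tsum_eq]
      refine tsum_congr fun k => ?_
      rw [circOp, Pi.smul_apply, smul_eq_mul]
      ring
  | coe N =>
    rw [specRegion_coe]
    refine ⟨fun r => ∑ k ∈ Finset.range (N + 1),
      (2 * Real.pi : ℂ)⁻¹ * (r.1 * circMode 1 r.2) ^ k, ?_, ?_⟩
    · exact ContDiffOn.sum fun k _ => contDiffOn_const.mul (contDiff_circ_smul.pow k).contDiffOn
    · intro f hf hN μ _
      ext z
      rw [extOp, tsum_eq_sum (s := Finset.range (N + 1))]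
      · have hi : ∀ k ∈ Finset.range (N + 1), IntegrableOn (fun θ : ℝ =>
            (2 * Real.pi : ℂ)⁻¹ * (μ * circMode 1 θ) ^ k * f (z + rot n θ))
            (Icc 0 (2 * Real.pi)) volume := fun k _ =>
          (((continuous_const.mul ((continuous_const.mul (continuous_circMode 1)).pow k)).mul
            (continuous_translate hf (rot n) z)).continuousOn).integrableOn_compact isCompact_Icc
        simp only [convOp, Finset.sum_mul]
        rw [integral_finsetSum _ hi]
        refine Finset.sum_congr rfl fun k _ => ?_
        rw [circOp, Pi.smul_apply, smul_eq_mul, mul_right_comm, convOp, ← integral_const_mul]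
        congr 1
        ext θ
        rw [circMode_nat]
        ring
      · intro k hk
        rw [hN k (by simpa using hk)]
        simp

/-- The extension commutes with differentiation along the torus and in the parameters. -/
theorem extOp_family {E : Type} [NormedAddCommGroup E] [NormedSpace ℝ E] [LocallyCompactSpace E]
    {W : Set E} {u : E → Pt n → ℂ} (hu : IsTorusFamily W u) {N : ℕ∞}
    (h : ∀ s ∈ W, DegLE N (u s)) {μ : ℂ} (hμ : μ ∈ specRegion N) :
    (∀ s ∈ W, ∀ v, parD v (fun s => extOp μ (u s)) s = extOp μ (parD v u s)) ∧
    ∀ s ∈ W, ∀ i, pd i (extOp μ (u s)) = extOp μ (pd i (u s)) := by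
  obtain ⟨κ, hκ, hext⟩ := exists_extOp_kernel (n := n) N
  have hc : Continuous fun θ => κ (μ, θ) := by
    rw [← continuousOn_univ]
    exact hκ.continuousOn.comp (by fun_prop) fun θ _ => ⟨hμ, mem_univ _⟩
  constructor
  · intro s hs v
    rw [hext _ ((hu.parD v).torusFun hs) (DegLE.parD hu h v hs) μ hμ,
      ← (IsTorusOp.opConv (rot n) isCompact_Icc hc).parD hu s hs v]
    exact IsTorusFamily.parD_congr (fun s hs => hext _ (hu.torusFun hs) (h s hs) μ hμ)
      hu.isOpen hs v
  · intro s hs i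
    have hf := hu.torusFun hs
    rw [hext _ hf (h s hs) μ hμ, hext _ (hf.pd i) ((h s hs).pd hf i) μ hμ,
      pd_convOp hf isCompact_Icc hc]

/-- Joint smoothness of the extension. -/
theorem contDiffOn_extOp {W : Set (Fin 2 → ℝ)} {u : (Fin 2 → ℝ) → Pt n → ℂ}
    (hu : IsTorusFamily W u) {N : ℕ∞} (h : ∀ s ∈ W, DegLE N (u s)) :
    ContDiffOn ℝ ∞ (fun r : LaxPt n => extOp r.2.1 (u r.1) (Fin.cons 0 r.2.2))
      (W ×ˢ specRegion N ×ˢ univ) := by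
  obtain ⟨κ, hκ, hext⟩ := exists_extOp_kernel (n := n) N
  have hV : IsOpen (W ×ˢ specRegion N ×ˢ (univ : Set (Fin n → ℝ))) :=
    hu.isOpen.prod ((isOpen_specRegion N).prod isOpen_univ)
  have hcons : ContDiff ℝ ∞ fun r : LaxPt n × ℝ =>
      (Fin.cons 0 r.1.2.2 : Pt n) + rot n r.2 := by
    refine ContDiff.add (contDiff_pi.2 fun i => ?_) ((rot n).contDiff.comp contDiff_snd)
    refine Fin.cases ?_ (fun i => ?_) i
    · simpa using contDiff_const
    · simp only [Fin.cons_succ]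
      fun_prop
  have hG : ContDiffOn ℝ ∞ (fun r : LaxPt n × ℝ =>
      κ (r.1.2.1, r.2) * u r.1.1 ((Fin.cons 0 r.1.2.2 : Pt n) + rot n r.2))
      ((W ×ˢ specRegion N ×ˢ univ) ×ˢ univ) := by
    refine ContDiffOn.mul (hκ.comp (f := fun r : LaxPt n × ℝ => (r.1.2.1, r.2)) (by fun_prop)
      fun r hr => ⟨hr.1.2.1, mem_univ _⟩) ?_
    exact hu.contDiffOn.comp (f := fun r : LaxPt n × ℝ =>
      (r.1.1, (Fin.cons 0 r.1.2.2 : Pt n) + rot n r.2))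
      ((contDiff_fst.comp contDiff_fst).prodMk hcons).contDiffOn fun r hr => ⟨hr.1.1, mem_univ _⟩
  refine (contDiffOn_integral_kernel (μ := volume) hV (isCompact_Icc (a := (0 : ℝ))
    (b := 2 * Real.pi)) (κ := fun _ => 1) continuous_const hG).congr fun r hr => ?_
  rw [hext _ (hu.torusFun hr.1) (h _ hr.1) _ hr.2.1]
  simp only [convOp, one_mul]

theorem hasDerivAt_tsum_pow {c : ℕ → ℂ} {R : ℝ} (hR : 0 < R)
    (hc : Summable fun k : ℕ => ‖((k : ℂ) + 1) * c (k + 1)‖ * R ^ k) {μ : ℂ} (hμ : ‖μ‖ < R) :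
    HasDerivAt (fun μ => ∑' k, c k * μ ^ k) (∑' k : ℕ, ((k : ℂ) + 1) * c (k + 1) * μ ^ k) μ := by
  let b : ℕ → ℝ := fun k => ‖(k : ℂ) * c k‖ * R ^ (k - 1)
  have hb : Summable b := by
    rw [← summable_nat_add_iff 1]
    refine hc.congr fun k => ?_
    simp only [b, Nat.add_sub_cancel, Nat.cast_add, Nat.cast_one]
  have h := hasDerivAt_tsum_of_isPreconnected (g := fun k μ => c k * μ ^ k)
    (g' := fun k μ => c k * (k * μ ^ (k - 1))) hb (Metric.isOpen_ball (x := (0 : ℂ)) (ε := R))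
    (convex_ball 0 R).isPreconnected (fun k y _ => (hasDerivAt_pow k y).const_mul (c k))
    (fun k y hy => ?_) (Metric.mem_ball_self hR)
    (summable_of_hasFiniteSupport ((finite_singleton 0).subset fun k hk => by
      by_contra h0
      exact hk (by simp [show k ≠ 0 from h0])))
    (show μ ∈ Metric.ball 0 R by simpa using hμ)
  · have hs : Summable fun k : ℕ => c k * (k * μ ^ (k - 1)) :=
      Summable.of_norm_bounded hb fun k => by
        simp only [b]
        rw [← mul_assoc, norm_mul, norm_pow, mul_comm (c k)]
        gcongr
    have he : ∑' k : ℕ, c k * (k * μ ^ (k - 1)) = ∑' k : ℕ, ((k : ℂ) + 1) * c (k + 1) * μ ^ k := by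
      rw [hs.tsum_eq_zero_add]
      simp only [Nat.cast_zero, zero_mul, mul_zero, zero_add, Nat.add_sub_cancel]
      refine tsum_congr fun k => ?_
      push_cast
      ring
    rw [← he]
    exact h
  · simp only [b]
    rw [← mul_assoc, norm_mul, norm_pow, mul_comm (c k)]
    have : ‖y‖ ≤ R := by simpa using (Metric.mem_ball.1 hy).le
    gcongr

/-- In the disc, the series for the derivative is dominated with R = 1 because the Fourier series of
∂f/∂λ converges absolutely on the circle. In the polynomial case the sums are finite and any R > |μ|
will do. -/
theorem hasDerivAt_extOp {N : ℕ∞} {f : Pt n → ℂ} (hf : IsTorusFun f) (hN : DegLE N f) {μ : ℂ}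
    (hμ : μ ∈ specRegion N) (x : Fin n → ℝ) :
    HasDerivAt (fun μ => extOp μ f (Fin.cons 0 x)) (extOp μ (dd 0 f) (Fin.cons 0 x)) μ := by
  have hk : ∀ k : ℕ, circOp (k : ℤ) (dd 0 f) (Fin.cons 0 x) =
      ((k : ℂ) + 1) * circOp ((k + 1 : ℕ) : ℤ) f (Fin.cons 0 x) := fun k => by
    rw [circOp_dd_zero hf]
    simp [lam]
  simp only [extOp, hk]
  induction N using ENat.recTopCoe with
  | top =>
    rw [specRegion_top] at hμ
    refine hasDerivAt_tsum_pow (c := fun k : ℕ => circOp (k : ℤ) f (Fin.cons 0 x)) one_pos ?_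
      (by simpa using hμ)
    simpa [hk] using (summable_circOp_nat (hf.dd 0) (Fin.cons 0 x)).norm
  | coe N =>
    refine hasDerivAt_tsum_pow (c := fun k : ℕ => circOp (k : ℤ) f (Fin.cons 0 x))
      (R := ‖μ‖ + 1) (by positivity) ?_ (by simp)
    refine summable_of_hasFiniteSupport ((Finset.range (N + 1)).finite_toSet.subset fun k hk => ?_)
    by_contra h0
    refine hk ?_
    have : N < k + 1 := by simp at h0; omega
    simp only [hN (k + 1) (by exact_mod_cast this)]
    simp

/-- Continuity up to the circle is what links the extension on the open disc to its values at |λ| =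
1. -/
theorem continuousOn_extOp {f : Pt n → ℂ} (hf : IsTorusFun f) (z : Pt n) :
    ContinuousOn (fun μ => extOp μ f z) (Metric.closedBall 0 1) :=
  continuousOn_tsum (fun k => by fun_prop) (summable_circOp_nat hf z).norm fun k μ hμ => by
    rw [norm_mul, norm_pow]
    exact mul_le_of_le_one_right (norm_nonneg _)
      (pow_le_one₀ (norm_nonneg _) (by simpa using hμ))

theorem extOp_lam {f : Pt n → ℂ} (hf : IsTorusFun f) (θ : ℝ) (x : Fin n → ℝ) :
    extOp (lam (Fin.cons θ x : Pt n)) f (Fin.cons 0 x) = plusOp f (Fin.cons θ x) := by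
  have hz : (Fin.cons θ x : Pt n) = (Fin.cons 0 x : Pt n) + rot n θ := by
    ext i
    refine Fin.cases ?_ (fun i => ?_) i
    · simp [rot_zero]
    · simp [rot_succ]
  have h := (hasSum_plusOp_rot hf (Fin.cons 0 x) θ).tsum_eq
  rw [← hz] at h
  rw [← h]
  refine tsum_congr fun k => ?_
  rw [← zpow_natCast, lam_zpow, circMode]
  push_cast
  simp

/-- The derivations preserve both summands of the splitting into nonnegative and negative degrees,
hence commute with the projection. -/
theorem plusOp_dd {f : Pt n → ℂ} (hf : IsTorusFun f) (i : Fin (n + 1)) :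
    plusOp (dd i f) = dd i (plusOp f) := by
  have hp := opPlus.torusFun hf
  have h1 := IsPlus.plusOp_eq (hp.dd i) ((isPlus_plusOp hf).dd hp i)
  have h2 := IsMinus.plusOp_eq ((isMinus_sub_plusOp hf).dd (hf.sub hp) i)
  rw [(IsTorusOp.opDd i).sub hf hp, opPlus.sub (hf.dd i) (hp.dd i), h1, sub_eq_zero] at h2
  exact h2

/-! ### First order operators with complex coefficients -/

section Derivations

variable {E : Type} [NormedAddCommGroup E] [NormedSpace ℝ E] {V : Set E} {r : E} {f g : E → ℂ}

/-- The derivative in the complexified direction `w.1 + i w.2`. -/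
def cdir (w : E × E) (f : E → ℂ) : E → ℂ := fun r =>
  fderiv ℝ f r w.1 + Complex.I * fderiv ℝ f r w.2

theorem contDiffOn_cdir (hV : IsOpen V) (hf : ContDiffOn ℝ ∞ f V) (w : E × E) :
    ContDiffOn ℝ ∞ (cdir w f) V :=
  (contDiffOn_fderiv_apply hV hf _).add
    (contDiffOn_const.mul (contDiffOn_fderiv_apply hV hf _))

theorem cdir_add (hf : DifferentiableAt ℝ f r) (hg : DifferentiableAt ℝ g r) (w : E × E) :
    cdir w (fun r => f r + g r) r = cdir w f r + cdir w g r := by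
  simp only [cdir, fderiv_fun_add hf hg, add_apply]
  ring

theorem cdir_mul (hf : DifferentiableAt ℝ f r) (hg : DifferentiableAt ℝ g r) (w : E × E) :
    cdir w (fun r => f r * g r) r = cdir w f r * g r + f r * cdir w g r := by
  simp only [cdir, fderiv_fun_mul hf hg, add_apply, smul_apply, smul_eq_mul]
  ring

theorem cdir_sum {ι : Type*} {S : Finset ι} {f : ι → E → ℂ}
    (hf : ∀ i ∈ S, DifferentiableAt ℝ (f i) r) (w : E × E) :
    cdir w (fun r => ∑ i ∈ S, f i r) r = ∑ i ∈ S, cdir w (f i) r := by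
  simp only [cdir, fderiv_fun_sum hf, sum_apply, Finset.mul_sum, Finset.sum_add_distrib]

theorem cdir_congr (h : f =ᶠ[𝓝 r] g) (w : E × E) : cdir w f r = cdir w g r := by
  simp only [cdir, h.fderiv_eq]

theorem cdir_comm (hV : IsOpen V) (hf : ContDiffOn ℝ ∞ f V) (hr : r ∈ V) (w w' : E × E) :
    cdir w (cdir w' f) r = cdir w' (cdir w f) r := by
  have h : ∀ u v v' : E, fderiv ℝ (fun r => fderiv ℝ f r v + Complex.I * fderiv ℝ f r v') r u =
      fderiv ℝ (fun r => fderiv ℝ f r v) r u +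
        Complex.I * fderiv ℝ (fun r => fderiv ℝ f r v') r u := fun u v v' => by
    have h1 := differentiableAt_of_contDiffOn hV (contDiffOn_fderiv_apply hV hf v) hr
    have h2 := differentiableAt_of_contDiffOn hV (contDiffOn_fderiv_apply hV hf v') hr
    rw [fderiv_fun_add h1 (h2.const_mul _), fderiv_const_mul h2]
    rfl
  have hc := fun u v => fderiv_fderiv_apply_comm hV hf hr u v
  unfold cdir
  rw [h, h, h, h, hc w'.1 w.1, hc w'.2 w.1, hc w'.1 w.2, hc w'.2 w.2]
  ring

variable {ι : Type*} [Fintype ι] {e : ι → E × E} {a b : ι → E → ℂ} {w w' : E × E}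

/-- The first order operator `∂_w + ∑ aⱼ ∂_{eⱼ}`. -/
def transportOp (e : ι → E × E) (w : E × E) (a : ι → E → ℂ) (f : E → ℂ) : E → ℂ := fun r =>
  cdir w f r + ∑ j, a j r * cdir (e j) f r

theorem transportOp_congr (h : f =ᶠ[𝓝 r] g) :
    transportOp e w a f r = transportOp e w a g r := by
  simp only [transportOp, cdir_congr h]

theorem transportOp_zero : transportOp e w a (fun _ => 0) r = 0 := by
  simp [transportOp, cdir]

theorem transportOp_transportOp (hV : IsOpen V) (ha : ∀ j, ContDiffOn ℝ ∞ (a j) V)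
    (hf : ContDiffOn ℝ ∞ f V) (hr : r ∈ V) (w'' : E × E) :
    cdir w'' (transportOp e w a f) r = cdir w'' (cdir w f) r +
      ∑ j, (cdir w'' (a j) r * cdir (e j) f r + a j r * cdir w'' (cdir (e j) f) r) := by
  have hd : ∀ {g : E → ℂ}, ContDiffOn ℝ ∞ g V → DifferentiableAt ℝ g r :=
    fun hg => differentiableAt_of_contDiffOn hV hg hr
  have h1 : ∀ j, DifferentiableAt ℝ (fun r => a j r * cdir (e j) f r) r := fun j =>
    (hd (ha j)).mul (hd (contDiffOn_cdir hV hf _))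
  refine (cdir_add (hd (contDiffOn_cdir hV hf w)) (DifferentiableAt.fun_sum fun j _ => h1 j)
    _).trans ?_
  rw [cdir_sum fun j _ => h1 j]
  simp only [cdir_mul (hd (ha _)) (hd (contDiffOn_cdir hV hf _))]

/-- The commutator of two first order operators. -/
theorem transportOp_commutator (hV : IsOpen V) (ha : ∀ j, ContDiffOn ℝ ∞ (a j) V)
    (hb : ∀ j, ContDiffOn ℝ ∞ (b j) V) (hf : ContDiffOn ℝ ∞ f V) (hr : r ∈ V) :
    transportOp e w a (transportOp e w' b f) r - transportOp e w' b (transportOp e w a f) r =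
      ∑ j, (transportOp e w a (b j) r - transportOp e w' b (a j) r) * cdir (e j) f r := by
  have expand : ∀ {a b : ι → E → ℂ} {w w' : E × E}, (∀ j, ContDiffOn ℝ ∞ (b j) V) →
      transportOp e w a (transportOp e w' b f) r =
        ∑ j, transportOp e w a (b j) r * cdir (e j) f r + (cdir w (cdir w' f) r +
          ∑ i, a i r * cdir (e i) (cdir w' f) r + ∑ j, b j r * cdir w (cdir (e j) f) r +
          ∑ i, ∑ j, a i r * (b j r * cdir (e i) (cdir (e j) f) r)) := fun {a b w w'} hb => by
    have h1 : ∀ w'', _ := transportOp_transportOp (e := e) (w := w') hV hb hf hr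
    rw [transportOp]
    simp only [h1, transportOp, mul_add, add_mul, Finset.sum_add_distrib, Finset.mul_sum,
      Finset.sum_mul]
    rw [Finset.sum_comm (f := fun i j => a i r * (cdir (e i) (b j) r * cdir (e j) f r))]
    simp only [mul_assoc]
    ring
  -- The parenthesised part of each expansion contains all second derivatives and is symmetric under
  -- exchange of the two operators, since derivatives in complexified directions commute.
  rw [expand hb, expand ha, cdir_comm hV hf hr w' w,
    Finset.sum_comm (f := fun i j => b i r * (a j r * cdir (e i) (cdir (e j) f) r))]
  simp only [sub_mul, Finset.sum_sub_distrib, cdir_comm hV hf hr w,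
    fun j => cdir_comm hV hf hr w' (e j), mul_left_comm (b _ r),
    fun i j => cdir_comm hV hf hr (e j) (e i)]
  ring

end Derivations

/-! ### The linear system -/

/-- The complexified coordinate directions of `∂/∂λ` and `∂/∂xⱼ`. -/
def vertDir : Fin (n + 1) → LaxPt n × LaxPt n :=
  Fin.cons ((2⁻¹ : ℝ) • (0, 1, 0), (-2⁻¹ : ℝ) • (0, Complex.I, 0))
    fun j => ((0, 0, Pi.single j 1), 0)

theorem vertDeriv_eq (ψ : LaxPt n → ℂ) (r : LaxPt n) (j : Fin (n + 1)) :
    vertDeriv ψ r j = cdir (vertDir j) ψ r := by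
  refine Fin.cases ?_ (fun j => ?_) j
  · simp only [vertDeriv, vertDir, Fin.cons_zero, cdir, map_smul, Complex.real_smul]
    push_cast
    ring
  · simp [vertDeriv, vertDir, cdir]

theorem laxOp_eq (i : Fin 2) (g : Coeffs n → Coeffs n) (l : (Fin 2 → ℝ) → Coeffs n) :
    laxOp i g l = transportOp vertDir ((Pi.single i 1, 0, 0), 0)
      fun j r => plusExt (g (l r.1)) r.2.1 r.2.2 j := by
  ext ψ r
  simp [laxOp, transportOp, vertDeriv_eq, cdir]

/-- The coefficients of the commutator of the two operators of the linear system. -/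
def laxCurv (gt gy : Coeffs n → Coeffs n) (l : (Fin 2 → ℝ) → Coeffs n) (r : LaxPt n)
    (j : Fin (n + 1)) : ℂ :=
  laxOp 0 gt l (fun r => plusExt (gy (l r.1)) r.2.1 r.2.2 j) r -
    laxOp 1 gy l (fun r => plusExt (gt (l r.1)) r.2.1 r.2.2 j) r

/-- The linear system has smooth coefficients on the open set `V`. -/
def SmoothCoeffs (g : Coeffs n → Coeffs n) (l : (Fin 2 → ℝ) → Coeffs n) (V : Set (LaxPt n)) :
    Prop := ∀ j, ContDiffOn ℝ ∞ (fun r : LaxPt n => plusExt (g (l r.1)) r.2.1 r.2.2 j) V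

theorem laxOp_commutator {gt gy : Coeffs n → Coeffs n} {l : (Fin 2 → ℝ) → Coeffs n}
    {V : Set (LaxPt n)} (hV : IsOpen V) (ht : SmoothCoeffs gt l V) (hy : SmoothCoeffs gy l V)
    {ψ : LaxPt n → ℂ} (hψ : ContDiffOn ℝ ∞ ψ V) {r : LaxPt n} (hr : r ∈ V) :
    laxOp 0 gt l (laxOp 1 gy l ψ) r - laxOp 1 gy l (laxOp 0 gt l ψ) r =
      ∑ j, laxCurv gt gy l r j * vertDeriv ψ r j := by
  simp only [laxCurv, laxOp_eq, vertDeriv_eq]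
  exact transportOp_commutator hV ht hy hψ hr

/-- The commutator annihilates each common solution, since the other operator is applied to a
function that vanishes near r. This gives n + 1 linear equations for the curvature whose matrix is
the invertible Jacobian; local solutions suffice because the commutator is a local operator. -/
theorem laxCurv_eq_zero_of_invariants {gt gy : Coeffs n → Coeffs n}
    {l : (Fin 2 → ℝ) → Coeffs n} {W : Set (Fin 2 → ℝ)} {Ω : Set ℂ}
    (hV : IsOpen (W ×ˢ Ω ×ˢ (univ : Set (Fin n → ℝ))))
    (ht : SmoothCoeffs gt l (W ×ˢ Ω ×ˢ univ)) (hy : SmoothCoeffs gy l (W ×ˢ Ω ×ˢ univ))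
    (h : HasLocalInvariants gt gy W l Ω) {r : LaxPt n} (hr : r ∈ W ×ˢ Ω ×ˢ univ) :
    laxCurv gt gy l r = 0 := by
  obtain ⟨N, ψ, hN, hrN, hψ, hsol, hdet⟩ := h r hr.1 hr.2.1
  have hO := hV.inter hN
  have hrO : r ∈ (W ×ˢ Ω ×ˢ univ) ∩ N := ⟨hr, hrN⟩
  refine Matrix.eq_zero_of_mulVec_eq_zero hdet ?_
  ext i
  have h0 : laxOp 0 gt l (laxOp 1 gy l (ψ i)) r = 0 := by
    rw [laxOp_eq 0, transportOp_congr (g := fun _ => 0), transportOp_zero]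
    filter_upwards [hN.mem_nhds hrN] with r' hr' using (hsol i r' hr').2
  have h1 : laxOp 1 gy l (laxOp 0 gt l (ψ i)) r = 0 := by
    rw [laxOp_eq 1, transportOp_congr (g := fun _ => 0), transportOp_zero]
    filter_upwards [hN.mem_nhds hrN] with r' hr' using (hsol i r' hr').1
  have hc := laxOp_commutator hO (fun j => (ht j).mono inter_subset_left)
    (fun j => (hy j).mono inter_subset_left) ((hψ i).mono inter_subset_right) hrO
  rw [h0, h1, sub_zero] at hc
  simp only [Matrix.mulVec, dotProduct, Matrix.of_apply, Pi.zero_apply]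
  rw [hc]
  exact Finset.sum_congr rfl fun j _ => mul_comm _ _

/-- Test functions isolate the coefficients: ψ = λ has Wirtinger derivative 1 and no torus
derivatives, and ψ = exp(i xⱼ) replaces the coordinate xⱼ, which is not periodic. The latter has one
nonzero vertical derivative, i ψ, which vanishes nowhere. -/
theorem linearCompatible_iff {gt gy : Coeffs n → Coeffs n}
    {l : (Fin 2 → ℝ) → Coeffs n} {W : Set (Fin 2 → ℝ)} {Ω : Set ℂ}
    (hV : IsOpen (W ×ˢ Ω ×ˢ (univ : Set (Fin n → ℝ))))
    (ht : SmoothCoeffs gt l (W ×ˢ Ω ×ˢ univ)) (hy : SmoothCoeffs gy l (W ×ˢ Ω ×ˢ univ)) :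
    LinearCompatible gt gy W l Ω ↔
      ∀ r ∈ W ×ˢ Ω ×ˢ (univ : Set (Fin n → ℝ)), laxCurv gt gy l r = 0 := by
  constructor
  · intro h r hr
    ext j
    have key : ∀ ψ : LaxPt n → ℂ, ContDiff ℝ ∞ ψ →
        (∀ (i : Fin n) (r : LaxPt n), ψ (r + (0, 0, Pi.single i (2 * Real.pi))) = ψ r) →
        ∑ j, laxCurv gt gy l r j * vertDeriv ψ r j = 0 := fun ψ hψ hp => by
      rw [← laxOp_commutator hV ht hy hψ.contDiffOn hr, h ψ hψ hp r hr.1 hr.2.1, sub_self]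
    refine Fin.cases ?_ (fun j => ?_) j
    · have hd : ∀ u, fderiv ℝ (fun r : LaxPt n => r.2.1) r u = u.2.1 := fun u => by
        have := ((ContinuousLinearMap.fst ℝ ℂ (Fin n → ℝ)).comp
          (ContinuousLinearMap.snd ℝ (Fin 2 → ℝ) _)).hasFDerivAt (x := r)
        exact DFunLike.congr_fun this.fderiv u
      have hv : vertDeriv (fun r : LaxPt n => r.2.1) r = Pi.single 0 1 := by
        ext j
        refine Fin.cases ?_ (fun j => ?_) j
        · simp only [vertDeriv, Fin.cons_zero, hd, Pi.single_eq_same]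
          linear_combination (-2⁻¹ : ℂ) * Complex.I_sq
        · simp [vertDeriv, hd]
      have := key (fun r => r.2.1) (by fun_prop) fun i r => by simp
      rw [hv] at this
      simpa [Pi.single_apply] using this
    · let L : LaxPt n →L[ℝ] ℝ := (ContinuousLinearMap.proj j).comp
        ((ContinuousLinearMap.snd ℝ ℂ (Fin n → ℝ)).comp
          (ContinuousLinearMap.snd ℝ (Fin 2 → ℝ) (ℂ × (Fin n → ℝ))))
      let ψ : LaxPt n → ℂ := fun r => Complex.exp (Complex.I * (L r : ℂ))
      have hofL : HasFDerivAt (fun r : LaxPt n => (L r : ℂ)) (Complex.ofRealCLM.comp L) r :=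
        (Complex.ofRealCLM.comp L).hasFDerivAt
      have hd : ∀ u, fderiv ℝ ψ r u = ψ r * (Complex.I * (u.2.2 j : ℂ)) := fun u => by
        rw [((hofL.const_mul Complex.I).cexp).fderiv]
        rfl
      have hv : vertDeriv ψ r = Pi.single j.succ (Complex.I * ψ r) := by
        ext i
        refine Fin.cases ?_ (fun i => ?_) i
        · simp [vertDeriv, hd]
        · simp only [vertDeriv, Fin.cons_succ, hd]
          by_cases hij : i = j
          · subst hij
            simp [mul_comm]
          · rw [Pi.single_eq_of_ne (Ne.symm hij), Pi.single_eq_of_ne (by simpa using hij)]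
            simp
      have := key ψ ((contDiff_const.mul (Complex.ofRealCLM.comp L).contDiff).cexp) fun i r => by
        simp only [ψ, map_add]
        by_cases hij : i = j
        · subst hij
          have : L (0, 0, Pi.single i (2 * Real.pi)) = 2 * Real.pi := by simp [L]
          rw [this]
          push_cast
          rw [mul_add, Complex.exp_add, show Complex.I * (2 * (Real.pi : ℂ)) =
            2 * Real.pi * Complex.I by ring, Complex.exp_two_pi_mul_I, mul_one]
        · have : L (0, 0, Pi.single i (2 * Real.pi)) = 0 := by
            simp [L, Pi.single_eq_of_ne (Ne.symm hij)]
          rw [this, add_zero]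
      rw [hv] at this
      simpa [Pi.single_apply, ψ] using this
  · intro h ψ hψ _ r hr1 hr2
    have hr : r ∈ W ×ˢ Ω ×ˢ (univ : Set (Fin n → ℝ)) := ⟨hr1, hr2, mem_univ _⟩
    have hc := laxOp_commutator hV ht hy hψ.contDiffOn hr
    rw [h r hr] at hc
    simpa [sub_eq_zero] using hc

/-! ### The Lax relation and the linear system -/

section Extension

variable {W : Set (Fin 2 → ℝ)} {u : (Fin 2 → ℝ) → Pt n → ℂ} {N : ℕ∞} {r : LaxPt n}

theorem fderiv_extOp_param (hu : IsTorusFamily W u) (h : ∀ s ∈ W, DegLE N (u s))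
    (hr : r ∈ W ×ˢ specRegion N ×ˢ univ) (v : Fin 2 → ℝ) :
    fderiv ℝ (fun r : LaxPt n => extOp r.2.1 (u r.1) (Fin.cons 0 r.2.2)) r (v, 0, 0) =
      extOp r.2.1 (parD v u r.1) (Fin.cons 0 r.2.2) := by
  have hV : IsOpen (W ×ˢ specRegion N ×ˢ (univ : Set (Fin n → ℝ))) :=
    hu.isOpen.prod ((isOpen_specRegion N).prod isOpen_univ)
  have hd := (differentiableAt_of_contDiffOn hV (contDiffOn_extOp hu h) hr).hasFDerivAt
  have hc := HasFDerivAt.comp (f := fun s => (s, r.2)) r.1 hd (hasFDerivAt_prodMk_left r.1 r.2)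
  rw [← (extOp_family hu h hr.2.1).1 r.1 hr.1 v]
  exact (DFunLike.congr_fun hc.fderiv v).symm

/-- In λ the extension is holomorphic, so its real differential is multiplication by the complex
derivative and the Wirtinger derivative equals it. In x the derivative passes under the kernel; the
slice θ = 0 is parametrised by a linear embedding of the torus variables. -/
theorem vertDeriv_extOp (hu : IsTorusFamily W u) (h : ∀ s ∈ W, DegLE N (u s))
    (hr : r ∈ W ×ˢ specRegion N ×ˢ univ) (i : Fin (n + 1)) :
    vertDeriv (fun r : LaxPt n => extOp r.2.1 (u r.1) (Fin.cons 0 r.2.2)) r i =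
      extOp r.2.1 (dd i (u r.1)) (Fin.cons 0 r.2.2) := by
  have hV : IsOpen (W ×ˢ specRegion N ×ˢ (univ : Set (Fin n → ℝ))) :=
    hu.isOpen.prod ((isOpen_specRegion N).prod isOpen_univ)
  have hd := (differentiableAt_of_contDiffOn hV (contDiffOn_extOp hu h) hr).hasFDerivAt
  refine Fin.cases ?_ (fun i => ?_) i
  · have hp : HasFDerivAt (fun μ : ℂ => (r.1, μ, r.2.2))
        ((ContinuousLinearMap.inr ℝ (Fin 2 → ℝ) (ℂ × (Fin n → ℝ))).comp
          (ContinuousLinearMap.inl ℝ ℂ (Fin n → ℝ))) r.2.1 :=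
      (hasFDerivAt_prodMk_right r.1 (r.2.1, r.2.2)).comp r.2.1
        (hasFDerivAt_prodMk_left r.2.1 r.2.2)
    have hc := HasFDerivAt.comp (f := fun μ : ℂ => (r.1, μ, r.2.2)) r.2.1 hd hp
    have hh := (hasDerivAt_extOp (hu.torusFun hr.1) (h _ hr.1) hr.2.1
      r.2.2).hasFDerivAt.restrictScalars ℝ
    have he : ∀ c : ℂ, fderiv ℝ (fun r : LaxPt n => extOp r.2.1 (u r.1) (Fin.cons 0 r.2.2)) r
        (0, c, 0) = c * extOp r.2.1 (dd 0 (u r.1)) (Fin.cons 0 r.2.2) := fun c => by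
      simpa using DFunLike.congr_fun (hc.unique hh) c
    simp only [vertDeriv, Fin.cons_zero, he]
    linear_combination (-2⁻¹ * extOp r.2.1 (dd 0 (u r.1)) (Fin.cons 0 r.2.2)) * Complex.I_sq
  · have hp : HasFDerivAt (fun x : Fin n → ℝ => (r.1, r.2.1, x))
        ((ContinuousLinearMap.inr ℝ (Fin 2 → ℝ) (ℂ × (Fin n → ℝ))).comp
          (ContinuousLinearMap.inr ℝ ℂ (Fin n → ℝ))) r.2.2 :=
      (hasFDerivAt_prodMk_right r.1 (r.2.1, r.2.2)).comp r.2.2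
        (hasFDerivAt_prodMk_right r.2.1 r.2.2)
    have hc := HasFDerivAt.comp (f := fun x : Fin n → ℝ => (r.1, r.2.1, x)) r.2.2 hd hp
    obtain ⟨κ, hκ, hext⟩ := exists_extOp_kernel (n := n) N
    have hcont : Continuous fun θ => κ (r.2.1, θ) := by
      rw [← continuousOn_univ]
      exact hκ.continuousOn.comp (by fun_prop) fun θ _ => ⟨hr.2.1, mem_univ _⟩
    have hT : IsTorusFun (extOp r.2.1 (u r.1)) := by
      rw [hext _ (hu.torusFun hr.1) (h _ hr.1) _ hr.2.1]
      exact (IsTorusOp.opConv (rot n) isCompact_Icc hcont).torusFun (hu.torusFun hr.1)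
    let J : (Fin n → ℝ) →L[ℝ] Pt n := ContinuousLinearMap.pi
      (Fin.cons 0 fun i => ContinuousLinearMap.proj i)
    have hJ : ∀ x, J x = Fin.cons 0 x := fun x => by
      ext i
      refine Fin.cases ?_ (fun i => ?_) i <;> simp [J]
    have hc2 := (hT.differentiable (J r.2.2)).hasFDerivAt.comp r.2.2 J.hasFDerivAt
    have hc3 : HasFDerivAt ((fun r : LaxPt n => extOp r.2.1 (u r.1) (Fin.cons 0 r.2.2)) ∘
        fun x : Fin n → ℝ => (r.1, r.2.1, x)) ((fderiv ℝ (extOp r.2.1 (u r.1)) (J r.2.2)).comp J)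
        r.2.2 := by
      refine hc2.congr_of_eventuallyEq (Eventually.of_forall fun x => ?_)
      simp [hJ]
    have hJs : J (Pi.single i 1) = Pi.single i.succ 1 := by
      rw [hJ]
      ext k
      refine Fin.cases ?_ (fun k => ?_) k
      · simp
      · simp [Pi.single_apply]
    rw [dd_of_ne_zero (Fin.succ_ne_zero i), ← (extOp_family hu h hr.2.1).2 r.1 hr.1, ← hJ,
      pd, ← hJs]
    exact DFunLike.congr_fun (hc.unique hc3) (Pi.single i 1)

end Extension

/-- The extension to `λ = μ` of the coefficients of `c₊ - d₊ + [a₊, b₊]`. -/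
def extCurv (a b c d : Coeffs n) (x : Fin n → ℝ) (j : Fin (n + 1)) (μ : ℂ) : ℂ :=
  extOp μ (coef c j) (Fin.cons 0 x) - extOp μ (coef d j) (Fin.cons 0 x) +
    ∑ i, (extOp μ (coef a i) (Fin.cons 0 x) * extOp μ (dd i (coef b j)) (Fin.cons 0 x) -
      extOp μ (coef b i) (Fin.cons 0 x) * extOp μ (dd i (coef a j)) (Fin.cons 0 x))

/-- On the circle each extension takes the value of the corresponding P₊ part, and P₊ commutes with
the derivations. -/
theorem extCurv_lam {a b c d : Coeffs n} (ha : IsLoop a) (hb : IsLoop b) (hc : IsLoop c)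
    (hd : IsLoop d) (x : Fin n → ℝ) (j : Fin (n + 1)) (θ : ℝ) :
    extCurv a b c d x j (lam (Fin.cons θ x : Pt n)) =
    (plusPart c - plusPart d + bracket (plusPart a) (plusPart b)) (Fin.cons θ x) j := by
  change _ = coef (plusPart c - plusPart d + bracket (plusPart a) (plusPart b)) j (Fin.cons θ x)
  rw [coef_add, coef_sub, coef_bracket]
  simp only [lieD, coef_plusPart ha, coef_plusPart hb, coef_plusPart hc, coef_plusPart hd,
    extCurv, extOp_lam (ha.coef _), extOp_lam (hb.coef _), extOp_lam (hc.coef _),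
    extOp_lam (hd.coef _), extOp_lam ((ha.coef _).dd _), extOp_lam ((hb.coef _).dd _),
    plusOp_dd (ha.coef _), plusOp_dd (hb.coef _), Pi.add_apply, Pi.sub_apply, Finset.sum_apply,
    Pi.mul_apply, Finset.sum_sub_distrib]

theorem continuousOn_extCurv {a b c d : Coeffs n} (ha : IsLoop a) (hb : IsLoop b) (hc : IsLoop c)
    (hd : IsLoop d) (x : Fin n → ℝ) (j : Fin (n + 1)) :
    ContinuousOn (extCurv a b c d x j) (Metric.closedBall 0 1) :=
  ((continuousOn_extOp (hc.coef j) _).sub (continuousOn_extOp (hd.coef j) _)).add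
    (continuousOn_finsetSum _ fun i _ =>
      ((continuousOn_extOp (ha.coef i) _).mul (continuousOn_extOp ((hb.coef j).dd i) _)).sub
        ((continuousOn_extOp (hb.coef i) _).mul (continuousOn_extOp ((ha.coef j).dd i) _)))

theorem differentiableOn_extCurv {a b c d : Coeffs n} (ha : IsLoop a) (hb : IsLoop b) (hc : IsLoop c)
    (hd : IsLoop d) (x : Fin n → ℝ) (j : Fin (n + 1))
    {N : ℕ∞} (hNa : ∀ j, DegLE N (coef a j))
    (hNb : ∀ j, DegLE N (coef b j)) (hNc : ∀ j, DegLE N (coef c j))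
    (hNd : ∀ j, DegLE N (coef d j)) :
    DifferentiableOn ℂ (extCurv a b c d x j) (specRegion N) := by
  intro μ hμ
  have h : ∀ {f : Pt n → ℂ}, IsTorusFun f → DegLE N f →
      DifferentiableWithinAt ℂ (fun μ => extOp μ f (Fin.cons 0 x)) (specRegion N) μ :=
    fun hf hN => (hasDerivAt_extOp hf hN hμ x).differentiableAt.differentiableWithinAt
  exact ((h (hc.coef j) (hNc j)).sub (h (hd.coef j) (hNd j))).add
    (DifferentiableWithinAt.fun_sum fun i _ =>
      ((h (ha.coef i) (hNa i)).mul (h ((hb.coef j).dd i) ((hNb j).dd (hb.coef j) i))).sub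
        ((h (hb.coef i) (hNb i)).mul (h ((ha.coef j).dd i) ((hNa j).dd (ha.coef j) i))))

/-- From the region to the circle by continuity from the open disc. Conversely, the maximum
principle gives vanishing in the disc, and the identity theorem spreads it to the whole region when
that is ℂ. -/
theorem eqOn_zero_specRegion_iff {N : ℕ∞} {G : ℂ → ℂ} (hG : DifferentiableOn ℂ G (specRegion N))
    (hc : ContinuousOn G (Metric.closedBall 0 1)) :
    (∀ μ ∈ specRegion N, G μ = 0) ↔ ∀ μ : ℂ, ‖μ‖ = 1 → G μ = 0 := by
  have hcl : closure (Metric.ball (0 : ℂ) 1) = Metric.closedBall 0 1 :=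
    closure_ball 0 one_ne_zero
  constructor
  · intro h μ hμ
    have h0 : EqOn G (fun _ => 0) (Metric.ball 0 1) := fun μ hμ => h μ (ball_subset_specRegion N hμ)
    exact h0.of_subset_closure hc continuousOn_const Metric.ball_subset_closedBall hcl.ge
      (by simp [hμ])
  · intro h
    have hdc : DiffContOnCl ℂ G (Metric.ball 0 1) :=
      ⟨hG.mono (ball_subset_specRegion N), by rwa [hcl]⟩
    have h0 : EqOn G (fun _ => 0) (Metric.ball 0 1) :=
      Complex.eqOn_of_eqOn_frontier Metric.isBounded_ball hdc diffContOnCl_const fun μ hμ => by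
        rw [frontier_ball (0 : ℂ) one_ne_zero] at hμ
        exact h μ (by simpa using hμ)
    have hm : (0 : ℂ) ∈ Metric.ball (0 : ℂ) 1 := Metric.mem_ball_self one_pos
    exact (hG.analyticOnNhd (isOpen_specRegion N)).eqOn_zero_of_preconnected_of_eventuallyEq_zero
      (isPreconnected_specRegion N) (ball_subset_specRegion N hm)
      (h0.eventuallyEq_of_mem (Metric.isOpen_ball.mem_nhds hm))

/-! ### From the Lax relation on the circle to the curvature on Ω. -/

section

variable {gt gy : Coeffs n → Coeffs n} {W : Set (Fin 2 → ℝ)} {l : (Fin 2 → ℝ) → Coeffs n}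

theorem exists_degLE_of_isSpectralRegion (ht : IsPlot W fun s => gt (l s))
    (hy : IsPlot W fun s => gy (l s)) {Ω : Set ℂ} (hΩ : IsSpectralRegion gt gy W l Ω) :
    ∃ N : ℕ∞, Ω = specRegion N ∧ (∀ j, ∀ s ∈ W, DegLE N (coef (gt (l s)) j)) ∧
      ∀ j, ∀ s ∈ W, DegLE N (coef (gy (l s)) j) := by
  rcases hΩ with rfl | ⟨rfl, N, hN⟩
  · exact ⟨⊤, specRegion_top.symm, fun j s _ k hk => (not_top_lt hk).elim,
      fun j s _ k hk => (not_top_lt hk).elim⟩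
  · refine ⟨N, (specRegion_coe N).symm, fun j s hs => degLE_of_cons ((ht.2.1 s hs).coef j)
      fun k hk x => ?_, fun j s hs => degLE_of_cons ((hy.2.1 s hs).coef j) fun k hk x => ?_⟩
    · rw [← lamCoeff_eq]
      exact (hN s hs k (by exact_mod_cast hk) x j).1
    · rw [← lamCoeff_eq]
      exact (hN s hs k (by exact_mod_cast hk) x j).2

variable {N : ℕ∞}

theorem smoothCoeffs_specRegion {g : Coeffs n → Coeffs n} (h : IsPlot W fun s => g (l s))
    (hN : ∀ j, ∀ s ∈ W, DegLE N (coef (g (l s)) j)) :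
    SmoothCoeffs g l (W ×ˢ specRegion N ×ˢ univ) := fun j => by
  simp only [plusExt_eq]
  exact contDiffOn_extOp (h.coef j) (hN j)

theorem laxCurv_eq (ht : IsPlot W fun s => gt (l s)) (hy : IsPlot W fun s => gy (l s))
    (hNt : ∀ j, ∀ s ∈ W, DegLE N (coef (gt (l s)) j))
    (hNy : ∀ j, ∀ s ∈ W, DegLE N (coef (gy (l s)) j)) {r : LaxPt n}
    (hr : r ∈ W ×ˢ specRegion N ×ˢ univ) (j : Fin (n + 1)) :
    laxCurv gt gy l r j = extCurv (gt (l r.1)) (gy (l r.1)) (dpar 0 (fun s => gy (l s)) r.1)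
      (dpar 1 (fun s => gt (l s)) r.1) r.2.2 j r.2.1 := by
  simp only [laxCurv, laxOp, plusExt_eq, fderiv_extOp_param (ht.coef j) (hNt j) hr,
    fderiv_extOp_param (hy.coef j) (hNy j) hr, vertDeriv_extOp (ht.coef j) (hNt j) hr,
    vertDeriv_extOp (hy.coef j) (hNy j) hr, extCurv, coef_dpar, Finset.sum_sub_distrib]
  ring

/-- Fix the parameters, x and the component. The curvature is then a holomorphic function of λ whose
boundary values are ∂ₜA_y - ∂_yA_t + [A_t, A_y], so the boundary uniqueness statement applies.
Differentiation in the parameters preserves the degree bound. -/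
theorem laxRelation_iff_laxCurv (ht : IsPlot W fun s => gt (l s))
    (hy : IsPlot W fun s => gy (l s))
    (hNt : ∀ j, ∀ s ∈ W, DegLE N (coef (gt (l s)) j))
    (hNy : ∀ j, ∀ s ∈ W, DegLE N (coef (gy (l s)) j)) :
    LaxRelation gt gy W l ↔
      ∀ r ∈ W ×ˢ specRegion N ×ˢ (univ : Set (Fin n → ℝ)), laxCurv gt gy l r = 0 := by
  have hiff : ∀ s ∈ W, ∀ (x : Fin n → ℝ) (j : Fin (n + 1)), _ := fun s hs x j =>
    eqOn_zero_specRegion_iff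
      (differentiableOn_extCurv (ht.2.1 s hs) (hy.2.1 s hs) (isLoop_dpar hy hs 0)
        (isLoop_dpar ht hs 1) x j (fun j => hNt j s hs) (fun j => hNy j s hs)
        (fun j => DegLE.parD (hy.coef j) (hNy j) _ hs)
        (fun j => DegLE.parD (ht.coef j) (hNt j) _ hs))
      (continuousOn_extCurv (ht.2.1 s hs) (hy.2.1 s hs) (isLoop_dpar hy hs 0)
        (isLoop_dpar ht hs 1) x j)
  have hlam : ∀ s (hs : s ∈ W) (x : Fin n → ℝ) (j : Fin (n + 1)) (θ : ℝ), _ := fun s hs x j =>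
    extCurv_lam (ht.2.1 s hs) (hy.2.1 s hs) (isLoop_dpar hy hs 0) (isLoop_dpar ht hs 1) x j
  constructor
  · intro h r hr
    ext j
    rw [laxCurv_eq ht hy hNt hNy hr]
    refine (hiff r.1 hr.1 r.2.2 j).2 (fun μ hμ => ?_) r.2.1 hr.2.1
    obtain ⟨θ, rfl⟩ : ∃ θ : ℝ, lam (Fin.cons θ r.2.2 : Pt n) = μ := by
      refine ⟨μ.arg, ?_⟩
      have := Complex.norm_mul_exp_arg_mul_I μ
      rw [hμ, Complex.ofReal_one, one_mul] at this
      simpa [lam, mul_comm] using this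
    rw [hlam r.1 hr.1, ← dpar_plusPart hy hr.1, ← dpar_plusPart ht hr.1, ← h r.1 hr.1]
    simp
  · intro h s hs
    ext z j
    have h1 := (hiff s hs (fun i => z i.succ) j).1 (fun μ hμ => by
      have hr : (s, μ, fun i => z i.succ) ∈ W ×ˢ specRegion N ×ˢ (univ : Set (Fin n → ℝ)) :=
        ⟨hs, hμ, mem_univ _⟩
      have := congrFun (h _ hr) j
      rwa [laxCurv_eq ht hy hNt hNy hr] at this) _
      (norm_lam (Fin.cons (z 0) (fun i => z i.succ) : Pt n))
    rw [hlam s hs, ← dpar_plusPart hy hs, ← dpar_plusPart ht hs,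
      show (Fin.cons (z 0) (fun i => z i.succ) : Pt n) = z from Fin.cons_self_tail z] at h1
    simp only [Pi.add_apply, Pi.sub_apply] at h1 ⊢
    linear_combination -h1

end

end HolLoop

end

/-! ### Assembly of the proposition. -/

theorem proposition4p1 (n : ℕ) (p : ℤ) (q : ℕ)
    (U : Set (HolLoop.Coeffs n)) (hU : HolLoop.IsOpenDomain U)
    (hy ht : HolLoop.Coeffs n → ℂ) (gy gt : HolLoop.Coeffs n → HolLoop.Coeffs n)
    (hCy : HolLoop.IsCasimir p q U hy gy) (hCt : HolLoop.IsCasimir p q U ht gt) :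
    -- the two dynamical systems are given by well-defined smooth vector fields
    ((∀ l ∈ U,
        HolLoop.IsCoadjoint p q (HolLoop.plusPart (gy l)) l
          (HolLoop.coad p q (HolLoop.plusPart (gy l)) l) ∧
        HolLoop.IsCoadjoint p q (HolLoop.plusPart (gt l)) l
          (HolLoop.coad p q (HolLoop.plusPart (gt l)) l)) ∧
      HolLoop.IsSmoothMap U (HolLoop.flowField p q gy) ∧
      HolLoop.IsSmoothMap U (HolLoop.flowField p q gt)) ∧
    -- they are Hamiltonian
    (HolLoop.IsHamiltonianField p q U gy (HolLoop.flowField p q gy) ∧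
      HolLoop.IsHamiltonianField p q U gt (HolLoop.flowField p q gt)) ∧
    -- they commute
    ((∀ l ∈ U, HolLoop.poissonR p q gy gt l = 0) ∧
      HolLoop.CommuteOn U (HolLoop.flowField p q gy) (HolLoop.flowField p q gt)) ∧
    -- compatibility and the linear vector field system
    (∀ (W : Set (Fin 2 → ℝ)) (l : (Fin 2 → ℝ) → HolLoop.Coeffs n),
      HolLoop.IsPlot W l → Set.MapsTo l W U →
      ∀ Ω : Set ℂ, HolLoop.IsSpectralRegion gt gy W l Ω →
        (HolLoop.LaxRelation gt gy W l ↔ HolLoop.LinearCompatible gt gy W l Ω) ∧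
        (HolLoop.HasLocalInvariants gt gy W l Ω → HolLoop.LinearCompatible gt gy W l Ω) ∧
        (HolLoop.IsJointSolution p q gt gy W l →
          HolLoop.FlowsCompatible p q gt gy W l ∧ HolLoop.LaxRelation gt gy W l ∧
          (HolLoop.FlowsCompatible p q gt gy W l ↔
            HolLoop.LinearCompatible gt gy W l Ω))) := by
  refine ⟨⟨fun l hl => ⟨?_, ?_⟩, ?_, ?_⟩, ⟨?_, ?_⟩, ⟨fun l hl => ?_, ?_⟩, ?_⟩
  · exact HolLoop.isCoadjoint_coad (hCy.smooth_grad.isLoop hU hl).plusPart (hU.1 l hl)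
  · exact HolLoop.isCoadjoint_coad (hCt.smooth_grad.isLoop hU hl).plusPart (hU.1 l hl)
  · exact HolLoop.isSmoothMap_flowField hCy.smooth_grad
  · exact HolLoop.isSmoothMap_flowField hCt.smooth_grad
  · exact hCy.isHamiltonianField hU
  · exact hCt.isHamiltonianField hU
  · exact hCy.poissonR_eq_zero hU hCt hl
  · exact hCy.commuteOn hU hCt
  · intro W l hl hlU Ω hΩ
    have ht := hCt.smooth_grad 2 W l hl hlU
    have hy := hCy.smooth_grad 2 W l hl hlU
    -- The disc and the plane are handled together as the region of holomorphy for degree at most N,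
    -- with N = ⊤ imposing no bound and giving the disc.
    obtain ⟨N, rfl, hNt, hNy⟩ := HolLoop.exists_degLE_of_isSpectralRegion ht hy hΩ
    have hV : IsOpen (W ×ˢ HolLoop.specRegion N ×ˢ (Set.univ : Set (Fin n → ℝ))) :=
      hl.1.prod ((HolLoop.isOpen_specRegion N).prod isOpen_univ)
    have hst := HolLoop.smoothCoeffs_specRegion ht hNt
    have hsy := HolLoop.smoothCoeffs_specRegion hy hNy
    have hlin := HolLoop.linearCompatible_iff hV hst hsy
    have hlax := (HolLoop.laxRelation_iff_laxCurv ht hy hNt hNy).trans hlin.symm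
    refine ⟨hlax, fun h => hlin.2 fun r hr =>
      HolLoop.laxCurv_eq_zero_of_invariants hV hst hsy h hr, fun h => ?_⟩
    have hf := HolLoop.flowsCompatible_of_isJointSolution hl h
    have hL := HolLoop.laxRelation_of_isJointSolution hU hCy hCt hl hlU h
    -- Along a joint solution both sides of the last equivalence hold: flow compatibility by
    -- equality of mixed derivatives, linear compatibility through the Lax relation.
    exact ⟨hf, hL, fun _ => hlax.1 hL, fun _ => hf⟩
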